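/- Let $\mathfrak g$ be the Lie algebra of a connected compact Lie group, with an $\mathrm{Ad}$-invariant inner product (equivalently, a finite-dimensional real Lie algebra with an $\mathrm{ad}$-invariant inner product). Let $\mathbf T^3=\mathbf R^3/\mathbf Z^3$ and let $P=(P_s)_{s>0}$ be the heat semigroup on $\mathbf T^3$. For a segment $\ell=(x,v)\in\mathbf T^3\times\mathbf R^3$ write $|\ell|=|v|$ and $\int_\ell f=\int_0^1|v|f(x+tv)\,dt$, and let $|f|_{\mathrm{gr}\,\gamma}=\sup_{|\ell|\le 1/4}|\int_\ell f|/|\ell|^\gamma$ and $|f|_{\mathrm{gr}\,\alpha;<r}=\sup_{|\ell|\le 1/4,\,|\ell|<r}|\int_\ell f|/|\ell|^\alpha$. For a distribution $A\in\mathcal D'(\mathbf T^3,\mathfrak g^3)$ set $$\Sigma(A)=\sup_{s\in(0,1)}|P_sA|_{\mathrm{gr}\,\alpha;<s^\theta}+\sup_{s\in(0,1)}s^\delta\,|P_sA\otimes\nabla P_sA|_{\mathrm{gr}\,\gamma},\qquad \mathcal S^{\mathrm{YM}}=\{A:\Sigma(A)<\infty\}.$$ Assume $\alpha\in(0,\frac12)$,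 $\theta>0$, $\gamma\in(\frac12,1]$, $\delta\in(0,1)$, $\eta:=(1+2\theta)(\alpha-1)>-\frac23$, $\mu:=\gamma-1+2(1-\delta)\in(-\frac12,0)$, $\eta+\mu>-1$, and $$0<\nu\le\min\Big\{\tfrac\eta2+\tfrac\mu2+\tfrac12,\;1+\tfrac{3\eta}2,\;\mu+\tfrac12\Big\}.$$ Let $\mathcal F_sA$ be the value at time $s$ of the solution, continuous from $(0,T)$ to $\mathcal C^\infty(\mathbf T^3,\mathfrak g^3)$ for some $T>s$, of the DeTurck--Yang--Mills heat flow $$\partial_sU_i=\Delta U_i+\sum_{j=1}^3[U_j,\,2\partial_jU_i-\partial_iU_j+[U_j,U_i]],\qquad i=1,2,3,$$ with $U_0=A$, in the sense that $U_s\to A$ in $\mathcal D'$ as $s\downarrow0$ and $s^{-\mu/2}|U_s-P_sA|_\infty+s^{(1-\mu)/2}|\partial(U_s-P_sA)|_\infty$ is bounded near $s=0$. Then there are constants $c,q,C>0$, depending only on $\alpha,\theta,\gamma,\delta,\nu$ (and on $\mathfrak g$ with its inner product), such that for every $A\in\mathcal S^{\mathrm{YM}}$ and every $s>0$ with $s\le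 c$ and $s\,\Sigma(A)^q\le c$, the solution $\mathcal F_sA$ exists and is unique, the integral below converges absolutely at every point of $\mathbf T^3$, and $$\mathcal F_sA=P_sA+\int_0^sP_{s-r}(P_rA\,\partial P_rA)\,dr+R_sA,\qquad |R_sA|_\infty\le C\,s^\nu\big(\Sigma(A)+\Sigma(A)^3\big),$$ where $(P_rA\,\partial P_rA)_i=\sum_{j=1}^3[P_rA_j,\,2\partial_jP_rA_i-\partial_iP_rA_j]$. -/

import Mathlib

open Set Filter Topology MeasureTheory
open scoped TensorProduct ENNReal ContDiff

noncomputable section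

namespace YM

/-- A real Lie algebra together with an inner product for which every `ad x` is skew-symmetric.
In finite dimension these are exactly the Lie algebras of connected compact Lie groups `G`,
equipped with an `Ad`-invariant inner product. -/
class CompactLieAlgebra (𝔤 : Type*) extends
    NormedAddCommGroup 𝔤, LieRing 𝔤, InnerProductSpace ℝ 𝔤, LieAlgebra ℝ 𝔤 where
  inner_lie : ∀ x y z : 𝔤, inner ⁅x, y⁆ z = - inner y ⁅x, z⁆

/-- Euclidean space `ℝ³`. Functions on the torus `ℝ³ / ℤ³` are identified with `ℤ³`-periodic
functions on `ℝ³`. -/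
abbrev E3 : Type := EuclideanSpace ℝ (Fin 3)

/-- The space `𝔤³`. -/
abbrev Conn (𝔤 : Type*) : Type _ := PiLp 2 (fun _ : Fin 3 => 𝔤)

/-- The space `𝔤³ ⊗ (𝔤³)³`, with the Hilbert tensor norm. -/
abbrev QuadTarget (𝔤 : Type*) [CompactLieAlgebra 𝔤] : Type _ :=
  Conn 𝔤 ⊗[ℝ] PiLp 2 (fun _ : Fin 3 => Conn 𝔤)

def Periodic {F : Type*} (f : E3 → F) : Prop :=
  ∀ (x : E3) (j : Fin 3), f (x + EuclideanSpace.single j (1 : ℝ)) = f x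

/-- The unit cell `[0,1)³`. -/
def cell : Set E3 := {x | ∀ j, x j ∈ Ico (0 : ℝ) 1}

/-- The partial derivative `∂_j f (x)`. -/
def pd {F : Type*} [NormedAddCommGroup F] [NormedSpace ℝ F] (j : Fin 3) (f : E3 → F) (x : E3) : F :=
  fderiv ℝ f x (EuclideanSpace.single j (1 : ℝ))

/-- The space `C^∞(𝕋³, ℝ)` of test functions. -/
def TestFn : Submodule ℝ (E3 → ℝ) where
  carrier := {φ | ContDiff ℝ ∞ φ ∧ Periodic φ}
  add_mem' := fun ha hb =>
    ⟨ha.1.add hb.1, fun x j => by simp only [Pi.add_apply, ha.2 x j, hb.2 x j]⟩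
  zero_mem' := ⟨contDiff_const, fun _ _ => rfl⟩
  smul_mem' := fun c _ ha =>
    ⟨contDiff_const.smul ha.1, fun x j => by simp only [Pi.smul_apply, ha.2 x j]⟩

/-- `F`-valued distributions on the torus: linear maps `C^∞(𝕋³) → F` that are bounded by finitely
many of the seminorms `φ ↦ sup |D^k φ|`. -/
structure TDist (F : Type*) [NormedAddCommGroup F] [NormedSpace ℝ F] where
  toLin : TestFn →ₗ[ℝ] F
  bounded : ∃ (n : ℕ) (C : ℝ), ∀ (φ : TestFn) (M : ℝ),
    (∀ k ≤ n, ∀ x, ‖iteratedFDeriv ℝ k (φ : E3 → ℝ) x‖ ≤ M) → ‖toLin φ‖ ≤ C * M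

/-- The heat kernel on the torus. By definition of the theta function,
`heatKernel s x = ∏_j ∑_{n ∈ ℤ} exp (-4 π² n² s + 2 π i n x_j)` for `s > 0`
(every factor is real). -/
def heatKernel (s : ℝ) (x : E3) : ℝ :=
  ∏ j : Fin 3, (jacobiTheta₂ (x j : ℂ) ((4 * Real.pi * s : ℝ) * Complex.I)).re

theorem heatKernel_shift_mem (s : ℝ) (x : E3) : (fun y : E3 => heatKernel s (x - y)) ∈ TestFn := by
  constructor
  · unfold heatKernel
    apply contDiff_prod
    intro j _
    have h1 : ContDiff ℂ ∞
        (fun z : ℂ => jacobiTheta₂ z ((4 * Real.pi * s : ℝ) * Complex.I)) := by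
      by_cases hs : 0 < (((4 * Real.pi * s : ℝ) : ℂ) * Complex.I).im
      · exact Differentiable.contDiff fun z => differentiableAt_jacobiTheta₂_fst z hs
      · have : (fun z : ℂ => jacobiTheta₂ z ((4 * Real.pi * s : ℝ) * Complex.I)) = fun _ => 0 := by
          funext z
          exact jacobiTheta₂_undef z (not_lt.mp hs)
        rw [this]
        exact contDiff_const
    have h2 : ContDiff ℝ ∞ (fun y : E3 => (((x - y) j : ℝ) : ℂ)) := by
      have h3 : ContDiff ℝ ∞ (fun y : E3 => (x - y) j) := by
        have h4 : ContDiff ℝ ∞ (fun y : E3 => x - y) := contDiff_const.sub contDiff_id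
        exact (contDiff_euclidean.mp h4) j
      exact Complex.ofRealCLM.contDiff.comp h3
    exact Complex.reCLM.contDiff.comp ((h1.restrict_scalars ℝ).comp h2)
  · intro y i
    simp only [heatKernel]
    refine Finset.prod_congr rfl fun j _ => ?_
    by_cases hij : j = i
    · subst hij
      rw [← jacobiTheta₂_add_left ((((x - (y + EuclideanSpace.single j (1 : ℝ))) j : ℝ)) : ℂ)]
      congr 2
      simp
      ring
    · congr 2
      simp [hij]

/-- The test function `y ↦ p_s(x - y)`. -/
def heatTest (s : ℝ) (x : E3) : TestFn := ⟨fun y => heatKernel s (x - y), heatKernel_shift_mem s x⟩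

section Target

variable {F : Type*} [NormedAddCommGroup F] [NormedSpace ℝ F]

/-- The heat semigroup on distributions, `(P_s A)(x) = ⟨A, p_s(x - ·)⟩` for `s > 0`. -/
def heat (s : ℝ) (A : TDist F) (x : E3) : F := A.toLin (heatTest s x)

/-- The heat semigroup on (periodic) functions,
`(P_s f)(x) = ∫_{𝕋³} p_s(x - y) f(y) dy` for `s > 0`. -/
def heatFn (s : ℝ) (f : E3 → F) (x : E3) : F := ∫ y in cell, heatKernel s (x - y) • f y

/-- `∫_ℓ f = ∫_0^1 |v| f(x + t v) dt` for the segment `ℓ = (x, v)`. -/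
def lineInt (f : E3 → F) (x v : E3) : F := ∫ t in (0 : ℝ)..1, ‖v‖ • f (x + t • v)

/-- The norm `|f|_{gr γ}`, the supremum of `|∫_ℓ f| / |ℓ|^γ` over segments with `|ℓ| ≤ 1/4`. -/
def grNorm (γ : ℝ) (f : E3 → F) : ℝ≥0∞ :=
  ⨆ (x : E3) (v : E3) (_ : ‖v‖ ≤ 1 / 4), ENNReal.ofReal (‖lineInt f x v‖ / ‖v‖ ^ γ)

/-- The norm `|f|_{gr α; < r}`, in which only segments with `|ℓ| < r` are taken into account. -/
def grNormLt (α r : ℝ) (f : E3 → F) : ℝ≥0∞ :=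
  ⨆ (x : E3) (v : E3) (_ : ‖v‖ ≤ 1 / 4) (_ : ‖v‖ < r), ENNReal.ofReal (‖lineInt f x v‖ / ‖v‖ ^ α)

/-- The norm `sup_{s ∈ (0,1)} |P_s A|_{gr α; < s^θ}`. -/
def heatGr (α θ : ℝ) (A : TDist F) : ℝ≥0∞ :=
  ⨆ s ∈ Ioo (0 : ℝ) 1, grNormLt α (s ^ θ) (heat s A)

end Target

variable {𝔤 : Type*} [CompactLieAlgebra 𝔤]

/-- `N_s A = P_s A ⊗ ∇ P_s A`. -/
def quad (s : ℝ) (A : TDist (Conn 𝔤)) (x : E3) : QuadTarget 𝔤 :=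
  heat s A x ⊗ₜ[ℝ] WithLp.toLp 2 (fun j : Fin 3 => pd j (heat s A) x)

/-- The quantity `sup_{s ∈ (0,1)} s^δ |N_s A|_{gr γ}`. -/
def quadNorm (γ δ : ℝ) (A : TDist (Conn 𝔤)) : ℝ≥0∞ :=
  ⨆ s ∈ Ioo (0 : ℝ) 1, ENNReal.ofReal (s ^ δ) * grNorm γ (quad s A)

/-- The size functional `Σ(A)`. -/
def sigma (α θ γ δ : ℝ) (A : TDist (Conn 𝔤)) : ℝ≥0∞ := heatGr α θ A + quadNorm γ δ A

/-- The refined state space: all distributions `A` with `Σ(A) < ∞`. -/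
def stateSpace (𝔤 : Type*) [CompactLieAlgebra 𝔤] (α θ γ δ : ℝ) : Set (TDist (Conn 𝔤)) :=
  {A | sigma α θ γ δ A < ⊤}

def etaOf (α θ : ℝ) : ℝ := (1 + 2 * θ) * (α - 1)

def muOf (γ δ : ℝ) : ℝ := γ - 1 + 2 * (1 - δ)

/-- The standing condition on the exponents `α, θ, γ, δ`. -/
structure Init (α θ γ δ : ℝ) : Prop where
  alpha_mem : α ∈ Ioo (0 : ℝ) (1 / 2)
  theta_pos : 0 < θ
  gamma_mem : γ ∈ Ioc (1 / 2 : ℝ) 1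
  delta_mem : δ ∈ Ioo (0 : ℝ) 1
  eta_gt : -(2 / 3) < etaOf α θ
  mu_mem : muOf γ δ ∈ Ioo (-(1 / 2) : ℝ) 0
  eta_add_mu_gt : -1 < etaOf α θ + muOf γ δ

/-- The quadratic term `∑_j [u_j, 2 ∂_j u_i - ∂_i u_j]`, `i = 1, 2, 3`, written `u ∂u`. -/
def quadTerm (u : E3 → Conn 𝔤) (x : E3) : Conn 𝔤 :=
  WithLp.toLp 2 fun i : Fin 3 => ∑ j : Fin 3, ⁅u x j, (2 : ℝ) • pd j u x i - pd i u x j⁆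

/-- The cubic term `∑_j [u_j, [u_j, u_i]]`, `i = 1, 2, 3`. -/
def cubicTerm (u : E3 → Conn 𝔤) (x : E3) : Conn 𝔤 :=
  WithLp.toLp 2 fun i : Fin 3 => ∑ j : Fin 3, ⁅u x j, ⁅u x j, u x i⁆⁆

/-- `U` is a solution on `(0, T)` of the DeTurck--Yang--Mills heat flow
`∂_t U_i = Δ U_i + ∑_j [U_j, 2 ∂_j U_i - ∂_i U_j + [U_j, U_i]]`, `U_0 = A`.

The first three fields say that `U` is a continuous map from `(0, T)` to `C^∞(𝕋³, 𝔤³)`. The last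
two fields give the sense in which the (singular) initial condition is attained: `U_t → A` in the
sense of distributions, and `U_t - P_t A` lies, near `t = 0`, in the space with weights
`t^{-μ/2} |·|_∞` and `t^{-(μ-1)/2} |∂ ·|_∞` in which the flow is well-posed. -/
structure IsYMHeatFlow (μ : ℝ) (A : TDist (Conn 𝔤)) (T : ℝ) (U : ℝ → E3 → Conn 𝔤) : Prop where
  periodic : ∀ t ∈ Ioo 0 T, Periodic (U t)
  smooth : ∀ t ∈ Ioo 0 T, ContDiff ℝ ∞ (U t)
  continuous_time : ∀ n : ℕ, ContinuousOn
    (fun p : ℝ × E3 => iteratedFDeriv ℝ n (U p.1) p.2) (Ioo 0 T ×ˢ univ)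
  equation : ∀ t ∈ Ioo 0 T, ∀ x, HasDerivAt (fun r => U r x)
    (Laplacian.laplacian (U t) x + quadTerm (U t) x + cubicTerm (U t) x) t
  initial : ∀ φ : TestFn, Tendsto (fun t => ∫ x in cell, (φ : E3 → ℝ) x • U t x)
    (𝓝[>] 0) (𝓝 (A.toLin φ))
  wellposed_class : ∃ C : ℝ, ∀ᶠ t in 𝓝[>] (0 : ℝ), ∀ x,
    ‖U t x - heat t A x‖ ≤ C * t ^ (μ / 2) ∧
    ‖fderiv ℝ (fun y => U t y - heat t A y) x‖ ≤ C * t ^ ((μ - 1) / 2)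

/-- `u` is the value at time `s > 0` of a solution started from `A` that exists beyond time `s`. -/
def IsFlowValue (μ : ℝ) (A : TDist (Conn 𝔤)) (s : ℝ) (u : E3 → Conn 𝔤) : Prop :=
  ∃ (T : ℝ) (U : ℝ → E3 → Conn 𝔤), s ∈ Ioo 0 T ∧ IsYMHeatFlow μ A T U ∧ U s = u

open Classical in
/-- The Yang--Mills heat flow `F_s A`, `s > 0`: the value at time `s` of the solution started from
`A` if it exists beyond time `s` (and is unique), and `none` (the cemetery) otherwise. -/
def ymHeatFlow (μ : ℝ) (A : TDist (Conn 𝔤)) (s : ℝ) : Option (E3 → Conn 𝔤) :=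
  if h : ∃! u : E3 → Conn 𝔤, IsFlowValue μ A s u then some h.choose else none

/-- The integrand `P_{s-r} (P_r A ∂ P_r A) (x)`. -/
def duhamelIntegrand (s : ℝ) (A : TDist (Conn 𝔤)) (x : E3) (r : ℝ) : Conn 𝔤 :=
  heatFn (s - r) (quadTerm (heat r A)) x

end YM

end

open scoped Pointwise

set_option linter.unusedSectionVars false
set_option linter.unusedVariables false

noncomputable section

namespace YM

/-! ### The standard Gaussian measure and its density -/

open ProbabilityTheory

set_option maxSynthPendingDepth 3

universe u

/-! Write `H_t = P_t A` and `B(u, ∂u)`, `C(u, u, u)` for the quadratic and cubic terms. The local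
line-integral norm gives `|H_t| ≲ Σ t^{η/2}` and `|∂H_t| ≲ Σ t^{(η-1)/2}` (`exists_heat_bounds`).
These alone bound `B(H_t, ∂H_t)` only by `t^{η-1/2}`, which need not be integrable at `0`. The
second half of `Σ` repairs exactly this term: a function whose integral along every short segment is
at most `L |ℓ|^γ` satisfies `|P_h f| ≲ L h^{(γ-1)/2}` (`exists_norm_gauss_le_of_lineInt`), so `|P_h
B(H_r, ∂H_r)| ≲ Σ h^{(γ-1)/2} r^{-δ}`. Its Duhamel integral `v_t` therefore exists, has size `Σ
t^{μ/2}`, and has gradient of size `Σ t^{(μ-1)/2}`.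

The solution is sought as `U = H + w` with `w = v + ∫ P_{t-r} g_r dr`, where `g` is the nonlinearity
of `H + w` minus `B(H, ∂H)`. With `|w| ≲ t^{μ/2}` and `|∂w| ≲ t^{(μ-1)/2}`, the products left in `g`
have exponents `η/2 + μ/2 - 1/2` (one factor `H`), `μ - 1/2` (two factors `w`), and at worst `3η/2`
or `3μ/2` (cubic). The hypothesis on `ν` makes all of them at least `ν - 1`, so the Duhamel integral
of `g` is `O(t^ν)`, with constant `Σ² + Σ³`. It is the remainder `R`. On an interval of length `T ≤
1` with `T^ν (Σ + Σ²)` small, the map is a contraction in the weighted space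
(`exists_mild_solution`). The smallness condition is implied by `s ≤ c` and `s Σ^{2/ν} ≤ c`.

Three points remain. Smoothness: a mild solution with continuous source gains one derivative and a
half-Hölder bound, and with Hölder source two derivatives. Both gains together beat the derivative
lost in `B(U, ∂U)` (`Mild.reg_nonlin`), and smooth mild solutions are classical. Initial value:
`v_t` need not tend to `0` in sup norm, but tested against a smooth function it is controlled by
line integrals of the source, which are `O(r^{-δ})` (`Source.tendsto_pairing_duh`). Uniqueness: two
classical solutions are mild from each time `a > 0`. Letting `a → 0`, their difference is the
Duhamel integral of the difference of the nonlinearities, and a norm with weight `e^{-lt}` forces it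
to vanish (`IsFlow.unique_aux`).

All heat estimates use `P_h f(x) = E f(x + √(2h) Z)` with `Z` a standard Gaussian on `ℝ³`. The
theta-function kernel is identified with this average by Poisson summation, and the flow of a
distribution is handled through its Fourier series. -/

/-- The standard Gaussian measure on `ℝ³`. -/
abbrev gm : Measure E3 := stdGaussian E3

/-- The density of `gm`. -/
def gaussDensity (z : E3) : ℝ := (2 * Real.pi) ^ (-(3 / 2 : ℝ)) * Real.exp (-(1 / 2) * ‖z‖ ^ 2)

theorem gaussDensity_nonneg (z : E3) : 0 ≤ gaussDensity z := by unfold gaussDensity; positivity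

theorem continuous_gaussDensity : Continuous gaussDensity := by unfold gaussDensity; fun_prop

theorem integrable_exp_neg_mul_norm_sq {b : ℝ} (hb : 0 < b) :
    Integrable (fun z : E3 => Real.exp (-b * ‖z‖ ^ 2)) := by
  have h := GaussianFourier.integrable_cexp_neg_mul_sq_norm_add (V := E3) (b := (b : ℂ))
    (by simpa using hb) 0 0
  refine h.norm.congr (Eventually.of_forall fun z => ?_)
  simp [Complex.norm_exp, ← Complex.ofReal_pow]

theorem integrable_gaussDensity : Integrable gaussDensity :=
  (integrable_exp_neg_mul_norm_sq (by norm_num)).const_mul _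

/-- The two finite measures have the same characteristic function. A density is needed so that
derivatives can be moved from the averaged function onto the kernel. -/
theorem gm_eq_withDensity :
    gm = volume.withDensity fun z => ENNReal.ofReal (gaussDensity z) := by
  have : IsFiniteMeasure (volume.withDensity fun z => ENNReal.ofReal (gaussDensity z)) :=
    isFiniteMeasure_withDensity_ofReal integrable_gaussDensity.2
  apply Measure.ext_of_charFun
  funext t
  rw [charFun_stdGaussian, charFun_apply,
    integral_withDensity_eq_integral_toReal_smul
      (continuous_gaussDensity.measurable.ennreal_ofReal) (by simp)]
  have h := GaussianFourier.integral_cexp_neg_mul_sq_norm_add (V := E3) (b := (1 / 2 : ℂ))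
    (by norm_num) Complex.I t
  have e : ∀ z : E3, (ENNReal.ofReal (gaussDensity z)).toReal • Complex.exp (inner ℝ z t * Complex.I)
      = ((2 * Real.pi) ^ (-(3 / 2 : ℝ)) : ℝ) *
        Complex.exp (-(1 / 2) * ‖z‖ ^ 2 + Complex.I * inner ℝ t z) := by
    intro z
    rw [ENNReal.toReal_ofReal (gaussDensity_nonneg z), Complex.exp_add, gaussDensity,
      real_inner_comm]
    rw [Complex.real_smul]
    push_cast
    ring_nf
  simp_rw [e]
  rw [integral_const_mul, h]
  have h2 : ((Real.pi : ℂ) / (1 / 2)) ^ ((Module.finrank ℝ E3 : ℂ) / 2)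
      = (((2 * Real.pi) ^ (3 / 2 : ℝ) : ℝ) : ℂ) := by
    rw [Complex.ofReal_cpow (by positivity)]
    congr 1
    · push_cast; ring
    · simp
  rw [h2, ← mul_assoc, ← Complex.ofReal_mul, ← Real.rpow_add (by positivity)]
  norm_num

theorem integral_gm {F : Type*} [NormedAddCommGroup F] [NormedSpace ℝ F] (g : E3 → F) :
    ∫ z, g z ∂gm = ∫ z, gaussDensity z • g z := by
  rw [gm_eq_withDensity, integral_withDensity_eq_integral_toReal_smul
      (continuous_gaussDensity.measurable.ennreal_ofReal) (by simp)]
  simp_rw [ENNReal.toReal_ofReal (gaussDensity_nonneg _)]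

theorem aesm_of_continuous {G : Type*} [TopologicalSpace G] [TopologicalSpace.PseudoMetrizableSpace G]
    {f : E3 → G} (hf : Continuous f) (μ : Measure E3) : AEStronglyMeasurable f μ :=
  hf.aestronglyMeasurable

theorem integrable_norm_gm : Integrable (fun z : E3 => ‖z‖) gm :=
  (IsGaussian.integrable_id (μ := gm)).norm

/-! ### Periodic functions -/

section Periodic

variable {F : Type*}

theorem Periodic.add_int {f : E3 → F} (hf : Periodic f) (x : E3) (n : Fin 3 → ℤ) :
    f (x + WithLp.toLp 2 fun j => (n j : ℝ)) = f x := by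
  have h1 : ∀ (j : Fin 3) (m : ℤ) (y : E3), f (y + m • EuclideanSpace.single j (1 : ℝ)) = f y :=
    fun j m => Function.Periodic.zsmul (c := EuclideanSpace.single j (1 : ℝ)) (fun y => hf y j) m
  have h2 : (WithLp.toLp 2 fun j => (n j : ℝ) : E3) = n 0 • EuclideanSpace.single 0 (1 : ℝ) +
      n 1 • EuclideanSpace.single 1 (1 : ℝ) + n 2 • EuclideanSpace.single 2 (1 : ℝ) := by
    ext j
    fin_cases j <;> simp
  rw [h2, ← add_assoc, ← add_assoc, h1, h1, h1]

/-- The representative of a point of the torus in the unit cell. -/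
def fracE (x : E3) : E3 := WithLp.toLp 2 fun j => Int.fract (x j)

theorem Periodic.apply_fracE {f : E3 → F} (hf : Periodic f) (x : E3) : f (fracE x) = f x := by
  rw [← hf.add_int (fracE x) fun j => ⌊x j⌋]
  congr 1
  ext j
  simp [fracE]

theorem fracE_mem_cell (x : E3) : fracE x ∈ cell :=
  fun j => ⟨Int.fract_nonneg _, Int.fract_lt_one _⟩

/-- The closed unit cell. -/
def closedCell : Set E3 := {x | ∀ j, x j ∈ Icc (0 : ℝ) 1}

theorem cell_subset_closedCell : cell ⊆ closedCell := fun _ hx j => Ico_subset_Icc_self (hx j)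

theorem isCompact_closedCell : IsCompact closedCell := by
  have h : closedCell = (EuclideanSpace.equiv (Fin 3) ℝ).toHomeomorph ⁻¹'
      (Set.pi univ fun _ => Icc (0 : ℝ) 1) := by
    ext x
    simp [closedCell, Pi.le_def, forall_and]
  rw [h, Homeomorph.isCompact_preimage]
  exact isCompact_univ_pi fun _ => isCompact_Icc

variable [NormedAddCommGroup F]

/-- The cell is compact, so a bound at one parameter persists nearby, uniformly in space (tube
lemma). This provides the dominating functions for continuity in parameters. -/
theorem eventually_norm_le_of_periodic {X : Type*} [TopologicalSpace X] {S : Set X}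
    {u : X → E3 → F} (hu : ContinuousOn (fun q : X × E3 => u q.1 q.2) (S ×ˢ univ))
    (hper : ∀ p ∈ S, Periodic (u p)) {p₀ : X} (hp : p₀ ∈ S) :
    ∃ M, 0 ≤ M ∧ ∀ᶠ p in 𝓝[S] p₀, ∀ x, ‖u p x‖ ≤ M := by
  have hc : ContinuousOn (u p₀) closedCell := fun x _ =>
    ((hu (p₀, x) ⟨hp, mem_univ _⟩).comp (f := fun y : E3 => (p₀, y)) (s := closedCell)
      (by fun_prop : Continuous fun y : E3 => (p₀, y)).continuousWithinAt
      fun y _ => ⟨hp, mem_univ _⟩)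
  obtain ⟨M, hM⟩ := isCompact_closedCell.exists_bound_of_continuousOn hc
  refine ⟨|M| + 1, by positivity, ?_⟩
  rw [eventually_nhdsWithin_iff]
  have key : ∀ᶠ p in 𝓝 p₀, ∀ y ∈ closedCell, p ∈ S → ‖u p y‖ ≤ |M| + 1 := by
    refine isCompact_closedCell.eventually_forall_of_forall_eventually fun y hy => ?_
    have h1 := (hu (p₀, y) ⟨hp, mem_univ _⟩).norm
    have h2 : ∀ᶠ q in 𝓝[S ×ˢ univ] (p₀, y), ‖u q.1 q.2‖ < |M| + 1 :=
      h1.eventually (gt_mem_nhds (by have := hM y hy; have := le_abs_self M; simp only; linarith))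
    rw [eventually_nhdsWithin_iff] at h2
    exact h2.mono fun q hq hqS => (hq ⟨hqS, mem_univ _⟩).le
  filter_upwards [key] with p hp' hpS x
  rw [← (hper p hpS).apply_fracE x]
  exact hp' _ (cell_subset_closedCell (fracE_mem_cell x)) hpS

theorem Periodic.exists_bound {f : E3 → F} (hf : Periodic f) (hc : Continuous f) :
    ∃ M, 0 ≤ M ∧ ∀ x, ‖f x‖ ≤ M := by
  obtain ⟨M, hM⟩ := isCompact_closedCell.exists_bound_of_continuousOn hc.continuousOn
  refine ⟨|M|, abs_nonneg M, fun x => ?_⟩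
  rw [← hf.apply_fracE x]
  exact (hM _ (cell_subset_closedCell (fracE_mem_cell x))).trans (le_abs_self M)

end Periodic

/-! ### The heat semigroup as a Gaussian average -/

section Gauss

variable {F G : Type*} [NormedAddCommGroup F] [NormedSpace ℝ F]
  [NormedAddCommGroup G] [NormedSpace ℝ G]

/-- The heat semigroup on `ℝ³`, acting on functions. -/
def gauss (h : ℝ) (f : E3 → F) (x : E3) : F := ∫ z, f (x + √(2 * h) • z) ∂gm

/-- The derivative of `gauss h f`, for `h > 0`. -/
def gaussGrad (h : ℝ) (f : E3 → F) (x : E3) : E3 →L[ℝ] F :=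
  (√(2 * h))⁻¹ • ∫ z, (innerSL ℝ z).smulRight (f (x + √(2 * h) • z)) ∂gm

theorem norm_gauss_le {h M : ℝ} {f : E3 → F} (hM : ∀ x, ‖f x‖ ≤ M) (x : E3) :
    ‖gauss h f x‖ ≤ M :=
  (norm_integral_le_of_norm_le_const (μ := gm)
    (Eventually.of_forall fun z => hM (x + √(2 * h) • z))).trans (by simp)

theorem integrable_comp_gm {f : E3 → F} (hf : Continuous f) {M : ℝ} (hM : ∀ x, ‖f x‖ ≤ M)
    (x : E3) (σ : ℝ) : Integrable (fun z => f (x + σ • z)) gm :=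
  Integrable.of_bound (by fun_prop : Continuous fun z => f (x + σ • z)).aestronglyMeasurable M
    (Eventually.of_forall fun z => hM _)

/-- The mean length of a standard Gaussian vector. -/
def gmMean : ℝ := ∫ z : E3, ‖z‖ ∂gm

theorem gmMean_nonneg : 0 ≤ gmMean := integral_nonneg fun _ => norm_nonneg _

theorem continuous_smulRight_innerSL :
    Continuous fun p : E3 × F => (innerSL ℝ p.1).smulRight p.2 := by
  have h : (fun p : E3 × F => (innerSL ℝ p.1).smulRight p.2) = fun p : E3 × F =>
      ContinuousLinearMap.smulRightL ℝ E3 F (innerSL ℝ p.1) p.2 := rfl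
  rw [h]
  fun_prop

/-- The basic smoothing estimate: the Gaussian carries the derivative, at the price `h^{-1/2}`, and
`f` need only be bounded. -/
theorem norm_gaussGrad_le {h M : ℝ} {f : E3 → F} (hM : ∀ x, ‖f x‖ ≤ M) (x : E3) :
    ‖gaussGrad h f x‖ ≤ (√(2 * h))⁻¹ * (gmMean * M) := by
  rw [gaussGrad, norm_smul, norm_inv, Real.norm_of_nonneg (Real.sqrt_nonneg _)]
  gcongr
  rw [gmMean, ← integral_mul_const]
  refine norm_integral_le_of_norm_le (integrable_norm_gm.mul_const M)
    (Eventually.of_forall fun z => ?_)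
  rw [ContinuousLinearMap.norm_smulRight_apply, innerSL_apply_norm]
  gcongr
  exact hM _

theorem integrable_smulRight_gm {f : E3 → F} (hf : Continuous f) {M : ℝ} (hM : ∀ x, ‖f x‖ ≤ M)
    (x : E3) (σ : ℝ) : Integrable (fun z => (innerSL ℝ z).smulRight (f (x + σ • z))) gm := by
  refine (integrable_norm_gm.mul_const M).mono' ?_ (Eventually.of_forall fun z => ?_)
  · exact (continuous_smulRight_innerSL.comp
      (by fun_prop : Continuous fun z : E3 => (z, f (x + σ • z)))).aestronglyMeasurable
  · rw [ContinuousLinearMap.norm_smulRight_apply, innerSL_apply_norm]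
    gcongr
    exact hM _

theorem hasFDerivAt_gaussDensity (z : E3) :
    HasFDerivAt gaussDensity (-(gaussDensity z • innerSL ℝ z)) z := by
  have h := ((((hasStrictFDerivAt_norm_sq z).hasFDerivAt).const_mul (-(1 / 2) : ℝ)).exp).const_mul
    ((2 * Real.pi) ^ (-(3 / 2 : ℝ)))
  convert! h using 1
  ext v
  simp [gaussDensity]
  ring

/-- The left side is the norm of the derivative of the density at `w`; the right side is an
integrable majorant valid for all shifts of length at most one. -/
theorem gaussDensity_mul_norm_le {z w : E3} (h : ‖w - z‖ ≤ 1) :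
    gaussDensity w * ‖w‖ ≤
      (2 * Real.pi) ^ (-(3 / 2 : ℝ)) * Real.exp (1 / 4) * Real.exp (-(1 / 8) * ‖z‖ ^ 2) := by
  have h1 : ‖w‖ ≤ Real.exp (‖w‖ ^ 2 / 4) := by
    have := Real.add_one_le_exp (‖w‖ ^ 2 / 4)
    nlinarith [sq_nonneg (‖w‖ - 2)]
  have h2 : ‖z‖ ≤ ‖w‖ + 1 := by
    have := norm_sub_norm_le z w
    rw [norm_sub_rev] at this
    linarith
  have h3 : ‖z‖ ^ 2 ≤ 2 * ‖w‖ ^ 2 + 2 := by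
    have := norm_nonneg z
    nlinarith [sq_nonneg (‖w‖ - 1), norm_nonneg w]
  calc gaussDensity w * ‖w‖ ≤ gaussDensity w * Real.exp (‖w‖ ^ 2 / 4) := by
        gcongr
        exact gaussDensity_nonneg w
    _ = (2 * Real.pi) ^ (-(3 / 2 : ℝ)) * Real.exp (-(1 / 4) * ‖w‖ ^ 2) := by
        rw [gaussDensity, mul_assoc, ← Real.exp_add]
        ring_nf
    _ ≤ _ := by
        rw [mul_assoc, ← Real.exp_add]
        gcongr
        linarith

/-- A translation of the integration variable moves the dependence on the base point from `f`, which
is only continuous, onto the smooth Gaussian density. -/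
theorem hasFDerivAt_gauss [CompleteSpace F] {h : ℝ} (hh : 0 < h) {f : E3 → F} (hf : Continuous f)
    {M : ℝ} (hM : ∀ x, ‖f x‖ ≤ M) (x : E3) :
    HasFDerivAt (gauss h f) (gaussGrad h f x) x := by
  set σ := √(2 * h) with hσ
  have hσ0 : 0 < σ := Real.sqrt_pos.2 (by positivity)
  have hM0 : 0 ≤ M := (norm_nonneg _).trans (hM 0)
  have e : gauss h f = fun y => ∫ z, gaussDensity (z - σ⁻¹ • (y - x)) • f (x + σ • z) := by
    funext y
    rw [gauss, integral_gm,
      ← integral_sub_right_eq_self (fun z => gaussDensity z • f (y + σ • z)) (σ⁻¹ • (y - x))]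
    congr 1
    funext z
    congr 2
    rw [smul_sub, smul_smul, mul_inv_cancel₀ hσ0.ne', one_smul]
    abel
  have e2 : gaussGrad h f x = ∫ z, (gaussDensity (z - σ⁻¹ • (x - x)) • σ⁻¹ •
      innerSL ℝ (z - σ⁻¹ • (x - x))).smulRight (f (x + σ • z)) := by
    rw [gaussGrad, integral_gm, ← integral_smul]
    congr 1
    funext z
    ext v
    simp only [sub_self, smul_zero, sub_zero, _root_.smul_apply,
      ContinuousLinearMap.smulRight_apply, smul_smul, smul_eq_mul, ← hσ]
    congr 1
    ring
  rw [e, e2]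
  -- The radius `σ` makes the rescaled shift `σ⁻¹ (y - x)` have length at most one, as the majorant
  -- requires.
  refine hasFDerivAt_integral_of_dominated_of_fderiv_le
    (F' := fun y z => (gaussDensity (z - σ⁻¹ • (y - x)) • σ⁻¹ •
      innerSL ℝ (z - σ⁻¹ • (y - x))).smulRight (f (x + σ • z)))
    (bound := fun z => σ⁻¹ * M * ((2 * Real.pi) ^ (-(3 / 2 : ℝ)) * Real.exp (1 / 4) *
      Real.exp (-(1 / 8) * ‖z‖ ^ 2))) (s := Metric.ball x σ)
    (Metric.ball_mem_nhds x hσ0) ?_ ?_ ?_ ?_ ?_ ?_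
  · refine Eventually.of_forall fun y => Continuous.aestronglyMeasurable ?_
    have := continuous_gaussDensity
    fun_prop
  · refine (integrable_gaussDensity.mul_const M).mono' ?_ (Eventually.of_forall fun z => ?_)
    · refine aesm_of_continuous ?_ _
      have := continuous_gaussDensity
      fun_prop
    · rw [norm_smul, sub_self, smul_zero, sub_zero, Real.norm_of_nonneg (gaussDensity_nonneg z)]
      gcongr
      · exact gaussDensity_nonneg z
      · exact hM _
  · refine aesm_of_continuous ?_ _
    have h1 := continuous_gaussDensity
    have h2 := continuous_smulRight_innerSL (F := F)
    have h3 : (fun z => (gaussDensity (z - σ⁻¹ • (x - x)) • σ⁻¹ •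
      innerSL ℝ (z - σ⁻¹ • (x - x))).smulRight (f (x + σ • z))) = fun z =>
      gaussDensity z • σ⁻¹ • (innerSL ℝ z).smulRight (f (x + σ • z)) := by
      funext z
      ext v
      simp [smul_smul, mul_assoc]
    rw [h3]
    have h4 : Continuous fun z => (innerSL ℝ z).smulRight (f (x + σ • z)) :=
      h2.comp (by fun_prop : Continuous fun z : E3 => (z, f (x + σ • z)))
    exact h1.smul (h4.const_smul σ⁻¹)
  · refine Eventually.of_forall fun z y hy => ?_
    have hw : ‖(z - σ⁻¹ • (y - x)) - z‖ ≤ 1 := by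
      rw [sub_sub_cancel_left, norm_neg, norm_smul, norm_inv, Real.norm_of_nonneg hσ0.le,
        inv_mul_le_iff₀ hσ0, mul_one]
      exact (mem_ball_iff_norm.1 hy).le
    rw [ContinuousLinearMap.norm_smulRight_apply, norm_smul, norm_smul, innerSL_apply_norm,
      norm_inv, Real.norm_of_nonneg hσ0.le, Real.norm_of_nonneg (gaussDensity_nonneg _)]
    calc gaussDensity (z - σ⁻¹ • (y - x)) * (σ⁻¹ * ‖z - σ⁻¹ • (y - x)‖) * ‖f (x + σ • z)‖
        = σ⁻¹ * ‖f (x + σ • z)‖ *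
          (gaussDensity (z - σ⁻¹ • (y - x)) * ‖z - σ⁻¹ • (y - x)‖) := by ring
      _ ≤ _ := by
          exact mul_le_mul (mul_le_mul_of_nonneg_left (hM _) (by positivity))
            (gaussDensity_mul_norm_le hw)
            (mul_nonneg (gaussDensity_nonneg _) (norm_nonneg _)) (by positivity)
  · exact ((integrable_exp_neg_mul_norm_sq (by norm_num)).const_mul _).const_mul _
  · refine Eventually.of_forall fun z y _ => ?_
    have h1 : HasFDerivAt (fun y : E3 => z - σ⁻¹ • (y - x)) (-(σ⁻¹ • ContinuousLinearMap.id ℝ E3))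
        y := (((hasFDerivAt_id y).sub_const x).const_smul σ⁻¹).const_sub z
    have h2 := ((hasFDerivAt_gaussDensity (z - σ⁻¹ • (y - x))).comp y h1).smul_const
      (f (x + σ • z))
    convert! h2 using 1
    ext v
    simp [smul_smul]
    ring_nf

end Gauss

/-! ### Semigroup law, commutation with derivatives, and Hölder smoothing of Gaussian averages -/

section Gauss

variable {F G : Type*} [NormedAddCommGroup F] [NormedSpace ℝ F]
  [NormedAddCommGroup G] [NormedSpace ℝ G]

/-- Variances of independent Gaussians add, as the characteristic functions show. This is the
semigroup law at the level of measures. -/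
theorem map_add_smul_gm (a b : ℝ) :
    (gm.prod gm).map (fun p : E3 × E3 => a • p.1 + b • p.2) =
      gm.map fun z => √(a ^ 2 + b ^ 2) • z := by
  have : IsProbabilityMeasure ((gm.prod gm).map (fun p : E3 × E3 => a • p.1 + b • p.2)) :=
    Measure.isProbabilityMeasure_map (by fun_prop)
  have : IsProbabilityMeasure (gm.map fun z => √(a ^ 2 + b ^ 2) • z) :=
    Measure.isProbabilityMeasure_map (by fun_prop)
  apply Measure.ext_of_charFun
  funext t
  have e1 : ∀ (c : ℝ) (t : E3), ∫ z, Complex.exp (inner ℝ (c • z) t * Complex.I) ∂gm =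
      Complex.exp (-(c ^ 2 * ‖t‖ ^ 2) / 2) := by
    intro c t
    have h := charFun_stdGaussian (c • t)
    rw [charFun_apply] at h
    simp_rw [real_inner_smul_right] at h
    simp_rw [real_inner_smul_left]
    rw [h, norm_smul]
    push_cast
    congr 2
    rw [mul_pow, ← Complex.ofReal_pow ‖c‖, Real.norm_eq_abs, sq_abs]
    push_cast
    ring
  rw [charFun_apply, charFun_apply, integral_map (by fun_prop) (by fun_prop),
    integral_map (by fun_prop) (by fun_prop), e1, ← Complex.ofReal_pow (√_),
    Real.sq_sqrt (by positivity)]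
  have e2 : ∀ p : E3 × E3, Complex.exp (inner ℝ (a • p.1 + b • p.2) t * Complex.I) =
      Complex.exp (inner ℝ (a • p.1) t * Complex.I) * Complex.exp (inner ℝ (b • p.2) t * Complex.I) := by
    intro p
    rw [← Complex.exp_add, inner_add_left]
    push_cast
    ring_nf
  simp_rw [e2]
  rw [integral_prod_mul (fun z : E3 => Complex.exp (inner ℝ (a • z) t * Complex.I))
    (fun z : E3 => Complex.exp (inner ℝ (b • z) t * Complex.I)), e1, e1, ← Complex.exp_add]
  congr 1
  push_cast
  ring

theorem gauss_gauss {h k : ℝ} (hh : 0 ≤ h) (hk : 0 ≤ k) {f : E3 → F} (hf : Continuous f) {M : ℝ}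
    (hM : ∀ x, ‖f x‖ ≤ M) (x : E3) : gauss h (gauss k f) x = gauss (h + k) f x := by
  have hc : Continuous fun p : E3 × E3 => f (x + (√(2 * h) • p.1 + √(2 * k) • p.2)) := by fun_prop
  have h1 : gauss h (gauss k f) x =
      ∫ p : E3 × E3, f (x + (√(2 * h) • p.1 + √(2 * k) • p.2)) ∂(gm.prod gm) := by
    rw [integral_prod]
    · simp only [gauss, add_assoc]
    · exact Integrable.of_bound hc.aestronglyMeasurable M (Eventually.of_forall fun p => hM _)
  have h2 := integral_map (μ := gm.prod gm)
    (φ := fun p : E3 × E3 => √(2 * h) • p.1 + √(2 * k) • p.2) (f := fun y => f (x + y))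
    (by fun_prop) (by fun_prop : Continuous fun y => f (x + y)).aestronglyMeasurable
  rw [h1, ← h2, map_add_smul_gm, integral_map (by fun_prop)
    (by fun_prop : Continuous fun y => f (x + y)).aestronglyMeasurable, gauss,
    Real.sq_sqrt (by positivity), Real.sq_sqrt (by positivity), ← mul_add]

theorem gauss_zero [CompleteSpace F] (f : E3 → F) : gauss 0 f = f := by
  funext x
  simp [gauss]

theorem Periodic.gauss {f : E3 → F} (hf : Periodic f) (h : ℝ) : Periodic (gauss h f) := by
  intro x j
  unfold YM.gauss
  congr 1
  funext z
  rw [add_right_comm, hf]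

/-- The Gaussian is centred. Hence constants may be subtracted from `f` inside `gaussGrad`, which is
how Hölder continuity is exploited. -/
theorem gaussGrad_const [CompleteSpace F] (h : ℝ) (c : F) (x : E3) :
    gaussGrad h (fun _ => c) x = 0 := by
  have h1 := ((ContinuousLinearMap.smulRightL ℝ E3 F).flip c ∘L innerSL ℝ).integral_comp_comm
    (IsGaussian.integrable_id (μ := gm))
  have h2 : ∫ z : E3, (innerSL ℝ z).smulRight c ∂gm = 0 := by
    simp only [id, integral_id_stdGaussian, map_zero] at h1
    exact h1
  rw [gaussGrad, h2, smul_zero]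

theorem gaussGrad_sub {h : ℝ} {f g : E3 → F} (hf : Continuous f) (hg : Continuous g) {M N : ℝ}
    (hM : ∀ x, ‖f x‖ ≤ M) (hN : ∀ x, ‖g x‖ ≤ N) (x : E3) :
    gaussGrad h (fun y => f y - g y) x = gaussGrad h f x - gaussGrad h g x := by
  rw [gaussGrad, gaussGrad, gaussGrad, ← smul_sub, ← integral_sub
    (integrable_smulRight_gm hf hM x _) (integrable_smulRight_gm hg hN x _)]
  congr 2
  funext z
  ext v
  simp [smul_sub]

theorem gauss_sub {h : ℝ} {f g : E3 → F} (hf : Continuous f) (hg : Continuous g) {M N : ℝ}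
    (hM : ∀ x, ‖f x‖ ≤ M) (hN : ∀ x, ‖g x‖ ≤ N) (x : E3) :
    gauss h (fun y => f y - g y) x = gauss h f x - gauss h g x :=
  integral_sub (integrable_comp_gm hf hM x _) (integrable_comp_gm hg hN x _)

/-- Gaussian averages commute with differentiation. -/
theorem hasFDerivAt_gauss_fderiv [CompleteSpace F] (h : ℝ) {f : E3 → F}
    (hf : Differentiable ℝ f) (hf' : Continuous (fderiv ℝ f)) {M M' : ℝ} (hM : ∀ x, ‖f x‖ ≤ M)
    (hM' : ∀ x, ‖fderiv ℝ f x‖ ≤ M') (x : E3) :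
    HasFDerivAt (gauss h f) (gauss h (fderiv ℝ f) x) x := by
  have hc := hf.continuous
  refine hasFDerivAt_integral_of_dominated_of_fderiv_le
    (F' := fun y z => fderiv ℝ f (y + √(2 * h) • z)) (bound := fun _ => M') (s := univ)
    univ_mem ?_ (integrable_comp_gm hc hM x _) ?_ ?_ (integrable_const _) ?_
  · exact Eventually.of_forall fun y => aesm_of_continuous (by fun_prop) _
  · exact aesm_of_continuous (by fun_prop) _
  · exact Eventually.of_forall fun z y _ => hM' _
  · refine Eventually.of_forall fun z y _ => ?_
    exact (hasFDerivAt_comp_add_right (√(2 * h) • z)).2 (hf _).hasFDerivAt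

theorem gaussGrad_eq_gauss_fderiv [CompleteSpace F] {h : ℝ} (hh : 0 < h) {f : E3 → F}
    (hf : Differentiable ℝ f) (hf' : Continuous (fderiv ℝ f)) {M M' : ℝ} (hM : ∀ x, ‖f x‖ ≤ M)
    (hM' : ∀ x, ‖fderiv ℝ f x‖ ≤ M') (x : E3) :
    gaussGrad h f x = gauss h (fderiv ℝ f) x :=
  (hasFDerivAt_gauss hh hf.continuous hM x).unique
    (hasFDerivAt_gauss_fderiv h hf hf' hM hM' x)

theorem fderiv_gauss [CompleteSpace F] {h : ℝ} (hh : 0 < h) {f : E3 → F} (hf : Continuous f)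
    {M : ℝ} (hM : ∀ x, ‖f x‖ ≤ M) : fderiv ℝ (gauss h f) = gaussGrad h f :=
  funext fun x => (hasFDerivAt_gauss hh hf hM x).fderiv

/-- Continuity of weighted Gaussian averages in all parameters. -/
theorem continuousOn_integral_gm {X : Type*} [TopologicalSpace X] [FirstCountableTopology X]
    {S : Set X} {u : X → E3 → F} (hu : ContinuousOn (fun q : X × E3 => u q.1 q.2) (S ×ˢ univ))
    (hper : ∀ p ∈ S, Periodic (u p)) {σ : X → ℝ} (hσ : ContinuousOn σ S)
    {K : E3 → F → G} (hK : Continuous fun q : E3 × F => K q.1 q.2) {κ : E3 → ℝ}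
    (hκ : ∀ z y, ‖K z y‖ ≤ κ z * ‖y‖) (hκi : Integrable κ gm) (hκ0 : ∀ z, 0 ≤ κ z) :
    ContinuousOn (fun q : X × E3 => ∫ z, K z (u q.1 (q.2 + σ q.1 • z)) ∂gm) (S ×ˢ univ) := by
  rintro ⟨p₀, x₀⟩ ⟨hp₀, -⟩
  obtain ⟨M, hM0, hM⟩ := eventually_norm_le_of_periodic hu hper hp₀
  have hslice : ∀ p ∈ S, Continuous (u p) := fun p hp => by
    rw [← continuousOn_univ]
    exact hu.comp (by fun_prop : ContinuousOn (fun y : E3 => (p, y)) univ) fun y _ => ⟨hp, mem_univ _⟩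
  have hfst : Tendsto (fun q : X × E3 => q.1) (𝓝[S ×ˢ univ] (p₀, x₀)) (𝓝[S] p₀) := by
    rw [nhdsWithin_prod_eq]
    exact tendsto_fst
  refine continuousWithinAt_of_dominated (bound := fun z => κ z * M) ?_ ?_ (hκi.mul_const M) ?_
  · filter_upwards [self_mem_nhdsWithin] with q hq
    have h1 := hslice q.1 hq.1
    exact aesm_of_continuous
      (hK.comp (by fun_prop : Continuous fun z => (z, u q.1 (q.2 + σ q.1 • z)))) _
  · filter_upwards [hfst.eventually hM] with q hq
    exact Eventually.of_forall fun z => (hκ _ _).trans (by gcongr; exact hκ0 z; exact hq _)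
  · refine Eventually.of_forall fun z => ?_
    have h1 : ContinuousWithinAt (fun q : X × E3 => (q.1, q.2 + σ q.1 • z)) (S ×ˢ univ) (p₀, x₀) := by
      have h2 : ContinuousWithinAt (fun q : X × E3 => σ q.1) (S ×ˢ univ) (p₀, x₀) :=
        (hσ p₀ hp₀).comp continuous_fst.continuousWithinAt fun q hq => hq.1
      exact continuous_fst.continuousWithinAt.prodMk
        (continuous_snd.continuousWithinAt.add (h2.smul continuousWithinAt_const))
    have h3 := ContinuousWithinAt.comp (x := (p₀, x₀)) (f := fun q : X × E3 => (q.1, q.2 + σ q.1 • z))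
      (hu (p₀, x₀ + σ p₀ • z) ⟨hp₀, mem_univ _⟩) h1 fun q hq => ⟨hq.1, mem_univ _⟩
    exact (hK.comp (by fun_prop : Continuous fun y : F => (z, y))).continuousAt.comp_continuousWithinAt h3

theorem continuousOn_gauss {X : Type*} [TopologicalSpace X] [FirstCountableTopology X]
    {S : Set X} {u : X → E3 → F} (hu : ContinuousOn (fun q : X × E3 => u q.1 q.2) (S ×ˢ univ))
    (hper : ∀ p ∈ S, Periodic (u p)) {h : X → ℝ} (hh : ContinuousOn h S) :
    ContinuousOn (fun q : X × E3 => gauss (h q.1) (u q.1) q.2) (S ×ˢ univ) :=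
  continuousOn_integral_gm hu hper (hh.const_mul 2).sqrt (K := fun _ y => y) (by fun_prop)
    (κ := fun _ => 1) (by simp) (by simp) (by simp)

theorem continuousOn_gaussGrad {X : Type*} [TopologicalSpace X] [FirstCountableTopology X]
    {S : Set X} {u : X → E3 → F} (hu : ContinuousOn (fun q : X × E3 => u q.1 q.2) (S ×ˢ univ))
    (hper : ∀ p ∈ S, Periodic (u p)) {h : X → ℝ} (hh : ContinuousOn h S)
    (hpos : ∀ p ∈ S, 0 < h p) :
    ContinuousOn (fun q : X × E3 => gaussGrad (h q.1) (u q.1) q.2) (S ×ˢ univ) := by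
  have h1 := continuousOn_integral_gm hu hper (hh.const_mul 2).sqrt
    (K := fun z y => (innerSL ℝ z).smulRight y) continuous_smulRight_innerSL
    (κ := fun z => ‖z‖) (fun z y => by
      rw [ContinuousLinearMap.norm_smulRight_apply, innerSL_apply_norm])
    integrable_norm_gm (fun _ => norm_nonneg _)
  have h2 : ContinuousOn (fun p => (√(2 * h p))⁻¹) S :=
    (hh.const_mul 2).sqrt.inv₀ fun p hp => (Real.sqrt_pos.2 (by linarith [hpos p hp])).ne'
  exact (h2.comp continuousOn_fst fun q hq => hq.1).smul h1

theorem continuous_gauss [CompleteSpace F] {h : ℝ} {f : E3 → F} (hf : Continuous f)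
    {M : ℝ} (hM : ∀ x, ‖f x‖ ≤ M) : Continuous (gauss h f) :=
  continuous_of_dominated (bound := fun _ => M)
    (fun x => aesm_of_continuous (by fun_prop) _)
    (fun x => Eventually.of_forall fun z => hM _) (integrable_const _)
    (Eventually.of_forall fun z => by fun_prop)

theorem Periodic.gaussGrad {f : E3 → F} (hf : Periodic f) (h : ℝ) : Periodic (gaussGrad h f) := by
  intro x j
  unfold YM.gaussGrad
  congr 2
  funext z
  rw [add_right_comm, hf]

theorem continuous_gaussGrad [CompleteSpace F] {h : ℝ} {f : E3 → F} (hf : Continuous f)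
    {M : ℝ} (hM : ∀ x, ‖f x‖ ≤ M) : Continuous (gaussGrad h f) := by
  suffices h1 : Continuous fun x : E3 =>
      ∫ z, (innerSL ℝ z).smulRight (f (x + √(2 * h) • z)) ∂gm from h1.const_smul (√(2 * h))⁻¹
  refine continuous_of_dominated (bound := fun z => ‖z‖ * M)
    (fun x => ?_)
    (fun x => Eventually.of_forall fun z => ?_) (integrable_norm_gm.mul_const M)
    (Eventually.of_forall fun z => ?_)
  · exact aesm_of_continuous (continuous_smulRight_innerSL.comp
      (by fun_prop : Continuous fun z : E3 => (z, f (x + √(2 * h) • z)))) _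
  · rw [ContinuousLinearMap.norm_smulRight_apply, innerSL_apply_norm]
    gcongr
    exact hM _
  · exact continuous_smulRight_innerSL.comp
      (by fun_prop : Continuous fun x : E3 => (z, f (x + √(2 * h) • z)))

theorem gaussGrad_add [CompleteSpace F] {h k : ℝ} (hh : 0 < h) (hk : 0 < k) {f : E3 → F}
    (hf : Continuous f) {M : ℝ} (hM : ∀ x, ‖f x‖ ≤ M) (x : E3) :
    gaussGrad (h + k) f x = gauss h (gaussGrad k f) x := by
  have h1 : gauss (h + k) f = gauss h (gauss k f) :=
    funext fun y => (gauss_gauss hh.le hk.le hf hM y).symm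
  have h2 := fderiv_gauss hk hf hM
  have h3 := hasFDerivAt_gauss_fderiv h (f := gauss k f)
    (fun y => (hasFDerivAt_gauss hk hf hM y).differentiableAt)
    (by rw [h2]; exact continuous_gaussGrad hf hM) (norm_gauss_le hM)
    (by rw [h2]; exact norm_gaussGrad_le hM) x
  rw [h2, ← h1] at h3
  exact (hasFDerivAt_gauss (by positivity) hf hM x).unique h3

/-- The second derivative of a Gaussian average. -/
theorem hasFDerivAt_gaussGrad [CompleteSpace F] {h : ℝ} (hh : 0 < h) {f : E3 → F}
    (hf : Continuous f) {M : ℝ} (hM : ∀ x, ‖f x‖ ≤ M) (x : E3) :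
    HasFDerivAt (gaussGrad h f) (gaussGrad (h / 2) (gaussGrad (h / 2) f) x) x := by
  -- Half of the time is spent on each of the two derivatives.
  have h1 : gaussGrad h f = gauss (h / 2) (gaussGrad (h / 2) f) := funext fun y => by
    rw [← gaussGrad_add (by positivity) (by positivity) hf hM, add_halves]
  rw [h1]
  exact hasFDerivAt_gauss (by positivity) (continuous_gaussGrad hf hM) (norm_gaussGrad_le hM) x

theorem gauss_clm [CompleteSpace F] [CompleteSpace G] (L : F →L[ℝ] G) {h : ℝ} {f : E3 → F}
    (hf : Continuous f) {M : ℝ} (hM : ∀ x, ‖f x‖ ≤ M) (x : E3) :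
    gauss h (fun y => L (f y)) x = L (gauss h f x) :=
  L.integral_comp_comm (integrable_comp_gm hf hM x _)

/-- The Hölder version of the gradient bound. -/
theorem norm_gaussGrad_le_of_holder [CompleteSpace F] {h : ℝ} (hh : 0 < h) {f : E3 → F}
    (hf : Continuous f) {M N : ℝ} (hM : ∀ x, ‖f x‖ ≤ M)
    (hN : ∀ x y, ‖f x - f y‖ ≤ N * √‖x - y‖) (x : E3) :
    ‖gaussGrad h f x‖ ≤ N * (∫ z : E3, ‖z‖ * √‖z‖ ∂gm) * (2 * h) ^ (-(1 / 4) : ℝ) := by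
  have hN0 : 0 ≤ N := by
    have := (norm_nonneg _).trans (hN (EuclideanSpace.single 0 1) 0)
    simpa using this
  -- After subtracting `f x`, the integrand is at most `N |z|^{3/2} (2h)^{1/4}`, so `h^{-1/2}`
  -- improves to `h^{-1/4}`.
  have h1 : gaussGrad h f x = gaussGrad h (fun y => f y - f x) x := by
    rw [gaussGrad_sub hf continuous_const hM (fun _ => le_refl ‖f x‖), gaussGrad_const, sub_zero]
  have hi : Integrable (fun z : E3 => ‖z‖ * √‖z‖) gm := by
    have h2 : Integrable (fun z : E3 => ‖z‖ ^ 2) gm :=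
      ((IsGaussian.memLp_two_id (μ := gm)).integrable_norm_pow (by norm_num))
    refine (integrable_norm_gm.add h2).mono' (by fun_prop) (Eventually.of_forall fun z => ?_)
    rw [Real.norm_of_nonneg (by positivity), Pi.add_apply]
    have : √‖z‖ ≤ 1 + ‖z‖ := by
      rw [Real.sqrt_le_left (by positivity)]
      nlinarith [norm_nonneg z]
    nlinarith [norm_nonneg z]
  have hs : 0 < √(2 * h) := Real.sqrt_pos.2 (by positivity)
  rw [h1, gaussGrad, norm_smul, norm_inv, Real.norm_of_nonneg hs.le]
  have h3 : ‖∫ z, (innerSL ℝ z).smulRight (f (x + √(2 * h) • z) - f x) ∂gm‖ ≤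
      ∫ z : E3, ‖z‖ * √‖z‖ * (N * √√(2 * h)) ∂gm := by
    refine norm_integral_le_of_norm_le (hi.mul_const _) (Eventually.of_forall fun z => ?_)
    rw [ContinuousLinearMap.norm_smulRight_apply, innerSL_apply_norm, mul_assoc]
    gcongr
    refine (hN _ _).trans (le_of_eq ?_)
    rw [add_sub_cancel_left, norm_smul, Real.norm_of_nonneg hs.le, Real.sqrt_mul hs.le]
    ring
  have h4 : (√(2 * h))⁻¹ * √√(2 * h) = (2 * h) ^ (-(1 / 4) : ℝ) := by
    rw [Real.sqrt_eq_rpow √(2 * h), Real.sqrt_eq_rpow, ← Real.rpow_mul (by positivity),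
      ← Real.rpow_neg (by positivity), ← Real.rpow_add (by positivity)]
    norm_num
  rw [integral_mul_const] at h3
  calc _ ≤ (√(2 * h))⁻¹ * ((∫ z : E3, ‖z‖ * √‖z‖ ∂gm) * (N * √√(2 * h))) := by gcongr
    _ = N * (∫ z : E3, ‖z‖ * √‖z‖ ∂gm) * ((√(2 * h))⁻¹ * √√(2 * h)) := by ring
    _ = _ := by rw [h4]

/-- The gradient of a Gaussian average of a bounded function is Hölder continuous. -/
theorem norm_gaussGrad_sub_le [CompleteSpace F] {h : ℝ} (hh : 0 < h) {f : E3 → F}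
    (hf : Continuous f) {M : ℝ} (hM : ∀ x, ‖f x‖ ≤ M) (x y : E3) :
    ‖gaussGrad h f x - gaussGrad h f y‖ ≤
      2 * (gmMean + gmMean ^ 2) * M * h ^ (-(3 / 4) : ℝ) * √‖x - y‖ := by
  have hm := gmMean_nonneg
  have hM0 : 0 ≤ M := (norm_nonneg _).trans (hM 0)
  set D := ‖gaussGrad h f x - gaussGrad h f y‖ with hD
  have h1 : D ≤ 2 * gmMean * M * h ^ (-(1 / 2) : ℝ) := by
    have a1 := norm_gaussGrad_le (h := h) hM x
    have a2 := norm_gaussGrad_le (h := h) hM y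
    have a3 : (√(2 * h))⁻¹ ≤ h ^ (-(1 / 2) : ℝ) := by
      rw [Real.rpow_neg hh.le, ← Real.sqrt_eq_rpow]
      gcongr
      linarith
    have a4 : (√(2 * h))⁻¹ * (gmMean * M) ≤ h ^ (-(1 / 2) : ℝ) * (gmMean * M) := by gcongr
    calc D ≤ _ := norm_sub_le _ _
      _ ≤ h ^ (-(1 / 2) : ℝ) * (gmMean * M) + h ^ (-(1 / 2) : ℝ) * (gmMean * M) :=
        add_le_add (a1.trans a4) (a2.trans a4)
      _ = _ := by ring
  have h2 : D ≤ gmMean ^ 2 * M * h⁻¹ * ‖x - y‖ := by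
    refine Convex.norm_image_sub_le_of_norm_hasFDerivWithin_le (s := univ)
      (fun z _ => (hasFDerivAt_gaussGrad hh hf hM z).hasFDerivWithinAt) (fun z _ => ?_)
      convex_univ (mem_univ y) (mem_univ x)
    refine (norm_gaussGrad_le (norm_gaussGrad_le hM) z).trans (le_of_eq ?_)
    rw [mul_div_cancel₀ h (two_ne_zero' ℝ)]
    have : (√h)⁻¹ * (√h)⁻¹ = h⁻¹ := by rw [← mul_inv, Real.mul_self_sqrt hh.le]
    linear_combination gmMean ^ 2 * M * this
  -- Interpolation: `D²` is at most the product of the sup bound, of order `h^{-1/2}`, and the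
  -- Lipschitz bound, of order `h^{-1} ‖x - y‖`.
  have h3 : D ^ 2 ≤ (2 * (gmMean + gmMean ^ 2) * M * h ^ (-(3 / 4) : ℝ) * √‖x - y‖) ^ 2 := by
    have b1 : (h ^ (-(3 / 4) : ℝ)) ^ 2 = h ^ (-(1 / 2) : ℝ) * h⁻¹ := by
      rw [← Real.rpow_natCast, ← Real.rpow_mul hh.le, ← Real.rpow_neg_one, ← Real.rpow_add hh]
      norm_num
    calc D ^ 2 = D * D := sq D
      _ ≤ (2 * gmMean * M * h ^ (-(1 / 2) : ℝ)) * (gmMean ^ 2 * M * h⁻¹ * ‖x - y‖) := by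
        gcongr
      _ = (2 * gmMean ^ 3) * (M ^ 2 * (h ^ (-(1 / 2) : ℝ) * h⁻¹) * ‖x - y‖) := by ring
      _ ≤ (2 * (gmMean + gmMean ^ 2)) ^ 2 * (M ^ 2 * (h ^ (-(1 / 2) : ℝ) * h⁻¹) * ‖x - y‖) := by
        gcongr
        nlinarith [pow_nonneg hm 3, pow_nonneg hm 4, pow_nonneg hm 2]
      _ = _ := by
        rw [mul_pow, mul_pow, mul_pow, mul_pow, b1, Real.sq_sqrt (norm_nonneg _)]
        ring
  exact (pow_le_pow_iff_left₀ (norm_nonneg _) (by positivity) two_ne_zero).1 h3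

end Gauss

/-! ### The heat equation for Gaussian averages of smooth periodic functions -/

section

variable {F G : Type*} [NormedAddCommGroup F] [NormedSpace ℝ F]
  [NormedAddCommGroup G] [NormedSpace ℝ G]

theorem Periodic.fderiv {f : E3 → F} (hf : Periodic f) : Periodic (fderiv ℝ f) := by
  intro x j
  have h : f = fun y => f (y + EuclideanSpace.single j (1 : ℝ)) := funext fun y => (hf y j).symm
  conv_rhs => rw [h, fderiv_comp_add_right]

theorem laplacian_eq_sum (f : E3 → F) (x : E3) :
    Laplacian.laplacian f x = ∑ j : Fin 3, fderiv ℝ (fderiv ℝ f) x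
      (EuclideanSpace.single j (1 : ℝ)) (EuclideanSpace.single j (1 : ℝ)) := by
  rw [InnerProductSpace.laplacian_eq_iteratedFDeriv_orthonormalBasis f (EuclideanSpace.basisFun (Fin 3) ℝ)]
  simp [iteratedFDeriv_two_apply]

theorem sum_smul_single (z : E3) :
    z = ∑ j : Fin 3, z j • EuclideanSpace.single j (1 : ℝ) := by
  ext i
  simp [Finset.sum_apply, Pi.single_apply]

variable [CompleteSpace F]

/-- Differentiating `√(2h)` produces `(2h)^{-1/2} ∑_j z_j ∂_j f`. Gaussian integration by parts, in
the form `gaussGrad_eq_gauss_fderiv` applied to each `∂_j f`, turns the factor `(2h)^{-1/2} z_j`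
into another `∂_j`. -/
theorem hasDerivAt_gauss_time {f : E3 → F} (hper : Periodic f) (hf : ContDiff ℝ 2 f) {h : ℝ}
    (hh : 0 < h) (x : E3) :
    HasDerivAt (fun h => gauss h f x) (gauss h (Laplacian.laplacian f) x) h := by
  have hc := hf.continuous
  have hd : Differentiable ℝ f := hf.differentiable two_ne_zero
  have hf1 : ContDiff ℝ 1 (fderiv ℝ f) := hf.fderiv_right (by norm_num)
  have hc1 := hf1.continuous
  have hd1 : Differentiable ℝ (fderiv ℝ f) := hf1.differentiable one_ne_zero
  have hc2 : Continuous (fderiv ℝ (fderiv ℝ f)) := hf1.continuous_fderiv one_ne_zero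
  obtain ⟨M, hM0, hM⟩ := hper.exists_bound hc
  obtain ⟨M1, hM10, hM1⟩ := hper.fderiv.exists_bound hc1
  obtain ⟨M2, hM20, hM2⟩ := hper.fderiv.fderiv.exists_bound hc2
  have key := hasDerivAt_integral_of_dominated_loc_of_deriv_le (μ := gm) (x₀ := h)
    (F := fun h z => f (x + √(2 * h) • z))
    (F' := fun h z => (√(2 * h))⁻¹ • fderiv ℝ f (x + √(2 * h) • z) z)
    (s := Ioi (h / 2)) (bound := fun z => (√h)⁻¹ * (M1 * ‖z‖))
    (Ioi_mem_nhds (by linarith))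
    (Eventually.of_forall fun h => aesm_of_continuous (by fun_prop) _)
    (integrable_comp_gm hc hM x _) (aesm_of_continuous (by fun_prop) _)
    (Eventually.of_forall fun z k hk => ?_)
    ((integrable_norm_gm.const_mul M1).const_mul _)
    (Eventually.of_forall fun z k hk => ?_)
  · convert! key.2 using 1
    have e1 : ∀ z : E3, (√(2 * h))⁻¹ • fderiv ℝ f (x + √(2 * h) • z) z = ∑ j : Fin 3,
        (√(2 * h))⁻¹ • (innerSL ℝ z).smulRight (fderiv ℝ f (x + √(2 * h) • z)
          (EuclideanSpace.single j 1)) (EuclideanSpace.single j 1) := by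
      intro z
      conv_lhs => rw [sum_smul_single z, map_sum, Finset.smul_sum]
      refine Finset.sum_congr rfl fun j _ => ?_
      rw [map_smul, ← sum_smul_single z]
      simp [EuclideanSpace.inner_single_right]
    have hb : ∀ (j : Fin 3) (y : E3), ‖fderiv ℝ f y (EuclideanSpace.single j 1)‖ ≤ M1 := by
      intro j y
      refine ((fderiv ℝ f y).le_opNorm _).trans ?_
      simpa using hM1 y
    have hi := fun j : Fin 3 => integrable_smulRight_gm
      (f := fun y => fderiv ℝ f y (EuclideanSpace.single j 1)) (by fun_prop) (hb j) x (√(2 * h))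
    simp_rw [e1]
    rw [integral_finsetSum _ fun j _ => ?_]
    · have e2 : ∀ j : Fin 3, ∫ z, (√(2 * h))⁻¹ • (innerSL ℝ z).smulRight (fderiv ℝ f (x + √(2 * h) • z)
          (EuclideanSpace.single j 1)) (EuclideanSpace.single j 1) ∂gm =
          gauss h (fun y => fderiv ℝ (fderiv ℝ f) y (EuclideanSpace.single j 1)
            (EuclideanSpace.single j 1)) x := by
        intro j
        have e3 : fderiv ℝ (fun y => fderiv ℝ f y (EuclideanSpace.single j (1 : ℝ))) =
            fun y => (fderiv ℝ (fderiv ℝ f) y).flip (EuclideanSpace.single j 1) := by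
          funext y
          rw [fderiv_clm_apply (hd1 y) (differentiableAt_const _)]
          simp
        have e4 := gaussGrad_eq_gauss_fderiv hh
          (f := fun y => fderiv ℝ f y (EuclideanSpace.single j 1)) (by fun_prop)
          (by rw [e3]; exact (ContinuousLinearMap.flipₗᵢ ℝ E3 E3 F).continuous.comp hc2 |>.clm_apply continuous_const)
          (hb j) (M' := M2) (fun y => by
            rw [e3]
            refine ((fderiv ℝ (fderiv ℝ f) y).flip.le_opNorm _).trans ?_
            rw [ContinuousLinearMap.opNorm_flip]
            simpa using hM2 y) x
        have e5 := congrArg (fun L => L (EuclideanSpace.single j (1 : ℝ))) e4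
        simp only [gaussGrad, _root_.smul_apply] at e5
        rw [ContinuousLinearMap.integral_apply (hi j)] at e5
        rw [integral_smul, e5, e3, ← ContinuousLinearMap.apply_apply (𝕜 := ℝ) (EuclideanSpace.single j 1), ← gauss_clm (M := M2)]
        · rfl
        · exact (ContinuousLinearMap.flipₗᵢ ℝ E3 E3 F).continuous.comp hc2 |>.clm_apply continuous_const
        · intro y
          refine ((fderiv ℝ (fderiv ℝ f) y).flip.le_opNorm _).trans ?_
          rw [ContinuousLinearMap.opNorm_flip]
          simpa using hM2 y
      simp_rw [e2]
      simp only [gauss]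
      rw [← integral_finsetSum _ fun j _ => ?_]
      · simp_rw [laplacian_eq_sum]
      · refine integrable_comp_gm (f := fun y => fderiv ℝ (fderiv ℝ f) y
          (EuclideanSpace.single j 1) (EuclideanSpace.single j 1)) (by fun_prop) (M := M2) (fun y => ?_) x _
        refine ((fderiv ℝ (fderiv ℝ f) y).le_opNorm₂ _ _).trans ?_
        simpa using hM2 y
    · exact ((ContinuousLinearMap.apply ℝ F (EuclideanSpace.single j (1 : ℝ))).integrable_comp
        (hi j)).smul _
  · have hk' : h / 2 < k := hk
    rw [norm_smul, norm_inv, Real.norm_of_nonneg (Real.sqrt_nonneg _)]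
    have h0 : 0 < √h := Real.sqrt_pos.2 hh
    gcongr
    · linarith
    · exact ((fderiv ℝ f _).le_opNorm z).trans (by gcongr; exact hM1 _)
  · have hk' : h / 2 < k := hk
    have hk0 : 0 < k := by linarith
    have h1 : HasDerivAt (fun k => x + √(2 * k) • z) ((√(2 * k))⁻¹ • z) k := by
      have h2 := (((hasDerivAt_id k).const_mul 2).sqrt (by simp; positivity)).smul_const z |>.const_add x
      convert! h2 using 2
      simp only [id, mul_one]
      field_simp
    have h3 := (hd (x + √(2 * k) • z)).hasFDerivAt.comp_hasDerivAt k h1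
    rwa [map_smul] at h3

theorem continuous_laplacian {f : E3 → F} (hf : ContDiff ℝ 2 f) :
    Continuous (Laplacian.laplacian f) := by
  have hf1 : ContDiff ℝ 1 (fderiv ℝ f) := hf.fderiv_right (by norm_num)
  have hc2 : Continuous (fderiv ℝ (fderiv ℝ f)) := hf1.continuous_fderiv one_ne_zero
  rw [funext (laplacian_eq_sum f)]
  fun_prop

theorem Periodic.laplacian {f : E3 → F} (hf : Periodic f) :
    Periodic (Laplacian.laplacian f) := by
  intro x j
  rw [laplacian_eq_sum, laplacian_eq_sum, hf.fderiv.fderiv x j]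

theorem continuousOn_gauss_time {f : E3 → F} (hper : Periodic f) (hf : Continuous f) (x : E3) :
    ContinuousOn (fun h => gauss h f x) (Ici 0) := by
  have h := continuousOn_gauss (S := Ici (0 : ℝ)) (u := fun _ => f)
    (hf.comp continuous_snd).continuousOn (fun _ _ => hper) (h := id) continuousOn_id
  exact h.comp (f := fun h : ℝ => (h, x)) (by fun_prop) fun h hh => ⟨hh, mem_univ _⟩

theorem gauss_sub_self {f : E3 → F} (hper : Periodic f) (hf : ContDiff ℝ 2 f) {h : ℝ}
    (hh : 0 ≤ h) (x : E3) :
    gauss h f x - f x = ∫ k in (0 : ℝ)..h, gauss k (Laplacian.laplacian f) x := by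
  have hc := continuousOn_gauss_time hper.laplacian (continuous_laplacian hf) x
  rw [intervalIntegral.integral_eq_sub_of_hasDerivAt_of_le hh
    ((continuousOn_gauss_time hper hf.continuous x).mono Icc_subset_Ici_self)
    (fun k hk => hasDerivAt_gauss_time hper hf hk.1 x), gauss_zero]
  refine ContinuousOn.intervalIntegrable (hc.mono ?_)
  rw [uIcc_of_le hh]
  exact Icc_subset_Ici_self

/-! ### Smoothing in terms of integrals along segments -/

/-- The line integral divided by `r` is a mean value of `u` along a segment of length `r` starting
at `x`, and `u` varies by at most `r N` along it. -/
theorem norm_le_lineInt {u : E3 → F} (hu : Differentiable ℝ u) {N : ℝ}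
    (hN : ∀ x, ‖fderiv ℝ u x‖ ≤ N) (x : E3) {r : ℝ} (hr : 0 < r) :
    ‖u x‖ ≤ ‖lineInt u x (r • EuclideanSpace.single 0 (1 : ℝ))‖ / r + r * N := by
  set v : E3 := r • EuclideanSpace.single 0 (1 : ℝ) with hv
  have hvn : ‖v‖ = r := by simp [hv, norm_smul, abs_of_pos hr]
  have hc := hu.continuous
  have h1 : r • u x - lineInt u x v = ∫ t in (0 : ℝ)..1, r • (u x - u (x + t • v)) := by
    simp_rw [smul_sub]
    rw [intervalIntegral.integral_sub (by simp) (Continuous.intervalIntegrable (by fun_prop) _ _),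
      lineInt, hvn]
    simp
  have h2 : ‖r • u x - lineInt u x v‖ ≤ r * (N * r) := by
    rw [h1]
    refine (intervalIntegral.norm_integral_le_of_norm_le_const (C := r * (N * r))
      fun t ht => ?_).trans (by simp)
    rw [uIoc_of_le zero_le_one] at ht
    rw [norm_smul, Real.norm_of_nonneg hr.le]
    gcongr
    have h3 := Convex.norm_image_sub_le_of_norm_fderiv_le (s := univ) (f := u) (𝕜 := ℝ)
      (fun z _ => hu z) (fun z _ => hN z) convex_univ (mem_univ (x + t • v)) (mem_univ x)
    refine h3.trans ?_
    have hN0 := (norm_nonneg _).trans (hN 0)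
    gcongr
    rw [sub_add_cancel_left, norm_neg, norm_smul, hvn, Real.norm_of_nonneg ht.1.le]
    nlinarith [ht.2]
  have h4 : r * ‖u x‖ ≤ ‖lineInt u x v‖ + r * (N * r) := by
    rw [← Real.norm_of_nonneg hr.le, ← norm_smul, Real.norm_of_nonneg hr.le]
    calc ‖r • u x‖ = ‖lineInt u x v + (r • u x - lineInt u x v)‖ := by simp
      _ ≤ _ := (norm_add_le _ _).trans (by gcongr)
  rw [div_add' _ _ _ hr.ne', le_div_iff₀ hr]
  linarith

/-- The heat flow averages translates, and the assumed bound is uniform in the position of the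
segment. -/
theorem norm_lineInt_gauss_le {f : E3 → F} (hf : Continuous f) {M : ℝ} (hM : ∀ x, ‖f x‖ ≤ M)
    (h : ℝ) {v : E3} {B : ℝ} (hB : ∀ x, ‖lineInt f x v‖ ≤ B) (x : E3) :
    ‖lineInt (gauss h f) x v‖ ≤ B := by
  have h1 : lineInt (gauss h f) x v = ∫ z, lineInt f (x + √(2 * h) • z) v ∂gm := by
    simp only [lineInt, gauss, ← integral_smul]
    simp_rw [intervalIntegral.integral_of_le (zero_le_one' ℝ)]
    rw [integral_integral_swap]
    · simp only [add_right_comm]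
    · refine Integrable.of_bound (C := ‖v‖ * M) ?_ (Eventually.of_forall fun p => ?_)
      · exact Continuous.aestronglyMeasurable
          (by unfold Function.uncurry; fun_prop)
      · simp only [Function.uncurry, norm_smul, norm_norm]
        gcongr
        exact hM _
  rw [h1]
  exact (norm_integral_le_of_norm_le_const (Eventually.of_forall fun z => hB _)).trans (by simp)

/-- A self-improving argument. Apply `norm_le_lineInt` to `P_h f` with a segment of length `κ √h`:
the mean value contributes `L (κ √h)^{γ-1}`, and the gradient error is at most half of the sup of
`P_{h/2} f`. Iterating `h ↦ h/2` halves the crude bound `M` each time while the `L`-part stays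
bounded by a fixed point `K`. In the limit `M` disappears and only `L` enters the constant. -/
theorem exists_norm_gauss_le_of_lineInt {γ : ℝ} (hγ : 0 < γ) (hγ1 : γ ≤ 1) :
    ∃ C > 0, ∀ f : E3 → F, Continuous f → Periodic f → ∀ L : ℝ,
      (∀ x v, ‖v‖ ≤ 1 / 4 → ‖lineInt f x v‖ ≤ L * ‖v‖ ^ γ) →
      ∀ h ∈ Ioc (0 : ℝ) 1, ∀ x, ‖gauss h f x‖ ≤ C * L * h ^ ((γ - 1) / 2) := by
  -- Small enough for the segments to be admissible (`κ ≤ 1/4`) and for the gradient error to be at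
  -- most one half (`κ * gmMean ≤ 1/2`).
  set κ : ℝ := 1 / (4 * (gmMean + 1)) with hκ
  have hm := gmMean_nonneg
  have hκ0 : 0 < κ := by positivity
  have hκ1 : κ ≤ 1 / 4 := by
    rw [hκ]
    gcongr
    linarith
  have hκm : κ * gmMean ≤ 1 / 2 := by
    rw [hκ, one_div_mul_eq_div, div_le_iff₀ (by positivity)]
    linarith
  -- One half times the growth of `h^{(γ-1)/2}` under `h ↦ h/2`. It is less than one because `γ >
  -- 0`, so `K = κ^{γ-1} + τ K` has a positive solution.
  set τ : ℝ := (1 / 2) * 2 ^ ((1 - γ) / 2) with hτ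
  have hτ1 : τ < 1 := by
    have : (2 : ℝ) ^ ((1 - γ) / 2) < 2 ^ (1 : ℝ) :=
      Real.rpow_lt_rpow_of_exponent_lt (by norm_num) (by linarith)
    rw [Real.rpow_one] at this
    linarith
  set K : ℝ := κ ^ (γ - 1) / (1 - τ) with hK
  have hK0 : 0 < K := div_pos (Real.rpow_pos_of_pos hκ0 _) (by linarith)
  refine ⟨K, hK0, fun f hf hper L hL => ?_⟩
  obtain ⟨M, hM0, hM⟩ := hper.exists_bound hf
  have hL0 : 0 ≤ L := by
    have h1 := (norm_nonneg _).trans (hL 0 ((1 / 4 : ℝ) • EuclideanSpace.single 0 (1 : ℝ))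
      (by simp [norm_smul]))
    exact nonneg_of_mul_nonneg_left h1 (Real.rpow_pos_of_pos (by simp [norm_smul]) _)
  have key : ∀ n : ℕ, ∀ h ∈ Ioc (0 : ℝ) 1, ∀ x,
      ‖gauss h f x‖ ≤ K * L * h ^ ((γ - 1) / 2) + (1 / 2) ^ n * M := by
    intro n
    induction n with
    | zero =>
      intro h hh x
      have := norm_gauss_le (h := h) hM x
      have h2 : 0 ≤ K * L * h ^ ((γ - 1) / 2) :=
        mul_nonneg (by positivity) (Real.rpow_nonneg hh.1.le _)
      linarith
    | succ n ih =>
      intro h hh x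
      have hh0 := hh.1
      have hh2 : h / 2 ∈ Ioc (0 : ℝ) 1 := ⟨by linarith, by linarith [hh.2]⟩
      set a := K * L * (h / 2) ^ ((γ - 1) / 2) + (1 / 2) ^ n * M with ha
      have hs : 0 < √h := Real.sqrt_pos.2 hh0
      have e1 : gauss h f = gauss (h / 2) (gauss (h / 2) f) := funext fun y => by
        rw [gauss_gauss hh2.1.le hh2.1.le hf hM, add_halves]
      have hgc := continuous_gauss (h := h / 2) hf hM
      have hN : ∀ y, ‖fderiv ℝ (gauss h f) y‖ ≤ (√h)⁻¹ * (gmMean * a) := by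
        intro y
        rw [e1, fderiv_gauss hh2.1 hgc (ih _ hh2)]
        refine (norm_gaussGrad_le (ih _ hh2) y).trans (le_of_eq ?_)
        rw [mul_div_cancel₀ h (two_ne_zero' ℝ)]
      have hr : 0 < κ * √h := by positivity
      have h1 := norm_le_lineInt (fun y => (hasFDerivAt_gauss hh0 hf hM y).differentiableAt) hN x hr
      set v : E3 := (κ * √h) • EuclideanSpace.single 0 (1 : ℝ) with hv
      have hvn : ‖v‖ = κ * √h := by
        rw [hv, norm_smul, Real.norm_of_nonneg hr.le]
        simp
      have hv4 : ‖v‖ ≤ 1 / 4 := by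
        rw [hvn]
        have : √h ≤ 1 := Real.sqrt_le_one.2 hh.2
        nlinarith
      have h2 := norm_lineInt_gauss_le hf hM h (v := v) (fun y => hL y v hv4) x
      rw [hvn] at h2
      have h3 : L * (κ * √h) ^ γ / (κ * √h) = κ ^ (γ - 1) * L * h ^ ((γ - 1) / 2) := by
        rw [mul_div_assoc, ← Real.rpow_sub_one hr.ne', Real.mul_rpow hκ0.le hs.le,
          Real.sqrt_eq_rpow, ← Real.rpow_mul hh0.le]
        ring_nf
      have h4 : κ * √h * ((√h)⁻¹ * (gmMean * a)) = κ * gmMean * a := by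
        field_simp
      have ha0 : 0 ≤ a := (norm_nonneg _).trans (ih _ hh2 0)
      have h5 : (h / 2) ^ ((γ - 1) / 2) = 2 ^ ((1 - γ) / 2) * h ^ ((γ - 1) / 2) := by
        rw [Real.div_rpow hh0.le (by norm_num), div_eq_mul_inv, ← Real.rpow_neg (by norm_num),
          mul_comm]
        ring_nf
      calc ‖gauss h f x‖ ≤ L * (κ * √h) ^ γ / (κ * √h) + κ * gmMean * a := by
            rw [← h4]
            exact h1.trans (by gcongr)
        _ ≤ κ ^ (γ - 1) * L * h ^ ((γ - 1) / 2) + 1 / 2 * a := by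
            rw [h3]
            gcongr
        _ = (κ ^ (γ - 1) + τ * K) * L * h ^ ((γ - 1) / 2) + (1 / 2) ^ (n + 1) * M := by
            rw [ha, h5, hτ]
            ring
        _ = K * L * h ^ ((γ - 1) / 2) + (1 / 2) ^ (n + 1) * M := by
            have : κ ^ (γ - 1) + τ * K = K := by
              rw [hK]
              have : 1 - τ ≠ 0 := by linarith
              field_simp
              ring
            rw [this]
  intro h hh x
  have h1 : Tendsto (fun n : ℕ => K * L * h ^ ((γ - 1) / 2) + (1 / 2 : ℝ) ^ n * M) atTop
      (𝓝 (K * L * h ^ ((γ - 1) / 2) + 0 * M)) :=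
    ((tendsto_pow_atTop_nhds_zero_of_lt_one (by norm_num) (by norm_num)).mul_const M).const_add _
  rw [zero_mul, add_zero] at h1
  exact ge_of_tendsto' h1 fun n => key n h hh x

end

/-! ### The unit cell as a fundamental domain -/

/-- The standard basis of `ℝ³`. -/
def stdBasis3 : Module.Basis (Fin 3) ℝ E3 := (EuclideanSpace.basisFun (Fin 3) ℝ).toBasis

theorem fundamentalDomain_eq_cell : ZSpan.fundamentalDomain stdBasis3 = cell := by
  ext x
  simp [ZSpan.mem_fundamentalDomain, cell, stdBasis3]

theorem isAddFundamentalDomain_cell :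
    IsAddFundamentalDomain (Submodule.span ℤ (Set.range stdBasis3)).toAddSubgroup cell volume := by
  rw [← fundamentalDomain_eq_cell]
  exact ZSpan.isAddFundamentalDomain' stdBasis3 volume

/-- The integer vector with coordinates `n`. -/
def intVec (n : Fin 3 → ℤ) : E3 := WithLp.toLp 2 fun j => (n j : ℝ)

/-- The lattice `ℤ³` as a span. -/
def latticeEquiv : (Fin 3 → ℤ) ≃ (Submodule.span ℤ (Set.range stdBasis3)).toAddSubgroup :=
  (stdBasis3.restrictScalars ℤ).equivFun.symm.toEquiv

instance : Countable (Submodule.span ℤ (Set.range stdBasis3)).toAddSubgroup :=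
  Countable.of_equiv _ latticeEquiv

theorem latticeEquiv_coe (n : Fin 3 → ℤ) : (latticeEquiv n : E3) = intVec n := by
  have h : (latticeEquiv n : E3) = ∑ i, n i • stdBasis3 i := by
    simp [latticeEquiv, Module.Basis.equivFun_symm_apply]
  rw [h]
  ext j
  simp [intVec, stdBasis3, Finset.sum_apply, Pi.single_apply]

theorem norm_sq_intVec (n : Fin 3 → ℤ) : ‖intVec n‖ ^ 2 = ∑ j, (n j : ℝ) ^ 2 := by
  rw [EuclideanSpace.real_norm_sq_eq]
  rfl

theorem inner_intVec (n : Fin 3 → ℤ) (x : E3) : inner ℝ (intVec n) x = ∑ j, (n j : ℝ) * x j := by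
  rw [PiLp.inner_apply]
  simp [intVec, mul_comm]

theorem volume_cell_lt_top : volume cell < ⊤ :=
  (measure_mono cell_subset_closedCell).trans_lt isCompact_closedCell.measure_lt_top

instance : IsFiniteMeasure (volume.restrict cell) :=
  ⟨by simpa using volume_cell_lt_top⟩

section

variable {F G : Type*} [NormedAddCommGroup F] [NormedSpace ℝ F]

theorem integral_eq_integral_cell_tsum {f : E3 → F} (hf : Integrable f) :
    ∫ x, f x = ∫ x in cell, ∑' n : Fin 3 → ℤ, f (x + intVec n) := by
  have h1 := isAddFundamentalDomain_cell.integral_eq_tsum'' f hf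
  have h2 := isAddFundamentalDomain_cell.lintegral_eq_tsum'' (fun x => ‖f x‖ₑ)
  rw [← latticeEquiv.tsum_eq] at h1 h2
  have e : ∀ (n : Fin 3 → ℤ) (x : E3), latticeEquiv n +ᵥ x = x + intVec n := fun n x => by
    rw [AddSubgroup.vadd_def, latticeEquiv_coe, vadd_eq_add, add_comm]
  simp_rw [e] at h1 h2
  rw [h1, integral_tsum]
  · intro n
    have h3 : AEStronglyMeasurable (fun x => f (x + intVec n)) volume :=
      (hf.comp_add_right (intVec n)).aestronglyMeasurable
    exact h3.restrict
  · rw [← h2]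
    exact hf.2.ne

/-- A translate of the cell is again a fundamental domain of the lattice. -/
theorem Periodic.integral_cell_add {f : E3 → F} (hf : Periodic f) (v : E3) :
    ∫ x in cell, f (x + v) = ∫ x in cell, f x := by
  have h1 : ∫ x in cell, f (x + v) = ∫ x in v +ᵥ cell, f x := by
    have := (measurePreserving_vadd v (volume : Measure E3)).setIntegral_image_emb
      (measurableEmbedding_const_vadd v) f cell
    rw [← image_vadd, this]
    simp only [vadd_eq_add, add_comm]
  rw [h1]
  refine (isAddFundamentalDomain_cell.vadd_of_comm v).setIntegral_eq isAddFundamentalDomain_cell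
    fun g x => ?_
  obtain ⟨n, rfl⟩ := latticeEquiv.surjective g
  rw [AddSubgroup.vadd_def, latticeEquiv_coe, vadd_eq_add, add_comm]
  exact hf.add_int x n

end

/-! ### Sums over `ℤ³` of products -/

/-- Functions on `Fin 3` as triples. -/
def finThreeEquiv : (Fin 3 → ℤ) ≃ ℤ × ℤ × ℤ where
  toFun n := (n 0, n 1, n 2)
  invFun p := ![p.1, p.2.1, p.2.2]
  left_inv n := by
    funext j
    match j with
    | 0 => rfl
    | 1 => rfl
    | 2 => rfl
  right_inv _ := rfl

theorem hasSum_mul_of_norm {R ι κ : Type*} [NormedField R] [CompleteSpace R] {g : ι → R} {h : κ → R}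
    {b c : R} (hg : HasSum g b) (hh : HasSum h c) (hn : Summable fun n => ‖g n‖)
    (hn' : Summable fun n => ‖h n‖) :
    HasSum (fun p : ι × κ => g p.1 * h p.2) (b * c) := by
  have h0 : Summable fun p : ι × κ => ‖g p.1 * h p.2‖ := hn.mul_norm hn'
  rw [← hg.tsum_eq, ← hh.tsum_eq, tsum_mul_tsum_of_summable_norm hn hn']
  exact h0.of_norm.hasSum

theorem hasSum_prod_three {R : Type*} [NormedField R] [CompleteSpace R] {f : Fin 3 → ℤ → R}
    {a : Fin 3 → R} (hf : ∀ j, HasSum (f j) (a j)) (hn : ∀ j, Summable fun n => ‖f j n‖) :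
    HasSum (fun n : Fin 3 → ℤ => ∏ j, f j (n j)) (∏ j, a j) := by
  have h12 : HasSum (fun p : ℤ × ℤ => f 1 p.1 * f 2 p.2) (a 1 * a 2) :=
    hasSum_mul_of_norm (hf 1) (hf 2) (hn 1) (hn 2)
  have hn12 : Summable fun p : ℤ × ℤ => ‖f 1 p.1 * f 2 p.2‖ := (hn 1).mul_norm (hn 2)
  have h012 := hasSum_mul_of_norm (hf 0) h12 (hn 0) hn12
  have h := (finThreeEquiv.hasSum_iff
    (f := fun p : ℤ × ℤ × ℤ => f 0 p.1 * (f 1 p.2.1 * f 2 p.2.2))).2 h012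
  rw [Fin.prod_univ_three, mul_assoc]
  refine h.congr_fun fun n => ?_
  rw [Fin.prod_univ_three, mul_assoc]
  rfl

/-! ### The heat kernel on the torus -/

/-- The one-dimensional theta series of the heat kernel. -/
def theta1 (s x : ℝ) : ℂ := jacobiTheta₂ (x : ℂ) ((4 * Real.pi * s : ℝ) * Complex.I)

theorem theta1_im_pos {s : ℝ} (hs : 0 < s) :
    0 < (((4 * Real.pi * s : ℝ) : ℂ) * Complex.I).im := by
  rw [Complex.im_ofReal_mul, Complex.I_im, mul_one]
  positivity

theorem hasSum_theta1 {s : ℝ} (hs : 0 < s) (x : ℝ) :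
    HasSum (fun n : ℤ => Complex.exp ((2 * Real.pi * (n * x) : ℝ) * Complex.I) *
      (Real.exp (-(4 * Real.pi ^ 2 * s * n ^ 2)) : ℝ)) (theta1 s x) := by
  refine (hasSum_jacobiTheta₂_term (x : ℂ) (theta1_im_pos hs)).congr_fun fun n => ?_
  rw [jacobiTheta₂_term, Complex.ofReal_exp, ← Complex.exp_add]
  congr 1
  push_cast
  linear_combination -(4 * Real.pi ^ 2 * s * n ^ 2 : ℂ) * Complex.I_mul_I

/-- Poisson summation, in the form of the functional equation of the theta function at `τ = 4πis`:
the Fourier series becomes a periodized Gaussian. Its terms are real, hence so is the sum. -/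
theorem hasSum_gauss_theta1 {s : ℝ} (hs : 0 < s) (x : ℝ) :
    HasSum (fun n : ℤ => (4 * Real.pi * s) ^ (-(1 / 2) : ℝ) * Real.exp (-(x + n) ^ 2 / (4 * s)))
      (theta1 s x).re ∧ (theta1 s x).im = 0 := by
  have hs' : (0 : ℝ) < 4 * Real.pi * s := by positivity
  have hsc : (s : ℂ) ≠ 0 := by exact_mod_cast hs.ne'
  have hpi : (Real.pi : ℂ) ≠ 0 := by exact_mod_cast Real.pi_pos.ne'
  set τ : ℂ := ((4 * Real.pi * s : ℝ) : ℂ) * Complex.I with hτ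
  have hτ' : -1 / τ = (((4 * Real.pi * s)⁻¹ : ℝ) : ℂ) * Complex.I := by
    rw [hτ, Complex.ofReal_inv, div_eq_iff (by simp [hs.ne', Real.pi_pos.ne'])]
    have : (((4 * Real.pi * s : ℝ)) : ℂ) ≠ 0 := by exact_mod_cast hs'.ne'
    field_simp
    rw [Complex.I_sq]
  have him : 0 < (-1 / τ).im := by
    rw [hτ', Complex.im_ofReal_mul, Complex.I_im, mul_one]
    positivity
  have h1 := (hasSum_jacobiTheta₂_term ((x : ℂ) / τ) him).mul_left
    (1 / (-Complex.I * τ) ^ (1 / 2 : ℂ) * Complex.exp (-Real.pi * Complex.I * (x : ℂ) ^ 2 / τ))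
  rw [← jacobiTheta₂_functional_equation] at h1
  have h2 : 1 / (-Complex.I * τ) ^ (1 / 2 : ℂ) = (((4 * Real.pi * s) ^ (-(1 / 2) : ℝ) : ℝ) : ℂ) := by
    have : -Complex.I * τ = ((4 * Real.pi * s : ℝ) : ℂ) := by
      rw [hτ]
      linear_combination (-((4 * Real.pi * s : ℝ) : ℂ)) * Complex.I_mul_I
    rw [this, Complex.ofReal_cpow hs'.le, one_div, ← Complex.cpow_neg]
    push_cast
    rfl
  have h3 : HasSum (fun n : ℤ => (((4 * Real.pi * s) ^ (-(1 / 2) : ℝ) *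
      Real.exp (-(x - n) ^ 2 / (4 * s)) : ℝ) : ℂ)) (theta1 s x) := by
    refine h1.congr_fun fun n => ?_
    rw [h2, jacobiTheta₂_term, Complex.ofReal_mul, Complex.ofReal_exp,
      mul_assoc _ (Complex.exp _) (Complex.exp _), ← Complex.exp_add]
    congr 2
    have e1 : -(Real.pi : ℂ) * Complex.I * (x : ℂ) ^ 2 / τ = (Real.pi * Complex.I * (x : ℂ) ^ 2) * (-1 / τ) := by ring
    have e2 : (x : ℂ) / τ = - x * (-1 / τ) := by ring
    rw [e1, e2, hτ']
    push_cast
    field_simp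
    linear_combination -(((x : ℂ) - n) ^ 2) * Complex.I_sq
  -- The functional equation yields shifts `x - n`; reindexing by `n ↦ -n` gives `x + n`.
  have h4 : HasSum (fun n : ℤ => (((4 * Real.pi * s) ^ (-(1 / 2) : ℝ) *
      Real.exp (-(x + n) ^ 2 / (4 * s)) : ℝ) : ℂ)) (theta1 s x) := by
    have := (Equiv.neg ℤ).hasSum_iff.2 h3
    refine this.congr_fun fun n => ?_
    simp
  have h6 := Complex.hasSum_re h4
  simp only [Complex.ofReal_re] at h6
  refine ⟨h6, ?_⟩
  have h5 := Complex.hasSum_im h4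
  simp only [Complex.ofReal_im] at h5
  exact h5.unique hasSum_zero

theorem ofReal_theta1_re {s : ℝ} (hs : 0 < s) (x : ℝ) : ((theta1 s x).re : ℂ) = theta1 s x :=
  Complex.ext (by simp) (by simp [(hasSum_gauss_theta1 hs x).2])

theorem heatKernel_eq (s : ℝ) (x : E3) : heatKernel s x = ∏ j : Fin 3, (theta1 s (x j)).re := rfl

theorem heatKernel_neg (s : ℝ) (x : E3) : heatKernel s (-x) = heatKernel s x := by
  simp only [heatKernel]
  refine Finset.prod_congr rfl fun j _ => ?_
  have h : ((-x) j : ℝ) = -(x j) := rfl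
  rw [h, Complex.ofReal_neg, jacobiTheta₂_neg_left]

/-- The heat kernel as a Fourier series. -/
theorem hasSum_heatKernel {s : ℝ} (hs : 0 < s) (x : E3) :
    HasSum (fun n : Fin 3 → ℤ => Real.exp (-(4 * Real.pi ^ 2 * s * ‖intVec n‖ ^ 2)) *
      Real.cos (2 * Real.pi * inner ℝ (intVec n) x)) (heatKernel s x) := by
  have h := hasSum_prod_three (fun j => hasSum_theta1 hs (x j))
    fun j => (hasSum_theta1 hs (x j)).summable.norm
  have h2 := Complex.hasSum_re h
  have h3 : (∏ j : Fin 3, theta1 s (x j)).re = heatKernel s x := by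
    rw [heatKernel_eq, ← Complex.ofReal_re (∏ j : Fin 3, (theta1 s (x j)).re), Complex.ofReal_prod]
    exact congrArg Complex.re (Finset.prod_congr rfl fun j _ => (ofReal_theta1_re hs (x j)).symm)
  rw [h3] at h2
  refine h2.congr_fun fun n => ?_
  rw [Finset.prod_mul_distrib, ← Complex.exp_sum, ← Complex.ofReal_prod, ← Real.exp_sum,
    Complex.re_mul_ofReal, ← Finset.sum_mul, ← Complex.ofReal_sum, Complex.exp_ofReal_mul_I_re,
    mul_comm]
  congr 2
  · rw [inner_intVec, Finset.mul_sum]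
  · rw [norm_sq_intVec, Finset.mul_sum, Finset.sum_neg_distrib]

/-- The heat kernel on `ℝ³`. -/
def heatKernelE (s : ℝ) (x : E3) : ℝ :=
  (4 * Real.pi * s) ^ (-(3 / 2) : ℝ) * Real.exp (-‖x‖ ^ 2 / (4 * s))

/-- The heat kernel on the torus is the periodization of the heat kernel on `ℝ³`. -/
theorem hasSum_heatKernelE {s : ℝ} (hs : 0 < s) (x : E3) :
    HasSum (fun n : Fin 3 → ℤ => heatKernelE s (x + intVec n)) (heatKernel s x) := by
  have h := hasSum_prod_three (fun j => (hasSum_gauss_theta1 hs (x j)).1)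
    fun j => (hasSum_gauss_theta1 hs (x j)).1.summable.norm
  refine h.congr_fun fun n => ?_
  rw [Finset.prod_mul_distrib, ← Real.exp_sum, heatKernelE]
  congr 1
  · rw [Finset.prod_const, Finset.card_univ, Fintype.card_fin, ← Real.rpow_natCast,
      ← Real.rpow_mul (by positivity)]
    norm_num
  · congr 1
    simp only [EuclideanSpace.real_norm_sq_eq, intVec, Fin.sum_univ_three, PiLp.add_apply]
    ring

theorem gauss_eq_integral {F : Type*} [NormedAddCommGroup F] [NormedSpace ℝ F] {s : ℝ}
    (hs : 0 < s) (f : E3 → F) (x : E3) :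
    gauss s f x = ∫ y, heatKernelE s (y - x) • f y := by
  have hσ : 0 < √(2 * s) := Real.sqrt_pos.2 (by positivity)
  have h1 : ∫ y, heatKernelE s (y - x) • f y = ∫ y, heatKernelE s y • f (x + y) := by
    rw [← integral_add_left_eq_self _ x]
    simp
  have h2 := Measure.integral_comp_smul (volume : Measure E3)
    (fun y => heatKernelE s y • f (x + y)) √(2 * s)
  have h3 : ∀ z : E3, gaussDensity z = √(2 * s) ^ 3 * heatKernelE s (√(2 * s) • z) := by
    intro z
    rw [gaussDensity, heatKernelE, norm_smul, Real.norm_of_nonneg hσ.le, mul_pow,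
      Real.sq_sqrt (by positivity), ← mul_assoc]
    congr 1
    · have h5 : (4 * Real.pi * s) = (2 * Real.pi) * (2 * s) := by ring
      rw [h5, Real.mul_rpow (x := 2 * Real.pi) (y := 2 * s) (by positivity) (by positivity),
        Real.sqrt_eq_rpow, ← Real.rpow_natCast ((2 * s) ^ (1 / 2 : ℝ)),
        ← Real.rpow_mul (by positivity), mul_left_comm, ← Real.rpow_add (by positivity)]
      norm_num
    · congr 1
      field_simp
      ring
  rw [gauss, integral_gm, h1]
  simp_rw [h3, mul_smul]
  rw [integral_smul, h2, smul_smul, abs_of_pos (by positivity)]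
  rw [finrank_euclideanSpace_fin, mul_inv_cancel₀ (by positivity), one_smul]

theorem integrable_heatKernelE {s : ℝ} (hs : 0 < s) : Integrable (heatKernelE s) := by
  have h := (integrable_exp_neg_mul_norm_sq (b := 1 / (4 * s)) (by positivity)).const_mul
    ((4 * Real.pi * s) ^ (-(3 / 2) : ℝ))
  refine h.congr (Eventually.of_forall fun z => ?_)
  simp only [heatKernelE]
  congr 2
  ring

theorem continuous_heatKernelE (s : ℝ) : Continuous (heatKernelE s) := by
  unfold heatKernelE
  fun_prop

/-- The heat semigroup on the torus is a Gaussian average. -/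
theorem heatFn_eq_gauss {F : Type*} [NormedAddCommGroup F] [NormedSpace ℝ F] [CompleteSpace F]
    {s : ℝ} (hs : 0 < s)
    {f : E3 → F} (hf : Continuous f) (hper : Periodic f) (x : E3) :
    heatFn s f x = gauss s f x := by
  obtain ⟨M, hM0, hM⟩ := hper.exists_bound hf
  have hi : Integrable (fun y => heatKernelE s (y - x) • f y) := by
    refine (((integrable_heatKernelE hs).comp_sub_right x).norm.mul_const M).mono' ?_
      (Eventually.of_forall fun y => ?_)
    · have := continuous_heatKernelE s
      exact Continuous.aestronglyMeasurable (by fun_prop)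
    · rw [norm_smul]
      gcongr
      exact hM y
  -- Unfolding: the integral over `ℝ³` becomes a lattice sum over the cell. Periodicity takes `f`
  -- out of the sum, which leaves the periodized kernel.
  rw [gauss_eq_integral hs, integral_eq_integral_cell_tsum hi, heatFn]
  congr 1
  funext y
  have h1 := (hasSum_heatKernelE hs (y - x)).smul_const (f y)
  rw [← heatKernel_neg, neg_sub, ← h1.tsum_eq]
  refine tsum_congr fun n => ?_
  rw [intVec, hper.add_int]
  congr 2
  abel

/-! ### Trigonometric test functions -/

/-- The length of the frequency vector `2πn`. -/
def freq (n : Fin 3 → ℤ) : ℝ := 2 * Real.pi * ‖intVec n‖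

theorem freq_nonneg (n : Fin 3 → ℤ) : 0 ≤ freq n := by unfold freq; positivity

/-- The linear form `y ↦ 2π ⟨n, y⟩`. -/
def freqForm (n : Fin 3 → ℤ) : E3 →L[ℝ] ℝ := (2 * Real.pi) • innerSL ℝ (intVec n)

theorem norm_freqForm (n : Fin 3 → ℤ) : ‖freqForm n‖ = freq n := by
  rw [freqForm, norm_smul, innerSL_apply_norm, freq, Real.norm_of_nonneg (by positivity)]

theorem iteratedDeriv_cos_sub (k : ℕ) (c : ℝ) :
    iteratedDeriv k (fun u : ℝ => Real.cos (u - c)) =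
      fun u => Real.cos (u - c + k * (Real.pi / 2)) := by
  induction k with
  | zero => simp
  | succ k ih =>
    rw [iteratedDeriv_succ, ih]
    funext u
    have h : HasDerivAt (fun u : ℝ => Real.cos (u - c + k * (Real.pi / 2)))
        (-Real.sin (u - c + k * (Real.pi / 2)) * 1) u :=
      ((((hasDerivAt_id u).sub_const c).add_const _).cos)
    rw [h.deriv, mul_one, ← Real.cos_add_pi_div_two]
    congr 1
    push_cast
    ring

/-- The test function `y ↦ cos (2π ⟨n, y⟩ - c)`. -/
def cosTest (n : Fin 3 → ℤ) (c : ℝ) : TestFn :=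
  ⟨fun y => Real.cos (freqForm n y - c), by
    refine ⟨by fun_prop, fun x j => ?_⟩
    have h : freqForm n (EuclideanSpace.single j (1 : ℝ)) = n j * (2 * Real.pi) := by
      simp [freqForm, intVec, EuclideanSpace.inner_single_right, mul_comm]
    change Real.cos (freqForm n (x + _) - c) = Real.cos (freqForm n x - c)
    rw [map_add, h, add_sub_right_comm, Real.cos_add_int_mul_two_pi]⟩

theorem cosTest_apply (n : Fin 3 → ℤ) (c : ℝ) (y : E3) :
    (cosTest n c : E3 → ℝ) y = Real.cos (freqForm n y - c) := rfl

theorem norm_iteratedFDeriv_cosTest_le (n : Fin 3 → ℤ) (c : ℝ) (k : ℕ) (x : E3) :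
    ‖iteratedFDeriv ℝ k (cosTest n c : E3 → ℝ) x‖ ≤ freq n ^ k := by
  have h := (freqForm n).iteratedFDeriv_comp_right (f := fun u : ℝ => Real.cos (u - c))
    (n := ∞) (by fun_prop) x (i := k) (by exact_mod_cast le_top)
  have e : (cosTest n c : E3 → ℝ) = (fun u : ℝ => Real.cos (u - c)) ∘ freqForm n := rfl
  rw [e, h]
  refine (ContinuousMultilinearMap.norm_compContinuousLinearMap_le _ _).trans ?_
  rw [norm_iteratedFDeriv_eq_norm_iteratedDeriv, iteratedDeriv_cos_sub]
  simp only [Finset.prod_const, Finset.card_univ, Fintype.card_fin, norm_freqForm]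
  have := Real.abs_cos_le_one (freqForm n x - c + k * (Real.pi / 2))
  rw [Real.norm_eq_abs]
  exact mul_le_of_le_one_left (pow_nonneg (freq_nonneg n) k) this

/-! ### Distributions on trigonometric test functions -/

section Dist

variable {F : Type*} [NormedAddCommGroup F] [NormedSpace ℝ F]

/-- The real substitute for complex characters: for a fixed frequency all phases lie in the span of
two, so a distribution depends on the phase explicitly. -/
theorem cosTest_eq (n : Fin 3 → ℤ) (c : ℝ) :
    cosTest n c = Real.cos c • cosTest n 0 + Real.sin c • cosTest n (Real.pi / 2) := by
  ext y
  simp only [Submodule.coe_add, Submodule.coe_smul, Pi.add_apply, Pi.smul_apply, cosTest_apply,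
    smul_eq_mul, sub_zero, Real.cos_sub_pi_div_two]
  rw [Real.cos_sub]
  ring

theorem toLin_cosTest (A : TDist F) (n : Fin 3 → ℤ) (c : ℝ) :
    A.toLin (cosTest n c) =
      Real.cos c • A.toLin (cosTest n 0) + Real.sin c • A.toLin (cosTest n (Real.pi / 2)) := by
  rw [cosTest_eq, map_add, map_smul, map_smul]

/-- A distribution has finite order, so its Fourier coefficients grow at most polynomially. -/
theorem exists_norm_toLin_cosTest_le (A : TDist F) :
    ∃ (N : ℕ) (C : ℝ), 0 ≤ C ∧ (∀ (φ : TestFn) (M : ℝ),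
      (∀ k ≤ N, ∀ x, ‖iteratedFDeriv ℝ k (φ : E3 → ℝ) x‖ ≤ M) → ‖A.toLin φ‖ ≤ C * M) ∧
      ∀ n c, ‖A.toLin (cosTest n c)‖ ≤ C * (1 + freq n) ^ N := by
  obtain ⟨N, C, hC⟩ := A.bounded
  have hC' : ∀ (φ : TestFn) (M : ℝ),
      (∀ k ≤ N, ∀ x, ‖iteratedFDeriv ℝ k (φ : E3 → ℝ) x‖ ≤ M) → ‖A.toLin φ‖ ≤ |C| * M := by
    intro φ M hM
    have h0 : 0 ≤ M := (norm_nonneg _).trans (hM 0 (Nat.zero_le _) 0)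
    exact (hC φ M hM).trans (mul_le_mul_of_nonneg_right (le_abs_self C) h0)
  refine ⟨N, |C|, abs_nonneg C, hC', fun n c => hC' _ _ fun k hk x => ?_⟩
  have h0 := freq_nonneg n
  calc _ ≤ freq n ^ k := norm_iteratedFDeriv_cosTest_le n c k x
    _ ≤ (1 + freq n) ^ k := by gcongr; linarith
    _ ≤ _ := pow_le_pow_right₀ (by linarith) hk

theorem norm_iteratedFDeriv_le_of_hasSum {w : (Fin 3 → ℤ) → ℝ} {c : (Fin 3 → ℤ) → ℝ}
    (hw : ∀ k : ℕ, Summable fun n => |w n| * freq n ^ k) {φ : E3 → ℝ}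
    (hφ : ∀ y, φ y = ∑' n, w n * (cosTest n (c n) : E3 → ℝ) y) (k : ℕ) (x : E3) :
    ‖iteratedFDeriv ℝ k φ x‖ ≤ ∑' n, |w n| * freq n ^ k := by
  have hb : ∀ (k : ℕ) (n : Fin 3 → ℤ) (x : E3),
      ‖iteratedFDeriv ℝ k (fun y => w n * (cosTest n (c n) : E3 → ℝ) y) x‖ ≤ |w n| * freq n ^ k := by
    intro k n x
    have h := iteratedFDeriv_const_smul_apply (𝕜 := ℝ) (i := k) (a := w n) (x := x)
      (f := (cosTest n (c n) : E3 → ℝ))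
      ((cosTest n (c n)).2.1.contDiffAt.of_le (by exact_mod_cast le_top))
    have h2 : (w n • (cosTest n (c n) : E3 → ℝ)) = fun y => w n * (cosTest n (c n) : E3 → ℝ) y := rfl
    rw [h2] at h
    rw [h, norm_smul, Real.norm_eq_abs]
    gcongr
    exact norm_iteratedFDeriv_cosTest_le n (c n) k x
  rw [funext hφ, iteratedFDeriv_tsum_apply (N := ⊤) (v := fun k n => |w n| * freq n ^ k)
    (fun n => contDiff_const.mul (cosTest n (c n)).2.1) (fun k _ => hw k)
    (fun k n x _ => hb k n x) le_top]
  exact tsum_of_norm_bounded (hw k).hasSum fun n => hb k n x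

/-- Distributions may be applied termwise to rapidly convergent Fourier series. -/
theorem hasSum_toLin (A : TDist F) {w : (Fin 3 → ℤ) → ℝ} {c : (Fin 3 → ℤ) → ℝ}
    (hw : ∀ k : ℕ, Summable fun n => |w n| * (1 + freq n) ^ k) (φ : TestFn)
    (hφ : ∀ y, HasSum (fun n => w n * (cosTest n (c n) : E3 → ℝ) y) ((φ : E3 → ℝ) y)) :
    HasSum (fun n => w n • A.toLin (cosTest n (c n))) (A.toLin φ) := by
  obtain ⟨N, C, hC0, hC, -⟩ := exists_norm_toLin_cosTest_le A
  have hle : ∀ n k, k ≤ N → freq n ^ k ≤ (1 + freq n) ^ N := fun n k hk => by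
    have h0 := freq_nonneg n
    calc freq n ^ k ≤ (1 + freq n) ^ k := by gcongr; linarith
      _ ≤ _ := pow_le_pow_right₀ (by linarith) hk
  have hw' : ∀ k : ℕ, Summable fun n => |w n| * freq n ^ k := fun k =>
    (hw k).of_nonneg_of_le (fun n => mul_nonneg (abs_nonneg _) (pow_nonneg (freq_nonneg n) k))
      fun n => by
        have h0 := freq_nonneg n
        gcongr
        linarith
  rw [HasSum, SummationFilter.unconditional_filter, tendsto_iff_norm_sub_tendsto_zero]
  have key : ∀ S : Finset (Fin 3 → ℤ), ‖∑ n ∈ S, w n • A.toLin (cosTest n (c n)) - A.toLin φ‖ ≤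
      C * ((∑' n, |w n| * (1 + freq n) ^ N) - ∑ n ∈ S, |w n| * (1 + freq n) ^ N) := by
    intro S
    have e1 : ∑ n ∈ S, w n • A.toLin (cosTest n (c n)) - A.toLin φ =
        -A.toLin (φ - ∑ n ∈ S, w n • cosTest n (c n)) := by
      rw [map_sub, map_sum]
      simp
    rw [e1, norm_neg]
    refine hC _ _ fun k hk x => ?_
    -- With the weights on `S` set to zero, `φ` minus its partial sum is again a Fourier series, so
    -- its seminorms are bounded by tails of convergent series.
    let w' : (Fin 3 → ℤ) → ℝ := fun n => if n ∈ S then 0 else w n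
    have hw'le : ∀ n, |w' n| ≤ |w n| := fun n => by
      simp only [w']
      split_ifs <;> simp
    have hs' : ∀ k : ℕ, Summable fun n => |w' n| * freq n ^ k := fun k =>
      (hw' k).of_nonneg_of_le (fun n => mul_nonneg (abs_nonneg _) (pow_nonneg (freq_nonneg n) k))
        fun n => mul_le_mul_of_nonneg_right (hw'le n) (pow_nonneg (freq_nonneg n) k)
    refine (norm_iteratedFDeriv_le_of_hasSum (w := w') (c := c) hs' (fun y => ?_) k x).trans ?_
    · have h1 := (hφ y).sub (hasSum_sum_of_ne_finset_zero (s := S)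
        (f := fun n => if n ∈ S then w n * (cosTest n (c n) : E3 → ℝ) y else 0)
        fun n hn => if_neg hn)
      have h2 : ∑ n ∈ S, (if n ∈ S then w n * (cosTest n (c n) : E3 → ℝ) y else 0) =
          ∑ n ∈ S, w n * (cosTest n (c n) : E3 → ℝ) y :=
        Finset.sum_congr rfl fun n hn => if_pos hn
      rw [h2] at h1
      have h3 : ((φ - ∑ n ∈ S, w n • cosTest n (c n) : TestFn) : E3 → ℝ) y =
          (φ : E3 → ℝ) y - ∑ n ∈ S, w n * (cosTest n (c n) : E3 → ℝ) y := by
        simp [Finset.sum_apply]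
      rw [h3, ← h1.tsum_eq]
      refine tsum_congr fun n => ?_
      simp only [w']
      split_ifs <;> simp
    · have h1 := (hw N).hasSum.sub (hasSum_sum_of_ne_finset_zero (s := S)
        (f := fun n => if n ∈ S then |w n| * (1 + freq n) ^ N else 0)
        fun n hn => if_neg hn)
      have h2 : ∑ n ∈ S, (if n ∈ S then |w n| * (1 + freq n) ^ N else 0) =
          ∑ n ∈ S, |w n| * (1 + freq n) ^ N :=
        Finset.sum_congr rfl fun n hn => if_pos hn
      rw [h2] at h1
      refine (hasSum_le (fun n => ?_) (hs' k).hasSum h1)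
      simp only [w']
      split_ifs with hn
      · simp
      · simp only [sub_zero]
        gcongr
        exact hle n k hk
  have hlim : Tendsto (fun S : Finset (Fin 3 → ℤ) =>
      C * ((∑' n, |w n| * (1 + freq n) ^ N) - ∑ n ∈ S, |w n| * (1 + freq n) ^ N)) atTop
      (𝓝 (C * ((∑' n, |w n| * (1 + freq n) ^ N) - ∑' n, |w n| * (1 + freq n) ^ N))) :=
    ((hw N).hasSum.const_sub _).const_mul _
  rw [sub_self, mul_zero] at hlim
  exact squeeze_zero (fun _ => norm_nonneg _) key hlim

end Dist

/-! ### Gaussian sums over the lattice -/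

theorem summable_lattice :
    Summable fun n : Fin 3 → ℤ => ∏ j : Fin 3, (1 + (n j : ℝ) ^ 2)⁻¹ := by
  have h1 : Summable fun n : ℤ => (1 + (n : ℝ) ^ 2)⁻¹ := by
    have h2 : Summable fun n : ℤ => 1 / (n : ℝ) ^ 2 := Real.summable_one_div_int_pow.2 (by norm_num)
    have h3 : Summable fun n : ℤ => if n = 0 then (1 : ℝ) else 0 :=
      (hasSum_ite_eq (0 : ℤ) (1 : ℝ)).summable
    refine (h2.add h3).of_nonneg_of_le (fun n => by positivity) fun n => ?_
    by_cases hn : n = 0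
    · simp [hn]
    · have : 0 < (n : ℝ) ^ 2 := by positivity
      simp only [hn, if_false, add_zero, one_div]
      gcongr
      linarith
  exact (hasSum_prod_three (f := fun _ n => (1 + (n : ℝ) ^ 2)⁻¹) (fun _ => h1.hasSum)
    (fun _ => h1.norm)).summable

/-- The Gaussian weights `exp (-4π² s |n|²)`. -/
def gaussWeight (s : ℝ) (n : Fin 3 → ℤ) : ℝ := Real.exp (-(s * freq n ^ 2))

theorem gaussWeight_pos (s : ℝ) (n : Fin 3 → ℤ) : 0 < gaussWeight s n := Real.exp_pos _

theorem gaussWeight_add (s t : ℝ) (n : Fin 3 → ℤ) :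
    gaussWeight (s + t) n = gaussWeight s n * gaussWeight t n := by
  rw [gaussWeight, gaussWeight, gaussWeight, ← Real.exp_add]
  ring_nf

/-- Half of the Gaussian weight absorbs the polynomial growth, and the other half is bounded by a
summable product, at the price of one factor `s⁻¹` per coordinate (the `3` in the exponent). -/
theorem exists_gaussWeight_le (k : ℕ) : ∃ C, 0 ≤ C ∧ ∀ s ∈ Ioc (0 : ℝ) 1, ∀ n,
    gaussWeight s n * (1 + freq n) ^ k ≤
      C * (s⁻¹) ^ (k + 3) * ∏ j : Fin 3, (1 + (n j : ℝ) ^ 2)⁻¹ := by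
  refine ⟨k.factorial * Real.exp 2, by positivity, fun s hs n => ?_⟩
  have hs0 := hs.1
  have hf := freq_nonneg n
  have hsi : 1 ≤ s⁻¹ := (one_le_inv₀ hs0).2 hs.2
  set v := √s * freq n with hv
  have hv0 : 0 ≤ v := by positivity
  have h1 : 1 + freq n ≤ s⁻¹ * (1 + v) := by
    have h2 : s ≤ √s := Real.le_sqrt_of_sq_le (by nlinarith [hs.2])
    have h3 : freq n ≤ s⁻¹ * v := by
      rw [hv, ← mul_assoc]
      have : 1 ≤ s⁻¹ * √s := by
        rw [inv_mul_eq_div, one_le_div hs0]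
        exact h2
      exact le_mul_of_one_le_left hf this
    nlinarith
  have h2 : (1 + v) ^ k ≤ k.factorial * Real.exp (1 + v) := by
    have := Real.pow_div_factorial_le_exp (1 + v) (by positivity) k
    rwa [div_le_iff₀' (by positivity)] at this
  have h3 : gaussWeight s n = Real.exp (-v ^ 2) := by
    rw [gaussWeight, hv, mul_pow, Real.sq_sqrt hs0.le]
  have h4 : Real.exp (-v ^ 2) * Real.exp (1 + v) ≤ Real.exp 2 * Real.exp (-v ^ 2 / 2) := by
    rw [← Real.exp_add, ← Real.exp_add, Real.exp_le_exp]
    nlinarith [sq_nonneg (v - 1)]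
  have h5 : Real.exp (-v ^ 2 / 2) ≤ (s⁻¹) ^ 3 * ∏ j : Fin 3, (1 + (n j : ℝ) ^ 2)⁻¹ := by
    have e1 : Real.exp (-v ^ 2 / 2) = ∏ j : Fin 3, Real.exp (-(2 * Real.pi ^ 2 * s * (n j : ℝ) ^ 2)) := by
      rw [← Real.exp_sum]
      congr 1
      rw [hv, mul_pow, Real.sq_sqrt hs0.le, freq, mul_pow, norm_sq_intVec, Finset.sum_neg_distrib,
        ← Finset.mul_sum]
      ring
    have e2 : (s⁻¹) ^ 3 * ∏ j : Fin 3, (1 + (n j : ℝ) ^ 2)⁻¹ =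
        ∏ j : Fin 3, (s⁻¹ * (1 + (n j : ℝ) ^ 2)⁻¹) := by
      rw [Finset.prod_mul_distrib]
      simp
    rw [e1, e2]
    refine Finset.prod_le_prod (fun _ _ => (Real.exp_pos _).le) fun j _ => ?_
    rw [Real.exp_neg, ← mul_inv]
    gcongr
    have h6 := Real.add_one_le_exp (2 * Real.pi ^ 2 * s * (n j : ℝ) ^ 2)
    have h7 : (1 : ℝ) ≤ 2 * Real.pi ^ 2 := by nlinarith [Real.pi_gt_three]
    have h8 : s * (n j : ℝ) ^ 2 ≤ (2 * Real.pi ^ 2) * (s * (n j : ℝ) ^ 2) :=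
      le_mul_of_one_le_left (by positivity) h7
    nlinarith [hs.2]
  have hE := Real.exp_pos (-v ^ 2)
  calc gaussWeight s n * (1 + freq n) ^ k ≤ Real.exp (-v ^ 2) * (s⁻¹ * (1 + v)) ^ k := by
        rw [h3]
        gcongr
    _ = (s⁻¹) ^ k * (Real.exp (-v ^ 2) * (1 + v) ^ k) := by rw [mul_pow s⁻¹ (1 + v) k]; ring
    _ ≤ (s⁻¹) ^ k * (Real.exp (-v ^ 2) * (k.factorial * Real.exp (1 + v))) := by gcongr
    _ = (s⁻¹) ^ k * k.factorial * (Real.exp (-v ^ 2) * Real.exp (1 + v)) := by ring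
    _ ≤ (s⁻¹) ^ k * k.factorial * (Real.exp 2 * Real.exp (-v ^ 2 / 2)) := by gcongr
    _ ≤ (s⁻¹) ^ k * k.factorial * (Real.exp 2 *
        ((s⁻¹) ^ 3 * ∏ j : Fin 3, (1 + (n j : ℝ) ^ 2)⁻¹)) := by gcongr
    _ = _ := by ring

theorem summable_gaussWeight {s : ℝ} (hs : 0 < s) (k : ℕ) :
    Summable fun n => gaussWeight s n * (1 + freq n) ^ k := by
  obtain ⟨C, hC0, hC⟩ := exists_gaussWeight_le k
  refine (summable_lattice.mul_left (C * ((min s 1)⁻¹) ^ (k + 3))).of_nonneg_of_le (fun n => ?_)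
    fun n => ?_
  · have := freq_nonneg n
    have := gaussWeight_pos s n
    positivity
  · refine le_trans ?_ (hC (min s 1) ⟨lt_min hs one_pos, min_le_right _ _⟩ n)
    have := freq_nonneg n
    gcongr
    unfold gaussWeight
    gcongr
    exact min_le_left _ _

/-! ### Smooth functions under the heat semigroup -/

section Smooth

theorem fderiv_gauss_smooth {F : Type u} [NormedAddCommGroup F] [NormedSpace ℝ F] [CompleteSpace F]
    (h : ℝ) {f : E3 → F} (hper : Periodic f) (hf : ContDiff ℝ 1 f) :
    (∀ x, HasFDerivAt (gauss h f) (gauss h (fderiv ℝ f) x) x) := by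
  obtain ⟨M, -, hM⟩ := hper.exists_bound hf.continuous
  obtain ⟨M', -, hM'⟩ := hper.fderiv.exists_bound (hf.continuous_fderiv one_ne_zero)
  exact hasFDerivAt_gauss_fderiv h (hf.differentiable one_ne_zero)
    (hf.continuous_fderiv one_ne_zero) hM hM'

theorem contDiff_gauss (n : ℕ) : ∀ {F : Type u} [NormedAddCommGroup F] [NormedSpace ℝ F]
    [CompleteSpace F] (h : ℝ) {f : E3 → F}, Periodic f → ContDiff ℝ n f →
    ContDiff ℝ n (gauss h f) := by
  induction n with
  | zero =>
    intro F _ _ _ h f hper hf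
    obtain ⟨M, -, hM⟩ := hper.exists_bound hf.continuous
    exact contDiff_zero.2 (continuous_gauss hf.continuous hM)
  | succ n ih =>
    intro F _ _ _ h f hper hf
    have h1 := fderiv_gauss_smooth h hper (hf.of_le (by norm_cast; omega))
    push_cast at hf ⊢
    rw [contDiff_succ_iff_fderiv] at hf ⊢
    refine ⟨fun x => (h1 x).differentiableAt, by simp, ?_⟩
    rw [funext fun x => (h1 x).fderiv]
    exact ih h hper.fderiv hf.2.2

theorem Periodic.iteratedFDeriv {F : Type u} [NormedAddCommGroup F] [NormedSpace ℝ F] {f : E3 → F}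
    (hf : Periodic f) (k : ℕ) : Periodic (iteratedFDeriv ℝ k f) := by
  intro x j
  have h : f = fun y => f (y + EuclideanSpace.single j (1 : ℝ)) := funext fun y => (hf y j).symm
  conv_rhs => rw [h, iteratedFDeriv_comp_add_right]

theorem iteratedFDeriv_gauss {F : Type u} [NormedAddCommGroup F] [NormedSpace ℝ F] [CompleteSpace F]
    (h : ℝ) {f : E3 → F} (hper : Periodic f) (hf : ContDiff ℝ ∞ f) (k : ℕ) :
    iteratedFDeriv ℝ k (gauss h f) = gauss h (iteratedFDeriv ℝ k f) := by
  induction k with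
  | zero =>
    obtain ⟨M, -, hM⟩ := hper.exists_bound hf.continuous
    rw [iteratedFDeriv_zero_eq_comp, iteratedFDeriv_zero_eq_comp]
    funext x
    exact (gauss_clm (ContinuousLinearEquiv.toContinuousLinearMap
      (continuousMultilinearCurryFin0 ℝ E3 F).symm.toContinuousLinearEquiv)
      hf.continuous hM x).symm
  | succ k ih =>
    have hk : ContDiff ℝ 1 (iteratedFDeriv ℝ k f) :=
      hf.iteratedFDeriv_right (m := 1) (by exact_mod_cast le_top)
    have h1 := fderiv_gauss_smooth h (hper.iteratedFDeriv k) hk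
    obtain ⟨M, -, hM⟩ := (hper.iteratedFDeriv k).fderiv.exists_bound (hk.continuous_fderiv one_ne_zero)
    rw [iteratedFDeriv_succ_eq_comp_left, iteratedFDeriv_succ_eq_comp_left, ih,
      funext fun x => (h1 x).fderiv]
    funext x
    exact (gauss_clm (ContinuousLinearEquiv.toContinuousLinearMap
      (continuousMultilinearCurryLeftEquiv ℝ (fun _ : Fin (k + 1) => E3)
        F).symm.toContinuousLinearEquiv) (hk.continuous_fderiv one_ne_zero) hM x).symm

theorem norm_gauss_sub_self_le {F : Type u} [NormedAddCommGroup F] [NormedSpace ℝ F]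
    [CompleteSpace F] (h : ℝ) {f : E3 → F} (hf : Differentiable ℝ f) {M N : ℝ}
    (hM : ∀ x, ‖f x‖ ≤ M) (hN : ∀ x, ‖fderiv ℝ f x‖ ≤ N) (x : E3) :
    ‖gauss h f x - f x‖ ≤ N * √(2 * h) * gmMean := by
  have h1 : gauss h f x - f x = ∫ z, (f (x + √(2 * h) • z) - f x) ∂gm := by
    rw [integral_sub (integrable_comp_gm hf.continuous hM x _) (integrable_const _)]
    simp [gauss]
  rw [h1, gmMean, ← integral_const_mul]
  refine norm_integral_le_of_norm_le (integrable_norm_gm.const_mul _)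
    (Eventually.of_forall fun z => ?_)
  have h3 := Convex.norm_image_sub_le_of_norm_fderiv_le (s := univ) (f := f) (𝕜 := ℝ)
      (fun z _ => hf z) (fun z _ => hN z) convex_univ (mem_univ x) (mem_univ (x + √(2 * h) • z))
  rw [add_sub_cancel_left, norm_smul, Real.norm_of_nonneg (Real.sqrt_nonneg _), ← mul_assoc] at h3
  exact h3

/-- The heat semigroup on test functions. -/
def gaussTest (h : ℝ) (φ : TestFn) : TestFn :=
  ⟨gauss h φ, contDiff_infty.2 fun n => contDiff_gauss n h φ.2.2
    (φ.2.1.of_le (by exact_mod_cast le_top)), φ.2.2.gauss h⟩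

end Smooth

/-! ### The heat flow of a distribution: Fourier series, semigroup law, symmetry -/

section Heat

variable {F : Type u} [NormedAddCommGroup F] [NormedSpace ℝ F]

theorem gaussWeight_eq (s : ℝ) (n : Fin 3 → ℤ) :
    gaussWeight s n = Real.exp (-(4 * Real.pi ^ 2 * s * ‖intVec n‖ ^ 2)) := by
  rw [gaussWeight, freq]
  ring_nf

theorem hasSum_heatTest {s : ℝ} (hs : 0 < s) (x y : E3) :
    HasSum (fun n => gaussWeight s n * (cosTest n (freqForm n x) : E3 → ℝ) y)
      ((heatTest s x : E3 → ℝ) y) := by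
  refine (hasSum_heatKernel hs (x - y)).congr_fun fun n => ?_
  rw [gaussWeight_eq, cosTest_apply, ← map_sub, ← Real.cos_neg, ← map_neg, neg_sub]
  simp [freqForm]

theorem hasSum_heat {s : ℝ} (hs : 0 < s) (A : TDist F) (x : E3) :
    HasSum (fun n => gaussWeight s n • A.toLin (cosTest n (freqForm n x))) (heat s A x) :=
  hasSum_toLin A (fun k => by
    simpa only [abs_of_pos (gaussWeight_pos s _)] using summable_gaussWeight hs k) _
    (hasSum_heatTest hs x)

theorem periodic_heat (s : ℝ) (A : TDist F) : Periodic (heat s A) := by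
  intro x j
  unfold heat
  congr 1
  ext y
  have h := (heatKernel_shift_mem s x).2 (y - EuclideanSpace.single j (1 : ℝ)) j
  simp only [sub_add_cancel] at h
  change heatKernel s (x + _ - y) = heatKernel s (x - y)
  rw [h]
  congr 1
  abel

theorem continuous_toLin_cosTest (A : TDist F) (n : Fin 3 → ℤ) :
    Continuous fun c => A.toLin (cosTest n c) := by
  rw [funext fun c => toLin_cosTest A n c]
  fun_prop

theorem continuous_heat [CompleteSpace F] {s : ℝ} (hs : 0 < s) (A : TDist F) : Continuous (heat s A) := by
  obtain ⟨N, C, hC0, -, hC⟩ := exists_norm_toLin_cosTest_le A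
  rw [funext fun x => (hasSum_heat hs A x).tsum_eq.symm]
  refine continuous_tsum (u := fun n => C * (gaussWeight s n * (1 + freq n) ^ N)) (fun n => ?_)
    ((summable_gaussWeight hs N).mul_left C) fun n x => ?_
  · exact ((continuous_toLin_cosTest A n).comp (freqForm n).continuous).const_smul _
  · rw [norm_smul, Real.norm_of_nonneg (gaussWeight_pos s n).le]
    calc _ ≤ gaussWeight s n * (C * (1 + freq n) ^ N) :=
          mul_le_mul_of_nonneg_left (hC n _) (gaussWeight_pos s n).le
      _ = _ := by ring

/-- The exponent depends on the order of `A`, so this bound is only qualitative. It serves to start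
the improvement in `exists_norm_heat_le_rpow`. -/
theorem exists_norm_heat_le (A : TDist F) :
    ∃ (N : ℕ) (C : ℝ), 0 ≤ C ∧ ∀ s ∈ Ioc (0 : ℝ) 1, ∀ x, ‖heat s A x‖ ≤ C * (s⁻¹) ^ N := by
  obtain ⟨N, C, hC0, -, hC⟩ := exists_norm_toLin_cosTest_le A
  obtain ⟨K, hK0, hK⟩ := exists_gaussWeight_le N
  refine ⟨N + 3, C * (K * ∑' n : Fin 3 → ℤ, ∏ j : Fin 3, (1 + (n j : ℝ) ^ 2)⁻¹),
    mul_nonneg hC0 (mul_nonneg hK0 (tsum_nonneg fun n => by positivity)), fun s hs x => ?_⟩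
  rw [← (hasSum_heat hs.1 A x).tsum_eq]
  have h1 : HasSum (fun n : Fin 3 → ℤ => C * (K * (s⁻¹) ^ (N + 3) * ∏ j : Fin 3, (1 + (n j : ℝ) ^ 2)⁻¹))
      (C * (K * (s⁻¹) ^ (N + 3) * ∑' n : Fin 3 → ℤ, ∏ j : Fin 3, (1 + (n j : ℝ) ^ 2)⁻¹)) :=
    ((summable_lattice.hasSum).mul_left _).mul_left _
  refine (tsum_of_norm_bounded h1 fun n => ?_).trans (le_of_eq (by ring))
  rw [norm_smul, Real.norm_of_nonneg (gaussWeight_pos s n).le]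
  calc _ ≤ gaussWeight s n * (C * (1 + freq n) ^ N) :=
        mul_le_mul_of_nonneg_left (hC n _) (gaussWeight_pos s n).le
    _ = C * (gaussWeight s n * (1 + freq n) ^ N) := by ring
    _ ≤ _ := mul_le_mul_of_nonneg_left (hK s hs n) hC0

theorem integral_cos_gm (a : ℝ) (w : E3) :
    ∫ z, Real.cos (a + inner ℝ z w) ∂gm = Real.exp (-‖w‖ ^ 2 / 2) * Real.cos a := by
  have h := charFun_stdGaussian w
  rw [charFun_apply] at h
  have h1 : ∫ z, Complex.exp (a * Complex.I) * Complex.exp (inner ℝ z w * Complex.I) ∂gm =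
      Complex.exp (a * Complex.I) * Complex.exp (-‖w‖ ^ 2 / 2) := by
    rw [integral_const_mul, h]
  have h2 := congrArg Complex.re h1
  have hi : Integrable (fun z : E3 => Complex.exp (a * Complex.I) *
      Complex.exp (inner ℝ z w * Complex.I)) gm := by
    refine Integrable.of_bound (C := 1) (aesm_of_continuous (by fun_prop) _)
      (Eventually.of_forall fun z => ?_)
    rw [norm_mul, Complex.norm_exp_ofReal_mul_I, Complex.norm_exp_ofReal_mul_I, mul_one]
  have h3 := integral_re hi
  simp only [RCLike.re_eq_complex_re] at h3
  rw [← h3] at h2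
  have h4 : ∀ z : E3, (Complex.exp (a * Complex.I) * Complex.exp (inner ℝ z w * Complex.I)).re =
      Real.cos (a + inner ℝ z w) := by
    intro z
    rw [← Complex.exp_add, ← add_mul, ← Complex.ofReal_add, Complex.exp_ofReal_mul_I_re]
  simp_rw [h4] at h2
  rw [h2]
  have h5 : Complex.exp (-(‖w‖ : ℂ) ^ 2 / 2) = ((Real.exp (-‖w‖ ^ 2 / 2) : ℝ) : ℂ) := by
    push_cast
    rfl
  rw [h5, Complex.re_mul_ofReal, Complex.exp_ofReal_mul_I_re, mul_comm]

/-- Each Fourier mode is an eigenfunction of the heat flow: the characteristic function of the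
Gaussian gives the eigenvalue `exp (-t |2πn|²)`. -/
theorem gauss_toLin_cosTest [CompleteSpace F] (A : TDist F) (n : Fin 3 → ℤ) {t : ℝ} (ht : 0 ≤ t)
    (x : E3) :
    gauss t (fun x => A.toLin (cosTest n (freqForm n x))) x =
      gaussWeight t n • A.toLin (cosTest n (freqForm n x)) := by
  have hw : ∀ z : E3, freqForm n (x + √(2 * t) • z) =
      freqForm n x + inner ℝ z ((2 * Real.pi * √(2 * t)) • intVec n) := by
    intro z
    rw [map_add, map_smul, real_inner_smul_right, real_inner_comm]
    simp [freqForm]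
    ring
  have hn : Real.exp (-‖(2 * Real.pi * √(2 * t)) • intVec n‖ ^ 2 / 2) = gaussWeight t n := by
    rw [gaussWeight, norm_smul, mul_pow, Real.norm_eq_abs, sq_abs, mul_pow,
      Real.sq_sqrt (by positivity), freq]
    ring_nf
  have hc := integral_cos_gm (freqForm n x) ((2 * Real.pi * √(2 * t)) • intVec n)
  have hs := integral_cos_gm (freqForm n x - Real.pi / 2) ((2 * Real.pi * √(2 * t)) • intVec n)
  simp_rw [sub_add_eq_add_sub, Real.cos_sub_pi_div_two] at hs
  rw [hn] at hc hs
  have he : ∀ z : E3, A.toLin (cosTest n (freqForm n (x + √(2 * t) • z))) =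
      Real.cos (freqForm n x + inner ℝ z ((2 * Real.pi * √(2 * t)) • intVec n)) •
        A.toLin (cosTest n 0) +
      Real.sin (freqForm n x + inner ℝ z ((2 * Real.pi * √(2 * t)) • intVec n)) •
        A.toLin (cosTest n (Real.pi / 2)) := fun z => by
    rw [toLin_cosTest, hw]
  simp only [gauss, he]
  rw [toLin_cosTest A n (freqForm n x), integral_add, integral_smul_const, integral_smul_const, hc, hs]
  · simp only [smul_add, smul_smul]
  · exact (Integrable.of_bound (C := 1) (aesm_of_continuous (by fun_prop) _)
      (Eventually.of_forall fun z => by simpa using Real.abs_cos_le_one _)).smul_const _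
  · exact (Integrable.of_bound (C := 1) (aesm_of_continuous (by fun_prop) _)
      (Eventually.of_forall fun z => by simpa using Real.abs_sin_le_one _)).smul_const _

/-- The semigroup property of the heat flow on distributions. -/
theorem gauss_heat [CompleteSpace F] {s t : ℝ} (hs : 0 < s) (ht : 0 ≤ t) (A : TDist F) (x : E3) :
    gauss t (heat s A) x = heat (s + t) A x := by
  obtain ⟨N, C, hC0, -, hC⟩ := exists_norm_toLin_cosTest_le A
  have hb : ∀ n y, ‖gaussWeight s n • A.toLin (cosTest n (freqForm n y))‖ ≤
      C * (gaussWeight s n * (1 + freq n) ^ N) := fun n y => by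
    rw [norm_smul, Real.norm_of_nonneg (gaussWeight_pos s n).le]
    calc _ ≤ gaussWeight s n * (C * (1 + freq n) ^ N) :=
          mul_le_mul_of_nonneg_left (hC n _) (gaussWeight_pos s n).le
      _ = _ := by ring
  have hcont : ∀ n, Continuous fun y => gaussWeight s n • A.toLin (cosTest n (freqForm n y)) :=
    fun n => ((continuous_toLin_cosTest A n).comp (freqForm n).continuous).const_smul _
  have h1 := hasSum_integral_of_summable_integral_norm (μ := gm)
    (F := fun n z => gaussWeight s n • A.toLin (cosTest n (freqForm n (x + √(2 * t) • z))))
    (fun n => integrable_comp_gm (hcont n) (hb n) x _)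
    (((summable_gaussWeight hs N).mul_left C).of_nonneg_of_le
      (fun n => integral_nonneg fun _ => norm_nonneg _) fun n => by
      refine (integral_mono_of_nonneg (Eventually.of_forall fun _ => norm_nonneg _)
        (integrable_const (C * (gaussWeight s n * (1 + freq n) ^ N)))
        (Eventually.of_forall fun z => hb n _)).trans (by simp))
  have h2 : (∫ z, ∑' n, gaussWeight s n • A.toLin (cosTest n (freqForm n (x + √(2 * t) • z))) ∂gm) =
      gauss t (heat s A) x := by
    simp only [gauss]
    congr 1
    funext z
    exact (hasSum_heat hs A _).tsum_eq
  rw [h2] at h1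
  refine h1.unique ((hasSum_heat (by positivity) A x).congr_fun fun n => ?_)
  rw [integral_smul, gaussWeight_add, mul_smul]
  congr 1
  exact gauss_toLin_cosTest A n ht x

/-- The Fourier coefficients of a test function. -/
def fourierCoef (φ : TestFn) (n : Fin 3 → ℤ) : ℂ :=
  ⟨∫ x in cell, (φ : E3 → ℝ) x * Real.cos (freqForm n x),
    ∫ x in cell, (φ : E3 → ℝ) x * Real.sin (freqForm n x)⟩

theorem integrable_testFn_mul (φ : TestFn) {g : E3 → ℝ} (hg : Continuous g) (hg1 : ∀ x, |g x| ≤ 1) :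
    Integrable (fun x => (φ : E3 → ℝ) x * g x) (volume.restrict cell) := by
  have hφc : Continuous (φ : E3 → ℝ) := φ.2.1.continuous
  obtain ⟨M, hM0, hM⟩ := Periodic.exists_bound φ.2.2 hφc
  exact Integrable.of_bound (C := M) (aesm_of_continuous (by fun_prop) _)
    (Eventually.of_forall fun x => by
      rw [norm_mul]
      exact (mul_le_of_le_one_right (norm_nonneg _) (hg1 x)).trans (hM x))

theorem exists_norm_fourierCoef_le (φ : TestFn) : ∃ K, ∀ n, ‖fourierCoef φ n‖ ≤ K := by
  obtain ⟨M, hM0, hM⟩ := Periodic.exists_bound φ.2.2 φ.2.1.continuous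
  have hb : ∀ g : E3 → ℝ, (∀ x, |g x| ≤ 1) →
      |∫ x in cell, (φ : E3 → ℝ) x * g x| ≤ M * volume.real cell := fun g hg => by
    have := norm_setIntegral_le_of_norm_le_const (μ := volume) (s := cell) (C := M)
      (f := fun x => (φ : E3 → ℝ) x * g x) volume_cell_lt_top fun x _ => by
        rw [norm_mul]
        exact (mul_le_of_le_one_right (norm_nonneg _) (hg x)).trans (hM x)
    exact this
  refine ⟨M * volume.real cell + M * volume.real cell, fun n => ?_⟩
  exact (Complex.norm_le_abs_re_add_abs_im _).trans
    (add_le_add (hb _ fun x => Real.abs_cos_le_one _) (hb _ fun x => Real.abs_sin_le_one _))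

/-- Parseval in real form. For each frequency the cosine and sine integrals of `φ` are put in polar
form, so that the mode contributes a single `cosTest` whose phase is the argument of the Fourier
coefficient. -/
theorem hasSum_integral_smul_heat [CompleteSpace F] (B : TDist F) (φ : TestFn) {t : ℝ} (ht : 0 < t) :
    HasSum (fun n => (gaussWeight t n * ‖fourierCoef φ n‖) •
        B.toLin (cosTest n (fourierCoef φ n).arg))
      (∫ x in cell, (φ : E3 → ℝ) x • heat t B x) := by
  have hφc : Continuous (φ : E3 → ℝ) := φ.2.1.continuous
  obtain ⟨M, hM0, hM⟩ := Periodic.exists_bound φ.2.2 hφc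
  have hip : ∀ n, Integrable (fun x => (φ : E3 → ℝ) x * Real.cos (freqForm n x))
      (volume.restrict cell) := fun n => integrable_testFn_mul φ
    (Real.continuous_cos.comp (freqForm n).continuous) fun x => Real.abs_cos_le_one _
  have hiq : ∀ n, Integrable (fun x => (φ : E3 → ℝ) x * Real.sin (freqForm n x))
      (volume.restrict cell) := fun n => integrable_testFn_mul φ
    (Real.continuous_sin.comp (freqForm n).continuous) fun x => Real.abs_sin_le_one _
  obtain ⟨N, C, hC0, -, hC⟩ := exists_norm_toLin_cosTest_le B
  have hb : ∀ n x, ‖(φ : E3 → ℝ) x • gaussWeight t n • B.toLin (cosTest n (freqForm n x))‖ ≤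
      M * (C * (gaussWeight t n * (1 + freq n) ^ N)) := fun n x => by
    rw [norm_smul, norm_smul, Real.norm_of_nonneg (gaussWeight_pos t n).le]
    have := freq_nonneg n
    have := (gaussWeight_pos t n).le
    calc _ ≤ M * (gaussWeight t n * (C * (1 + freq n) ^ N)) := by
          gcongr
          · exact hM x
          · exact hC n _
      _ = _ := by ring
  have h1 := hasSum_integral_of_summable_integral_norm (μ := volume.restrict cell)
    (F := fun n x => (φ : E3 → ℝ) x • gaussWeight t n • B.toLin (cosTest n (freqForm n x)))
    (fun n => Integrable.of_bound (C := M * (C * (gaussWeight t n * (1 + freq n) ^ N)))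
      (aesm_of_continuous (hφc.smul
        (((continuous_toLin_cosTest B n).comp (freqForm n).continuous).const_smul _)) _)
      (Eventually.of_forall fun x => hb n x))
    ((((summable_gaussWeight ht N).mul_left C).mul_left M |>.mul_right
      (volume.real cell)).of_nonneg_of_le
      (fun n => integral_nonneg fun _ => norm_nonneg _) fun n => by
        refine (integral_mono_of_nonneg (Eventually.of_forall fun _ => norm_nonneg _)
          (integrable_const (M * (C * (gaussWeight t n * (1 + freq n) ^ N))))
          (Eventually.of_forall fun z => hb n _)).trans (le_of_eq ?_)
        rw [integral_const, smul_eq_mul, mul_comm, Measure.real, Measure.restrict_apply_univ,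
          Measure.real])
  have h2 : (∫ x in cell, ∑' n, (φ : E3 → ℝ) x • gaussWeight t n •
      B.toLin (cosTest n (freqForm n x))) = ∫ x in cell, (φ : E3 → ℝ) x • heat t B x := by
    congr 1
    funext x
    rw [tsum_const_smul'', (hasSum_heat ht B x).tsum_eq]
  rw [h2] at h1
  refine h1.congr_fun fun n => ?_
  have hrc : ‖fourierCoef φ n‖ * Real.cos (fourierCoef φ n).arg =
      ∫ x in cell, (φ : E3 → ℝ) x * Real.cos (freqForm n x) := Complex.norm_mul_cos_arg _
  have hrs : ‖fourierCoef φ n‖ * Real.sin (fourierCoef φ n).arg =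
      ∫ x in cell, (φ : E3 → ℝ) x * Real.sin (freqForm n x) := Complex.norm_mul_sin_arg _
  rw [toLin_cosTest B n (fourierCoef φ n).arg, smul_add, smul_smul, smul_smul, mul_assoc, hrc,
    mul_assoc, hrs]
  have h3 : ∀ x, (φ : E3 → ℝ) x • gaussWeight t n • B.toLin (cosTest n (freqForm n x)) =
      gaussWeight t n • (((φ : E3 → ℝ) x * Real.cos (freqForm n x)) • B.toLin (cosTest n 0) +
        ((φ : E3 → ℝ) x * Real.sin (freqForm n x)) • B.toLin (cosTest n (Real.pi / 2))) := by
    intro x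
    rw [toLin_cosTest B n (freqForm n x)]
    module
  simp_rw [h3]
  rw [integral_smul, integral_add ((hip n).smul_const _) ((hiq n).smul_const _),
    integral_smul_const, integral_smul_const, smul_add, smul_smul, smul_smul]

/-- The point mass at `y`. -/
def pointMass (y : E3) : TDist ℝ where
  toLin :=
    { toFun := fun φ => (φ : E3 → ℝ) y
      map_add' := fun _ _ => rfl
      map_smul' := fun _ _ => rfl }
  bounded := ⟨0, 1, fun φ M hM => by
    have := hM 0 le_rfl y
    rw [norm_iteratedFDeriv_zero] at this
    simpa using this⟩

/-- The heat flow is symmetric. -/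
theorem toLin_gaussTest [CompleteSpace F] (A : TDist F) (φ : TestFn) {t : ℝ} (ht : 0 < t) :
    A.toLin (gaussTest t φ) = ∫ x in cell, (φ : E3 → ℝ) x • heat t A x := by
  obtain ⟨K, hK⟩ := exists_norm_fourierCoef_le φ
  have hsumw : ∀ k : ℕ, Summable fun n =>
      |gaussWeight t n * ‖fourierCoef φ n‖| * (1 + freq n) ^ k := fun k => by
    refine ((summable_gaussWeight ht k).mul_left K).of_nonneg_of_le (fun n => ?_) fun n => ?_
    · have := freq_nonneg n
      positivity
    · have := freq_nonneg n
      have := (gaussWeight_pos t n).le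
      rw [abs_of_nonneg (by positivity)]
      calc gaussWeight t n * ‖fourierCoef φ n‖ * (1 + freq n) ^ k ≤
          gaussWeight t n * K * (1 + freq n) ^ k := by
            gcongr
            exact hK n
        _ = _ := by ring
  refine HasSum.unique (hasSum_toLin A hsumw (gaussTest t φ) fun y => ?_)
    (hasSum_integral_smul_heat A φ ht)
  -- For a point mass, the expansion just proved for `A` gives the Fourier series of `P_t φ` itself.
  -- Applying `A` to that series term by term reproduces the expansion of the right side.
  have h1 := hasSum_integral_smul_heat (pointMass y) φ ht
  have h2 : ∫ x in cell, (φ : E3 → ℝ) x • heat t (pointMass y) x = (gaussTest t φ : E3 → ℝ) y := by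
    change _ = gauss t (φ : E3 → ℝ) y
    rw [← heatFn_eq_gauss ht φ.2.1.continuous φ.2.2, heatFn]
    congr 1
    funext x
    change (φ : E3 → ℝ) x * heatKernel t (x - y) = heatKernel t (y - x) * (φ : E3 → ℝ) x
    rw [← heatKernel_neg, neg_sub, mul_comm]
  rw [h2] at h1
  exact h1

/-- The heat flow commutes with derivatives, so every derivative of `P_t φ - φ` is `O(√t)`, and `A`
only sees finitely many of them. -/
theorem tendsto_toLin_gaussTest (A : TDist F) (φ : TestFn) :
    Tendsto (fun t => A.toLin (gaussTest t φ)) (𝓝[>] 0) (𝓝 (A.toLin φ)) := by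
  obtain ⟨N, C, hC0, hC, -⟩ := exists_norm_toLin_cosTest_le A
  have hbd : ∀ k : ℕ, ∃ K, 0 ≤ K ∧ ∀ t x, ‖iteratedFDeriv ℝ k ((gaussTest t φ - φ : TestFn) : E3 → ℝ) x‖ ≤
      K * √(2 * t) * gmMean := by
    intro k
    have hk : ContDiff ℝ 1 (iteratedFDeriv ℝ k (φ : E3 → ℝ)) :=
      φ.2.1.iteratedFDeriv_right (m := 1) (by exact_mod_cast le_top)
    have hper := Periodic.iteratedFDeriv φ.2.2 k
    obtain ⟨M, -, hM⟩ := hper.exists_bound hk.continuous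
    obtain ⟨K, hK0, hK⟩ := hper.fderiv.exists_bound (hk.continuous_fderiv one_ne_zero)
    refine ⟨K, hK0, fun t x => ?_⟩
    have h1 : ((gaussTest t φ - φ : TestFn) : E3 → ℝ) = gauss t (φ : E3 → ℝ) - (φ : E3 → ℝ) := rfl
    rw [h1, iteratedFDeriv_sub_apply (f := gauss t (φ : E3 → ℝ)) (g := (φ : E3 → ℝ))
      ((gaussTest t φ).2.1.contDiffAt.of_le (by exact_mod_cast le_top))
      (φ.2.1.contDiffAt.of_le (by exact_mod_cast le_top)),
      iteratedFDeriv_gauss t φ.2.2 φ.2.1]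
    exact norm_gauss_sub_self_le t (hk.differentiable one_ne_zero) hM hK x
  choose K hK0 hK using hbd
  rw [tendsto_iff_norm_sub_tendsto_zero]
  have h1 : ∀ t, ‖A.toLin (gaussTest t φ) - A.toLin φ‖ ≤
      C * ((∑ k ∈ Finset.range (N + 1), K k) * √(2 * t) * gmMean) := by
    intro t
    rw [← map_sub]
    refine hC _ _ fun k hk x => (hK k t x).trans ?_
    have := gmMean_nonneg
    gcongr
    exact Finset.single_le_sum (fun k _ => hK0 k) (Finset.mem_range.2 (by omega))
  have h2 : Tendsto (fun t : ℝ => C * ((∑ k ∈ Finset.range (N + 1), K k) * √(2 * t) * gmMean)) (𝓝 0)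
      (𝓝 (C * ((∑ k ∈ Finset.range (N + 1), K k) * √(2 * 0) * gmMean))) :=
    Continuous.tendsto (by fun_prop) 0
  simp only [mul_zero, Real.sqrt_zero, zero_mul] at h2
  exact squeeze_zero (fun _ => norm_nonneg _) h1 (h2.mono_left nhdsWithin_le_nhds)

end Heat

/-! ### Weakly singular kernels -/

/-- The Beta integral `∫_0^1 (1-u)^{-p} u^{-q} du`. -/
def betaI (p q : ℝ) : ℝ := ∫ u in (0 : ℝ)..1, (1 - u) ^ (-p) * u ^ (-q)

theorem intervalIntegrable_beta {p q : ℝ} (hp : p < 1) (hq : q < 1) :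
    IntervalIntegrable (fun u : ℝ => (1 - u) ^ (-p) * u ^ (-q)) volume 0 1 := by
  have h := (Complex.betaIntegral_convergent (u := ((1 - q : ℝ) : ℂ)) (v := ((1 - p : ℝ) : ℂ))
    (by simpa using hq) (by simpa using hp)).norm
  refine h.congr_uIoo fun u hu => ?_
  rw [uIoo_of_le zero_le_one] at hu
  have h1 : (1 - (u : ℂ)) = ((1 - u : ℝ) : ℂ) := by push_cast; rfl
  simp only [norm_mul]
  rw [h1, Complex.norm_cpow_eq_rpow_re_of_pos hu.1,
    Complex.norm_cpow_eq_rpow_re_of_pos (sub_pos.2 hu.2), mul_comm]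
  simp

theorem betaI_nonneg (p q : ℝ) : 0 ≤ betaI p q :=
  intervalIntegral.integral_nonneg zero_le_one fun u hu =>
    mul_nonneg (Real.rpow_nonneg (sub_nonneg.2 hu.2) _) (Real.rpow_nonneg hu.1 _)

theorem singular_rescale {a t p q r : ℝ} (hr : r ∈ Ioo a t) :
    (t - r) ^ (-p) * (r - a) ^ (-q) = (t - a) ^ (-p - q) *
      ((1 - (r - a) / (t - a)) ^ (-p) * ((r - a) / (t - a)) ^ (-q)) := by
  have hta : 0 < t - a := by linarith [hr.1, hr.2]
  have h1 : 1 - (r - a) / (t - a) = (t - r) / (t - a) := by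
    field_simp
    ring
  rw [h1, Real.div_rpow (by linarith [hr.2]) hta.le, Real.div_rpow (by linarith [hr.1]) hta.le,
    sub_eq_add_neg (-p), Real.rpow_add hta]
  have := (Real.rpow_pos_of_pos hta (-p)).ne'
  have := (Real.rpow_pos_of_pos hta (-q)).ne'
  field_simp

theorem intervalIntegrable_singular {p q : ℝ} (hp : p < 1) (hq : q < 1) {a t : ℝ} (hat : a < t) :
    IntervalIntegrable (fun r : ℝ => (t - r) ^ (-p) * (r - a) ^ (-q)) volume a t := by
  have hta : 0 < t - a := sub_pos.2 hat
  have h1 := (((intervalIntegrable_beta hp hq).comp_mul_left (c := (t - a)⁻¹)).comp_sub_right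
    a).const_mul ((t - a) ^ (-p - q))
  have h2 : (1 : ℝ) / (t - a)⁻¹ + a = t := by field_simp; ring
  rw [zero_div, zero_add, h2] at h1
  refine h1.congr_uIoo fun r hr => ?_
  rw [uIoo_of_le hat.le] at hr
  simp only
  rw [singular_rescale hr, div_eq_inv_mul]

theorem integral_singular {p q : ℝ} {a t : ℝ} (hat : a < t) :
    ∫ r in a..t, (t - r) ^ (-p) * (r - a) ^ (-q) = (t - a) ^ (1 - p - q) * betaI p q := by
  have hta : 0 < t - a := sub_pos.2 hat
  have h1 : ∫ r in a..t, (t - r) ^ (-p) * (r - a) ^ (-q) =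
      ∫ r in a..t, (t - a) ^ (-p - q) *
      ((1 - (r - a) / (t - a)) ^ (-p) * ((r - a) / (t - a)) ^ (-q)) := by
    refine intervalIntegral.integral_congr_uIoo fun r hr => ?_
    rw [uIoo_of_le hat.le] at hr
    exact singular_rescale hr
  rw [h1, intervalIntegral.integral_const_mul,
    intervalIntegral.integral_comp_sub_right
      (fun r => (1 - r / (t - a)) ^ (-p) * (r / (t - a)) ^ (-q)) a,
    intervalIntegral.integral_comp_div (fun r => (1 - r) ^ (-p) * r ^ (-q)) hta.ne', sub_self,
    zero_div, div_self hta.ne', smul_eq_mul, ← betaI, ← mul_assoc]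
  congr 1
  rw [show 1 - p - q = (-p - q) + 1 by ring, Real.rpow_add hta, Real.rpow_one]

/-- Jointly continuous kernels `k t r x`, `a < r < t < T`, of size
`M (t - r)^{-p} (r - a)^{-q}`. -/
structure SingularKernel {F : Type*} [NormedAddCommGroup F] (a T p q M : ℝ)
    (k : ℝ → ℝ → E3 → F) : Prop where
  cont : ContinuousOn (fun z : (ℝ × ℝ) × E3 => k z.1.1 z.1.2 z.2)
    ({z : ℝ × ℝ | a < z.2 ∧ z.2 < z.1 ∧ z.1 < T} ×ˢ univ)
  bound : ∀ t r x, a < r → r < t → t < T → ‖k t r x‖ ≤ M * ((t - r) ^ (-p) * (r - a) ^ (-q))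

namespace SingularKernel

variable {F : Type*} [NormedAddCommGroup F] [NormedSpace ℝ F]
  {a T p q M : ℝ} {k : ℝ → ℝ → E3 → F}

theorem continuousOn_left (hk : SingularKernel a T p q M k) {t : ℝ} (ht : t < T) (x : E3) :
    ContinuousOn (fun r => k t r x) (Ioo a t) :=
  hk.cont.comp (f := fun r => ((t, r), x)) (by fun_prop) fun r hr => ⟨⟨hr.1, hr.2, ht⟩, mem_univ _⟩

theorem intervalIntegrable (hk : SingularKernel a T p q M k) (hp : p < 1) (hq : q < 1) {t : ℝ}
    (hat : a < t) (ht : t < T) (x : E3) : IntervalIntegrable (fun r => k t r x) volume a t := by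
  have h1 := ((intervalIntegrable_singular hp hq hat).const_mul M)
  rw [intervalIntegrable_iff_integrableOn_Ioo_of_le hat.le] at h1 ⊢
  refine Integrable.mono' h1
    ((hk.continuousOn_left ht x).aestronglyMeasurable measurableSet_Ioo) ?_
  exact (ae_restrict_iff' measurableSet_Ioo).2
    (Eventually.of_forall fun r hr => hk.bound t r x hr.1 hr.2 ht)

theorem norm_integral_le (hk : SingularKernel a T p q M k) (hp : p < 1) (hq : q < 1) {t : ℝ}
    (hat : a < t) (ht : t < T) (x : E3) :
    ‖∫ r in a..t, k t r x‖ ≤ M * ((t - a) ^ (1 - p - q) * betaI p q) := by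
  rw [← integral_singular hat, ← intervalIntegral.integral_const_mul]
  rw [intervalIntegral.integral_of_le hat.le, intervalIntegral.integral_of_le hat.le,
    integral_Ioc_eq_integral_Ioo, integral_Ioc_eq_integral_Ioo]
  have h1 := ((intervalIntegrable_singular hp hq hat).const_mul M)
  rw [intervalIntegrable_iff_integrableOn_Ioo_of_le hat.le] at h1
  exact norm_integral_le_of_norm_le h1 ((ae_restrict_iff' measurableSet_Ioo).2
    (Eventually.of_forall fun r hr => hk.bound t r x hr.1 hr.2 ht))

/-- The substitution `r = a + (t - a) u` fixes both the interval and the location of the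
singularities, so that a multiple of the Beta integrand dominates for all nearby `t`. -/
theorem continuousOn_integral (hk : SingularKernel a T p q M k) (hp : p < 1) (hq : q < 1) :
    ContinuousOn (fun z : ℝ × E3 => ∫ r in a..z.1, k z.1 r z.2) (Ioo a T ×ˢ univ) := by
  have hsub : ∀ z ∈ Ioo a T ×ˢ (univ : Set E3), ∫ r in a..z.1, k z.1 r z.2 =
      ∫ u in (0 : ℝ)..1, (z.1 - a) • k z.1 (a + (z.1 - a) * u) z.2 := by
    rintro ⟨t, x⟩ ⟨ht, -⟩
    rw [intervalIntegral.integral_smul, intervalIntegral.smul_integral_comp_add_mul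
      (fun r => k t r x) (t - a) a]
    simp
  refine ContinuousOn.congr ?_ hsub
  rintro ⟨t₀, x₀⟩ ⟨ht₀, -⟩
  simp only at ht₀
  have hpos : 0 < t₀ - a := sub_pos.2 ht₀.1
  have hcont : ContinuousAt (fun z : ℝ × E3 => |M| * (z.1 - a) ^ (1 - p - q)) (t₀, x₀) :=
    continuousAt_const.mul ((by fun_prop : ContinuousAt (fun z : ℝ × E3 => z.1 - a) _).rpow_const
      (Or.inl hpos.ne'))
  have hev := hcont.eventually_lt continuousAt_const
    (show |M| * (t₀ - a) ^ (1 - p - q) < |M| * (t₀ - a) ^ (1 - p - q) + 1 by linarith)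
  refine intervalIntegral.continuousWithinAt_of_dominated_interval
    (bound := fun u => (|M| * (t₀ - a) ^ (1 - p - q) + 1) * ((1 - u) ^ (-p) * u ^ (-q))) ?_ ?_
    ((intervalIntegrable_beta hp hq).const_mul _) ?_
  · refine eventually_mem_nhdsWithin.mono ?_
    rintro ⟨t, x⟩ ⟨ht, -⟩
    simp only at ht ⊢
    have h0 : 0 < t - a := sub_pos.2 ht.1
    have h1 : ContinuousOn (fun u => (t - a) • k t (a + (t - a) * u) x) (Ioo 0 1) :=
      ((hk.continuousOn_left ht.2 x).comp (f := fun u => a + (t - a) * u) (by fun_prop)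
        fun u hu => ⟨by nlinarith [hu.1], by nlinarith [hu.2]⟩).const_smul _
    rw [uIoc_of_le zero_le_one, ← Measure.restrict_congr_set Ioo_ae_eq_Ioc]
    exact h1.aestronglyMeasurable measurableSet_Ioo
  · filter_upwards [eventually_mem_nhdsWithin, nhdsWithin_le_nhds hev]
    rintro ⟨t, x⟩ ⟨ht, -⟩ hev
    simp only at ht hev
    have h1 : ∀ᵐ u : ℝ, u ≠ 1 := by simp [ae_iff]
    refine h1.mono fun u hu1 hu => ?_
    rw [uIoc_of_le zero_le_one] at hu
    have hu' : u < 1 := lt_of_le_of_ne hu.2 hu1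
    have h0 : 0 < t - a := sub_pos.2 ht.1
    have hr : a + (t - a) * u ∈ Ioo a t := ⟨by nlinarith [hu.1], by nlinarith⟩
    have hs : 0 ≤ (1 - u) ^ (-p) * u ^ (-q) :=
      mul_nonneg (Real.rpow_nonneg (sub_nonneg.2 hu.2) _) (Real.rpow_nonneg hu.1.le _)
    rw [norm_smul, Real.norm_of_nonneg h0.le]
    have hb := hk.bound t _ x hr.1 hr.2 ht.2
    rw [singular_rescale hr] at hb
    have hd : (a + (t - a) * u - a) / (t - a) = u := by field_simp; ring
    rw [hd] at hb
    calc (t - a) * ‖k t (a + (t - a) * u) x‖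
        ≤ (t - a) * (|M| * ((t - a) ^ (-p - q) * ((1 - u) ^ (-p) * u ^ (-q)))) := by
          gcongr
          exact hb.trans (mul_le_mul_of_nonneg_right (le_abs_self M)
            (mul_nonneg (Real.rpow_nonneg h0.le _) hs))
      _ = (|M| * (t - a) ^ (1 - p - q)) * ((1 - u) ^ (-p) * u ^ (-q)) := by
          rw [show 1 - p - q = (-p - q) + 1 by ring, Real.rpow_add h0, Real.rpow_one]
          ring
      _ ≤ _ := mul_le_mul_of_nonneg_right hev.le hs
  · have h1 : ∀ᵐ u : ℝ, u ≠ 1 := by simp [ae_iff]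
    refine h1.mono fun u hu1 hu => ?_
    rw [uIoc_of_le zero_le_one] at hu
    have hu' : u < 1 := lt_of_le_of_ne hu.2 hu1
    have h2 : ContinuousOn (fun z : ℝ × E3 => (z.1 - a) • k z.1 (a + (z.1 - a) * u) z.2)
        (Ioo a T ×ˢ univ) :=
      ContinuousOn.smul (by fun_prop) (hk.cont.comp
        (f := fun z : ℝ × E3 => ((z.1, a + (z.1 - a) * u), z.2)) (by fun_prop) (by
          rintro ⟨t, x⟩ ⟨ht, -⟩
          simp only at ht
          have h0 : 0 < t - a := sub_pos.2 ht.1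
          exact ⟨⟨by simp only; nlinarith [hu.1], by simp only; nlinarith, ht.2⟩, mem_univ _⟩))
    exact h2 (t₀, x₀) ⟨ht₀, mem_univ _⟩

theorem hasFDerivAt_integral [CompleteSpace F] (hk : SingularKernel a T p q M k) (hp : p < 1)
    (hq : q < 1) {p' q' M' : ℝ} {k' : ℝ → ℝ → E3 → E3 →L[ℝ] F}
    (hk' : SingularKernel a T p' q' M' k') (hp' : p' < 1) (hq' : q' < 1)
    (hd : ∀ t r x, a < r → r < t → t < T → HasFDerivAt (k t r) (k' t r x) x)
    {t : ℝ} (hat : a < t) (ht : t < T) (x : E3) :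
    HasFDerivAt (fun x => ∫ r in a..t, k t r x) (∫ r in a..t, k' t r x) x := by
  have h1 : ∀ᵐ r : ℝ, r ≠ t := by simp [ae_iff]
  refine (intervalIntegral.hasFDerivAt_integral_of_dominated_of_fderiv_le (𝕜 := ℝ) (s := univ)
    (bound := fun r => M' * ((t - r) ^ (-p') * (r - a) ^ (-q')))
    (F := fun x r => k t r x) (F' := fun x r => k' t r x) univ_mem
    (Eventually.of_forall fun y => (intervalIntegrable_iff.1 (hk.intervalIntegrable hp hq hat ht y)).aestronglyMeasurable)
    (hk.intervalIntegrable hp hq hat ht x)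
    (intervalIntegrable_iff.1 (hk'.intervalIntegrable hp' hq' hat ht x)).aestronglyMeasurable ?_
    ((intervalIntegrable_singular hp' hq' hat).const_mul _) ?_)
  · refine h1.mono fun r hr1 hr y _ => ?_
    rw [uIoc_of_le hat.le] at hr
    exact hk'.bound t r y hr.1 (lt_of_le_of_ne hr.2 hr1) ht
  · refine h1.mono fun r hr1 hr y _ => ?_
    rw [uIoc_of_le hat.le] at hr
    exact hd t r y hr.1 (lt_of_le_of_ne hr.2 hr1) ht

end SingularKernel

/-! ### Duhamel integrals -/

/-- Time-dependent functions on the torus, jointly continuous for times in `S`. -/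
structure TorusCont {F : Type*} [NormedAddCommGroup F] (S : Set ℝ) (u : ℝ → E3 → F) : Prop where
  cont : ContinuousOn (fun z : ℝ × E3 => u z.1 z.2) (S ×ˢ univ)
  per : ∀ t ∈ S, Periodic (u t)

namespace TorusCont

variable {F : Type*} [NormedAddCommGroup F] {S : Set ℝ} {u : ℝ → E3 → F}

theorem mono (hu : TorusCont S u) {S' : Set ℝ} (h : S' ⊆ S) : TorusCont S' u :=
  ⟨hu.cont.mono (prod_mono h subset_rfl), fun t ht => hu.per t (h ht)⟩

theorem continuous (hu : TorusCont S u) {t : ℝ} (ht : t ∈ S) : Continuous (u t) := by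
  rw [← continuousOn_univ]
  exact hu.cont.comp (f := fun x => (t, x)) (by fun_prop) fun x _ => ⟨ht, mem_univ _⟩

theorem continuousOn_time (hu : TorusCont S u) (x : E3) : ContinuousOn (fun t => u t x) S :=
  hu.cont.comp (f := fun t => (t, x)) (by fun_prop) fun t ht => ⟨ht, mem_univ _⟩

theorem exists_bound (hu : TorusCont S u) {t : ℝ} (ht : t ∈ S) : ∃ M, 0 ≤ M ∧ ∀ x, ‖u t x‖ ≤ M :=
  (hu.per t ht).exists_bound (hu.continuous ht)

theorem exists_bound_Icc (hu : TorusCont S u) {a b : ℝ} (hab : Icc a b ⊆ S) :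
    ∃ M, 0 ≤ M ∧ ∀ t ∈ Icc a b, ∀ x, ‖u t x‖ ≤ M := by
  obtain ⟨M, hM⟩ := (isCompact_Icc.prod isCompact_closedCell).exists_bound_of_continuousOn
    (hu.cont.mono (prod_mono hab (subset_univ closedCell)))
  refine ⟨|M|, abs_nonneg _, fun t ht x => ?_⟩
  rw [← (hu.per t (hab ht)).apply_fracE x]
  exact (hM (t, fracE x) ⟨ht, cell_subset_closedCell (fracE_mem_cell x)⟩).trans (le_abs_self _)

theorem congr (hu : TorusCont S u) {w : ℝ → E3 → F} (h : ∀ t ∈ S, ∀ x, w t x = u t x) :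
    TorusCont S w :=
  ⟨hu.cont.congr fun z hz => h z.1 hz.1 z.2, fun t ht x j => by
    rw [h t ht, h t ht, hu.per t ht]⟩

theorem add (hu : TorusCont S u) {w : ℝ → E3 → F} (hw : TorusCont S w) :
    TorusCont S (fun t x => u t x + w t x) :=
  ⟨hu.cont.add hw.cont, fun t ht x j => by simp only [hu.per t ht x j, hw.per t ht x j]⟩

theorem sub (hu : TorusCont S u) {w : ℝ → E3 → F} (hw : TorusCont S w) :
    TorusCont S (fun t x => u t x - w t x) :=
  ⟨hu.cont.sub hw.cont, fun t ht x j => by simp only [hu.per t ht x j, hw.per t ht x j]⟩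

end TorusCont

/-- `∫_a^t P_{t-r} f_r dr`. -/
def duh {F : Type*} [NormedAddCommGroup F] [NormedSpace ℝ F] (a : ℝ) (f : ℝ → E3 → F) (t : ℝ)
    (x : E3) : F := ∫ r in a..t, gauss (t - r) (f r) x

/-- `∫_a^t ∇P_{t-r} f_r dr`. -/
def duhGrad {F : Type*} [NormedAddCommGroup F] [NormedSpace ℝ F] (a : ℝ) (f : ℝ → E3 → F) (t : ℝ)
    (x : E3) : E3 →L[ℝ] F := ∫ r in a..t, gaussGrad (t - r) (f r) x

/-- Sources `f` on `(a, T)` for which `P_h f_r` is of size `M h^{-p} (r - a)^{-q}`. -/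
structure Source {F : Type*} [NormedAddCommGroup F] [NormedSpace ℝ F] (a T p q M : ℝ)
    (f : ℝ → E3 → F) : Prop extends TorusCont (Ioo a T) f where
  bound : ∀ r h x, a < r → 0 < h → r + h < T → ‖gauss h (f r) x‖ ≤ M * (h ^ (-p) * (r - a) ^ (-q))

section Source

variable {F : Type*} [NormedAddCommGroup F] [NormedSpace ℝ F] [CompleteSpace F]
  {a T p q M : ℝ} {f : ℝ → E3 → F}

theorem gaussGrad_half {h : ℝ} (hh : 0 < h) {f : E3 → F} (hf : Continuous f) {M : ℝ}
    (hM : ∀ x, ‖f x‖ ≤ M) (x : E3) :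
    gaussGrad h f x = gaussGrad (h / 2) (gauss (h / 2) f) x := by
  have h2 : 0 < h / 2 := half_pos hh
  have h1 : gauss h f = gauss (h / 2) (gauss (h / 2) f) := by
    funext y
    rw [gauss_gauss h2.le h2.le hf hM, add_halves]
  rw [← fderiv_gauss hh hf hM, h1, fderiv_gauss h2 (continuous_gauss hf hM) (norm_gauss_le hM)]

theorem inv_sqrt_eq_rpow {h : ℝ} (hh : 0 ≤ h) : (√h)⁻¹ = h ^ (-(1 / 2) : ℝ) := by
  rw [Real.sqrt_eq_rpow, Real.rpow_neg hh]

/-- The gradient uses half of the time and the hypothesis on `P_{h/2} f` the other half. The sup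
norm of `f` does not enter the bound. -/
theorem norm_gaussGrad_le_of_gauss {h : ℝ} (hh : 0 < h) {f : E3 → F} (hf : Continuous f) {M N : ℝ}
    (hM : ∀ x, ‖f x‖ ≤ M) (hN : ∀ x, ‖gauss (h / 2) f x‖ ≤ N) (x : E3) :
    ‖gaussGrad h f x‖ ≤ gmMean * N * h ^ (-(1 / 2) : ℝ) := by
  rw [gaussGrad_half hh hf hM x]
  refine (norm_gaussGrad_le hN x).trans (le_of_eq ?_)
  rw [mul_div_cancel₀ _ two_ne_zero, inv_sqrt_eq_rpow hh.le]
  ring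

theorem TorusCont.continuousOn_gauss_kernel (hf : TorusCont (Ioo a T) f) :
    ContinuousOn (fun z : (ℝ × ℝ) × E3 => gauss (z.1.1 - z.1.2) (f z.1.2) z.2)
      ({z : ℝ × ℝ | a < z.2 ∧ z.2 < z.1 ∧ z.1 < T} ×ˢ univ) :=
  continuousOn_gauss (u := fun z : ℝ × ℝ => f z.2) (h := fun z => z.1 - z.2)
    (hf.cont.comp (f := fun z : (ℝ × ℝ) × E3 => (z.1.2, z.2)) (by fun_prop)
      fun z hz => ⟨⟨hz.1.1, hz.1.2.1.trans hz.1.2.2⟩, mem_univ _⟩)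
    (fun z hz => hf.per _ ⟨hz.1, hz.2.1.trans hz.2.2⟩) (by fun_prop)

theorem TorusCont.continuousOn_gaussGrad_kernel (hf : TorusCont (Ioo a T) f) {c : ℝ} (hc : 0 < c) :
    ContinuousOn (fun z : (ℝ × ℝ) × E3 => gaussGrad (c * (z.1.1 - z.1.2)) (f z.1.2) z.2)
      ({z : ℝ × ℝ | a < z.2 ∧ z.2 < z.1 ∧ z.1 < T} ×ˢ univ) :=
  continuousOn_gaussGrad (u := fun z : ℝ × ℝ => f z.2) (h := fun z => c * (z.1 - z.2))
    (hf.cont.comp (f := fun z : (ℝ × ℝ) × E3 => (z.1.2, z.2)) (by fun_prop)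
      fun z hz => ⟨⟨hz.1.1, hz.1.2.1.trans hz.1.2.2⟩, mem_univ _⟩)
    (fun z hz => hf.per _ ⟨hz.1, hz.2.1.trans hz.2.2⟩) (by fun_prop)
    fun z hz => mul_pos hc (sub_pos.2 hz.2.1)

namespace Source

theorem kernel (hf : Source a T p q M f) :
    SingularKernel a T p q M (fun t r => gauss (t - r) (f r)) :=
  ⟨hf.continuousOn_gauss_kernel, fun t r x har hrt htT =>
    hf.bound r (t - r) x har (sub_pos.2 hrt) (by linarith)⟩

/-- The gradient costs another `1/2` in the exponent of `t - r`; the factor `2 ^ p` comes from using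
the source bound at time `(t - r) / 2`. -/
theorem kernelGrad (hf : Source a T p q M f) :
    SingularKernel a T (p + 1 / 2) q (gmMean * 2 ^ p * M)
      (fun t r => gaussGrad (t - r) (f r)) := by
  refine ⟨by simpa using hf.continuousOn_gaussGrad_kernel one_pos, fun t r x har hrt htT => ?_⟩
  have hh : 0 < t - r := sub_pos.2 hrt
  have hr : r ∈ Ioo a T := ⟨har, hrt.trans htT⟩
  obtain ⟨N, -, hN⟩ := hf.exists_bound hr
  refine (norm_gaussGrad_le_of_gauss hh (hf.continuous hr) hN
    (fun y => hf.bound r ((t - r) / 2) y har (half_pos hh) (by linarith)) x).trans (le_of_eq ?_)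
  rw [Real.div_rpow hh.le zero_le_two, Real.rpow_neg zero_le_two, div_inv_eq_mul,
    show -(p + 1 / 2) = -p + -(1 / 2) by ring, Real.rpow_add hh]
  ring

theorem torusCont_duh (hf : Source a T p q M f) (hp : p < 1) (hq : q < 1) :
    TorusCont (Ioo a T) (duh a f) :=
  ⟨hf.kernel.continuousOn_integral hp hq, fun t ht x j =>
    intervalIntegral.integral_congr_uIoo fun r hr => by
      rw [uIoo_of_le ht.1.le] at hr
      exact (hf.per r ⟨hr.1, hr.2.trans ht.2⟩).gauss _ x j⟩

theorem torusCont_duhGrad (hf : Source a T p q M f) (hp : p < 1 / 2) (hq : q < 1) :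
    TorusCont (Ioo a T) (duhGrad a f) :=
  ⟨hf.kernelGrad.continuousOn_integral (by linarith) hq, fun t ht x j =>
    intervalIntegral.integral_congr_uIoo fun r hr => by
      rw [uIoo_of_le ht.1.le] at hr
      exact (hf.per r ⟨hr.1, hr.2.trans ht.2⟩).gaussGrad _ x j⟩

theorem hasFDerivAt_duh (hf : Source a T p q M f) (hp : p < 1 / 2) (hq : q < 1) {t : ℝ}
    (ht : t ∈ Ioo a T) (x : E3) : HasFDerivAt (duh a f t) (duhGrad a f t x) x :=
  hf.kernel.hasFDerivAt_integral (by linarith) hq hf.kernelGrad (by linarith) hq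
    (fun t r x har hrt htT => by
      obtain ⟨N, -, hN⟩ := hf.exists_bound (t := r) ⟨har, hrt.trans htT⟩
      exact hasFDerivAt_gauss (sub_pos.2 hrt) (hf.continuous ⟨har, hrt.trans htT⟩) hN x)
    ht.1 ht.2 x

theorem norm_duh_le (hf : Source a T p q M f) (hp : p < 1) (hq : q < 1) {t : ℝ}
    (ht : t ∈ Ioo a T) (x : E3) : ‖duh a f t x‖ ≤ M * ((t - a) ^ (1 - p - q) * betaI p q) :=
  hf.kernel.norm_integral_le hp hq ht.1 ht.2 x

theorem norm_duhGrad_le (hf : Source a T p q M f) (hp : p < 1 / 2) (hq : q < 1) {t : ℝ}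
    (ht : t ∈ Ioo a T) (x : E3) : ‖duhGrad a f t x‖ ≤
      gmMean * 2 ^ p * M * ((t - a) ^ (1 - (p + 1 / 2) - q) * betaI (p + 1 / 2) q) :=
  hf.kernelGrad.norm_integral_le (by linarith) hq ht.1 ht.2 x

/-- A source bounded by `M (r - a)^{-q}`. -/
theorem of_norm_le (hf : TorusCont (Ioo a T) f)
    (hM : ∀ r ∈ Ioo a T, ∀ x, ‖f r x‖ ≤ M * (r - a) ^ (-q)) : Source a T 0 q M f :=
  { hf with
    bound := fun r h x har hh hT => by
      rw [neg_zero, Real.rpow_zero, one_mul]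
      exact norm_gauss_le (hM r ⟨har, by linarith⟩) x }

end Source

theorem TorusCont.source {S : Set ℝ} (hf : TorusCont S f) {a b : ℝ} (hab : Icc a b ⊆ S) :
    ∃ M, 0 ≤ M ∧ (∀ r ∈ Icc a b, ∀ x, ‖f r x‖ ≤ M) ∧ Source a b 0 0 M f := by
  obtain ⟨M, hM0, hM⟩ := hf.exists_bound_Icc hab
  exact ⟨M, hM0, hM, Source.of_norm_le (hf.mono (Ioo_subset_Icc_self.trans hab)) fun r hr x => by
    simpa using hM r (Ioo_subset_Icc_self hr) x⟩

/-- The heat semigroup commutes with weakly singular time integrals. -/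
theorem SingularKernel.gauss_integral {k : ℝ → ℝ → E3 → F} (hk : SingularKernel a T p q M k)
    (hp : p < 1) (hq : q < 1) {t : ℝ} (hat : a < t) (ht : t < T) (h : ℝ) (x : E3) :
    gauss h (fun y => ∫ r in a..t, k t r y) x = ∫ r in a..t, gauss h (k t r) x := by
  simp only [gauss, intervalIntegral.integral_of_le hat.le, integral_Ioc_eq_integral_Ioo]
  refine integral_integral_swap ?_
  have h1 := ((intervalIntegrable_singular hp hq hat).const_mul M)
  rw [intervalIntegrable_iff_integrableOn_Ioo_of_le hat.le] at h1
  have h2 := (integrable_const (μ := gm) (1 : ℝ)).mul_prod h1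
  have hco : ContinuousOn (fun z : E3 × ℝ => k t z.2 (x + √(2 * h) • z.1)) (univ ×ˢ Ioo a t) :=
    hk.cont.comp (f := fun z : E3 × ℝ => ((t, z.2), x + √(2 * h) • z.1)) (by fun_prop)
      fun z hz => ⟨⟨hz.2.1, hz.2.2, ht⟩, mem_univ _⟩
  have hmu : gm.prod (volume.restrict (Ioo a t)) =
      (gm.prod volume).restrict (univ ×ˢ Ioo a t) := by
    rw [← Measure.prod_restrict, Measure.restrict_univ]
  refine Integrable.mono' h2 ?_ ?_
  · rw [hmu]
    exact hco.aestronglyMeasurable (MeasurableSet.univ.prod measurableSet_Ioo)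
  · rw [hmu]
    refine (ae_restrict_iff' (MeasurableSet.univ.prod measurableSet_Ioo)).2
      (Eventually.of_forall fun z hz => ?_)
    rw [one_mul]
    exact hk.bound t z.2 _ hz.2.1 hz.2.2 ht

/-- The time integral is cut at `b`, and on the first piece the semigroup law extracts `P_{t-b}`.
This is how solutions built from time `0` become mild from positive times. -/
theorem Source.duh_restart (hf : Source a T p q M f) (hp : p < 1) (hq : q < 1) {b t : ℝ}
    (hab : a < b) (hbt : b < t) (ht : t < T) (x : E3) :
    duh a f t x = gauss (t - b) (duh a f b) x + duh b f t x := by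
  have h1 : gauss (t - b) (duh a f b) x = ∫ r in a..b, gauss (t - r) (f r) x := by
    refine (hf.kernel.gauss_integral hp hq hab (hbt.trans ht) (t - b) x).trans ?_
    refine intervalIntegral.integral_congr_uIoo fun r hr => ?_
    rw [uIoo_of_le hab.le] at hr
    have hr' : r ∈ Ioo a T := ⟨hr.1, hr.2.trans (hbt.trans ht)⟩
    obtain ⟨N, -, hN⟩ := hf.exists_bound hr'
    rw [gauss_gauss (sub_nonneg.2 hbt.le) (sub_nonneg.2 hr.2.le) (hf.continuous hr') hN]
    congr 1
    ring
  have hi := hf.kernel.intervalIntegrable hp hq (hab.trans hbt) ht x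
  rw [h1, duh, duh, intervalIntegral.integral_add_adjacent_intervals
    (hi.mono_set (by rw [uIcc_of_le hab.le, uIcc_of_le (hab.trans hbt).le]; gcongr))
    (hi.mono_set (by rw [uIcc_of_le hbt.le, uIcc_of_le (hab.trans hbt).le]; gcongr))]

end Source

/-! ### Mild solutions and their regularity -/

/-- `v` is a mild solution of `∂_t v = Δ v + f` on `(0, T)`. -/
def Mild {F : Type*} [NormedAddCommGroup F] [NormedSpace ℝ F] (T : ℝ) (v f : ℝ → E3 → F) : Prop :=
  ∀ a t, 0 < a → a < t → t < T → ∀ x, v t x = gauss (t - a) (v a) x + duh a f t x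

/-- Hölder continuity in space with exponent `1/2`, locally uniformly in time. -/
def LocHolder {F : Type*} [NormedAddCommGroup F] (T : ℝ) (u : ℝ → E3 → F) : Prop :=
  ∀ a b, 0 < a → b < T → ∃ N, ∀ t ∈ Icc a b, ∀ x y, ‖u t x - u t y‖ ≤ N * √‖x - y‖

section Mild

variable {F : Type u} [NormedAddCommGroup F] [NormedSpace ℝ F] [CompleteSpace F]
  {T : ℝ} {v f : ℝ → E3 → F}

theorem Icc_subset_Ioo_zero {a b : ℝ} (ha : 0 < a) (hb : b < T) : Icc a b ⊆ Ioo 0 T :=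
  fun _ hr => ⟨ha.trans_le hr.1, hr.2.trans_lt hb⟩

theorem Mild.hasFDerivAt (h : Mild T v f) (hv : TorusCont (Ioo 0 T) v) (hf : TorusCont (Ioo 0 T) f)
    {a t : ℝ} (ha : 0 < a) (hat : a < t) (ht : t < T) (x : E3) :
    HasFDerivAt (v t) (gaussGrad (t - a) (v a) x + duhGrad a f t x) x := by
  obtain ⟨b, htb, hbT⟩ := exists_between ht
  obtain ⟨M, -, -, hs⟩ := hf.source (Icc_subset_Ioo_zero ha hbT)
  have haT : a ∈ Ioo 0 T := ⟨ha, hat.trans ht⟩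
  obtain ⟨N, -, hN⟩ := hv.exists_bound haT
  rw [funext fun x => h a t ha hat ht x]
  exact (hasFDerivAt_gauss (sub_pos.2 hat) (hv.continuous haT) hN x).add
    (hs.hasFDerivAt_duh (by norm_num) (by norm_num) ⟨hat, htb⟩ x)

theorem Mild.fderiv_eq (h : Mild T v f) (hv : TorusCont (Ioo 0 T) v) (hf : TorusCont (Ioo 0 T) f)
    {a t : ℝ} (ha : 0 < a) (hat : a < t) (ht : t < T) (x : E3) :
    fderiv ℝ (v t) x = gaussGrad (t - a) (v a) x + duhGrad a f t x :=
  (h.hasFDerivAt hv hf ha hat ht x).fderiv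

theorem Mild.differentiable (h : Mild T v f) (hv : TorusCont (Ioo 0 T) v)
    (hf : TorusCont (Ioo 0 T) f) {t : ℝ} (ht : t ∈ Ioo 0 T) : Differentiable ℝ (v t) := fun x =>
  (h.hasFDerivAt hv hf (half_pos ht.1) (half_lt_self ht.1) ht.2 x).differentiableAt

theorem torusCont_of_local {G : Type*} [NormedAddCommGroup G] {w : ℝ → E3 → G}
    (h : ∀ a b, 0 < a → a < b → b < T → TorusCont (Ioo a b) w) : TorusCont (Ioo 0 T) w := by
  refine ⟨?_, fun t ht => ?_⟩
  · rintro ⟨t, x⟩ ⟨ht, -⟩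
    simp only at ht
    obtain ⟨b, htb, hbT⟩ := exists_between ht.2
    have h1 := (h (t / 2) b (half_pos ht.1) (by linarith [ht.1]) hbT).cont (t, x)
      ⟨⟨half_lt_self ht.1, htb⟩, mem_univ _⟩
    refine (h1.continuousAt ?_).continuousWithinAt
    exact (isOpen_Ioo.prod isOpen_univ).mem_nhds ⟨⟨half_lt_self ht.1, htb⟩, mem_univ _⟩
  · obtain ⟨b, htb, hbT⟩ := exists_between ht.2
    exact (h (t / 2) b (half_pos ht.1) (by linarith [ht.1]) hbT).per t ⟨half_lt_self ht.1, htb⟩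

theorem torusCont_gauss_shift {a b : ℝ} {g : E3 → F} (hg : Continuous g) (hper : Periodic g) :
    TorusCont (Ioo a b) (fun t => gauss (t - a) g) :=
  ⟨continuousOn_gauss (u := fun _ : ℝ => g) (h := fun t => t - a)
    (hg.comp continuous_snd).continuousOn (fun _ _ => hper) (by fun_prop),
    fun t _ => hper.gauss _⟩

theorem torusCont_gaussGrad_shift {a b c : ℝ} (hc : 0 < c) {g : E3 → F} (hg : Continuous g)
    (hper : Periodic g) : TorusCont (Ioo a b) (fun t => gaussGrad (c * (t - a)) g) :=
  ⟨continuousOn_gaussGrad (u := fun _ : ℝ => g) (h := fun t => c * (t - a))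
    (hg.comp continuous_snd).continuousOn (fun _ _ => hper) (by fun_prop)
      fun t ht => mul_pos hc (sub_pos.2 ht.1),
    fun t _ => hper.gaussGrad _⟩

theorem Mild.torusCont_fderiv (h : Mild T v f) (hv : TorusCont (Ioo 0 T) v)
    (hf : TorusCont (Ioo 0 T) f) : TorusCont (Ioo 0 T) (fun t => fderiv ℝ (v t)) := by
  refine torusCont_of_local fun a b ha hab hb => ?_
  have haT : a ∈ Ioo 0 T := ⟨ha, hab.trans hb⟩
  obtain ⟨M, -, -, hs⟩ := hf.source (Icc_subset_Ioo_zero ha hb)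
  have h1 := (torusCont_gaussGrad_shift (a := a) (b := b) one_pos (hv.continuous haT)
    (hv.per a haT)).add (hs.torusCont_duhGrad (by norm_num) (by norm_num))
  refine h1.congr fun t ht x => ?_
  rw [h.fderiv_eq hv hf ha ht.1 (ht.2.trans hb), one_mul]

/-- By `norm_gaussGrad_sub_le` the half-Hölder seminorm of `∇P_{t-r} f_r` is of order `(t -
r)^{-3/4}`, which is integrable. Starting the mild formula at some `a < a₀` keeps the free term away
from its singularity. -/
theorem Mild.locHolder_fderiv (h : Mild T v f) (hv : TorusCont (Ioo 0 T) v)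
    (hf : TorusCont (Ioo 0 T) f) : LocHolder T (fun t => fderiv ℝ (v t)) := by
  intro a₀ b₀ ha₀ hb₀
  obtain ⟨b, hb₀b, hb⟩ := exists_between hb₀
  rcases lt_or_ge b a₀ with hba | hab
  · exact ⟨0, fun t ht => absurd (ht.1.trans ht.2) (by linarith)⟩
  obtain ⟨a, ha, haa₀⟩ := exists_between ha₀
  have hlt : a < b := haa₀.trans_le hab
  have haT : a ∈ Ioo 0 T := ⟨ha, hlt.trans hb⟩
  obtain ⟨M, hM0, hM, hs⟩ := hf.source (Icc_subset_Ioo_zero ha hb)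
  obtain ⟨N, hN0, hN⟩ := hv.exists_bound haT
  have hc : 0 ≤ 2 * (gmMean + gmMean ^ 2) := by
    have := gmMean_nonneg
    positivity
  refine ⟨2 * (gmMean + gmMean ^ 2) * N * (a₀ - a) ^ (-(3 / 4) : ℝ) +
    2 * (gmMean + gmMean ^ 2) * M * ((b - a) ^ (1 - 3 / 4 - 0 : ℝ) * betaI (3 / 4) 0),
    fun t ht x y => ?_⟩
  have hat : a < t := haa₀.trans_le ht.1
  have htb : t < b := ht.2.trans_lt hb₀b
  simp only
  rw [h.fderiv_eq hv hf ha hat (htb.trans hb), h.fderiv_eq hv hf ha hat (htb.trans hb),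
    add_sub_add_comm, add_mul]
  refine (norm_add_le _ _).trans (add_le_add ?_ ?_)
  · refine (norm_gaussGrad_sub_le (sub_pos.2 hat) (hv.continuous haT) hN x y).trans ?_
    gcongr 2 * (gmMean + gmMean ^ 2) * N * ?_ * _
    exact Real.rpow_le_rpow_of_nonpos (sub_pos.2 haa₀) (sub_le_sub_right ht.1 a) (by norm_num)
  · have hi := hs.kernelGrad.intervalIntegrable (by norm_num) (by norm_num) hat htb
    rw [duhGrad, duhGrad, ← intervalIntegral.integral_sub (hi x) (hi y)]
    have hb1 := ((intervalIntegrable_singular (p := 3 / 4) (q := 0) (by norm_num) (by norm_num)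
      hat).const_mul (2 * (gmMean + gmMean ^ 2) * M * √‖x - y‖))
    refine (intervalIntegral.norm_integral_le_of_norm_le hat.le ?_ hb1).trans ?_
    · have h1 : ∀ᵐ r : ℝ, r ≠ t := by simp [ae_iff]
      refine h1.mono fun r hr1 hr => ?_
      have hrt := lt_of_le_of_ne hr.2 hr1
      have hrT : r ∈ Ioo 0 T := ⟨ha.trans hr.1, (hrt.trans htb).trans hb⟩
      refine (norm_gaussGrad_sub_le (sub_pos.2 hrt) (hf.continuous hrT)
        (hM r ⟨hr.1.le, (hrt.trans htb).le⟩) x y).trans (le_of_eq ?_)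
      rw [neg_zero, Real.rpow_zero]
      ring
    · rw [intervalIntegral.integral_const_mul, integral_singular hat]
      have := betaI_nonneg (3 / 4) 0
      calc _ = 2 * (gmMean + gmMean ^ 2) * M * ((t - a) ^ (1 - 3 / 4 - 0 : ℝ) * betaI (3 / 4) 0) *
            √‖x - y‖ := by ring
        _ ≤ _ := by
          gcongr

/-- Differentiation commutes with the heat flow, so the derivative solves the differentiated
problem. This drives the inductions on the number of derivatives. -/
theorem Mild.fderiv (h : Mild T v f) (hv : TorusCont (Ioo 0 T) v) (hf : TorusCont (Ioo 0 T) f)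
    (hfd : ∀ t ∈ Ioo 0 T, Differentiable ℝ (f t))
    (hf' : TorusCont (Ioo 0 T) (fun t => fderiv ℝ (f t))) :
    Mild T (fun t => fderiv ℝ (v t)) (fun t => fderiv ℝ (f t)) := by
  intro a t ha hat ht x
  have hv' := h.torusCont_fderiv hv hf
  have haT : a ∈ Ioo 0 T := ⟨ha, hat.trans ht⟩
  obtain ⟨N, -, hN⟩ := hv.exists_bound haT
  obtain ⟨N', -, hN'⟩ := hv'.exists_bound haT
  simp only
  rw [h.fderiv_eq hv hf ha hat ht, gaussGrad_eq_gauss_fderiv (sub_pos.2 hat)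
    (h.differentiable hv hf haT) (hv'.continuous haT) hN hN']
  congr 1
  refine intervalIntegral.integral_congr_uIoo fun r hr => ?_
  rw [uIoo_of_le hat.le] at hr
  have hrT : r ∈ Ioo 0 T := ⟨ha.trans hr.1, hr.2.trans ht⟩
  obtain ⟨M, -, hM⟩ := hf.exists_bound hrT
  obtain ⟨M', -, hM'⟩ := hf'.exists_bound hrT
  exact gaussGrad_eq_gauss_fderiv (sub_pos.2 hr.2) (hfd r hrT) (hf'.continuous hrT) hM hM' x

/-- For Hölder continuous sources, mild solutions are twice differentiable. -/
theorem Mild.fderiv_fderiv (h : Mild T v f) (hv : TorusCont (Ioo 0 T) v)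
    (hf : TorusCont (Ioo 0 T) f) (hH : LocHolder T f) :
    (∀ t ∈ Ioo 0 T, Differentiable ℝ (_root_.fderiv ℝ (v t))) ∧
      TorusCont (Ioo 0 T) (fun t => _root_.fderiv ℝ (_root_.fderiv ℝ (v t))) := by
  have key : ∀ a b, 0 < a → a < b → b < T → ∃ w : ℝ → E3 → E3 →L[ℝ] E3 →L[ℝ] F,
      TorusCont (Ioo a b) w ∧
      ∀ t ∈ Ioo a b, ∀ x, HasFDerivAt (_root_.fderiv ℝ (v t)) (w t x) x := by
    intro a b ha hab hb
    have haT : a ∈ Ioo 0 T := ⟨ha, hab.trans hb⟩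
    obtain ⟨M, hM0, hM, hs⟩ := hf.source (Icc_subset_Ioo_zero ha hb)
    obtain ⟨H, hH⟩ := hH a b ha hb
    obtain ⟨N, hN0, hN⟩ := hv.exists_bound haT
    have hmem : ∀ {r : ℝ}, r ∈ Ioo a b → r ∈ Ioo 0 T := fun hr =>
      Icc_subset_Ioo_zero ha hb (Ioo_subset_Icc_self hr)
    -- Twice differentiating the kernel costs `(t - r)^{-1}` in general. Hölder continuity gains a
    -- quarter, and `3/4 < 1` is integrable.
    have hk : SingularKernel a b (3 / 4) 0
        (gmMean * (H * ∫ (z : E3), ‖z‖ * √‖z‖ ∂gm))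
        (fun t r => gaussGrad ((t - r) / 2) (gaussGrad ((t - r) / 2) (f r))) := by
      refine ⟨?_, fun t r x har hrt htb => ?_⟩
      · refine (continuousOn_gaussGrad
          (u := fun z : ℝ × ℝ => gaussGrad (2⁻¹ * (z.1 - z.2)) (f z.2))
          (h := fun z => 2⁻¹ * (z.1 - z.2)) ?_ ?_ (by fun_prop) ?_).congr ?_
        · exact hs.continuousOn_gaussGrad_kernel (by norm_num)
        · exact fun z hz => (hs.per _ ⟨hz.1, hz.2.1.trans hz.2.2⟩).gaussGrad _
        · exact fun z hz => by have := hz.2.1; linarith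
        · intro z _
          simp only [div_eq_inv_mul]
      · have hr : r ∈ Ioo a b := ⟨har, hrt.trans htb⟩
        have hh : 0 < (t - r) / 2 := half_pos (sub_pos.2 hrt)
        have h1 := norm_gaussGrad_le (h := (t - r) / 2) (norm_gaussGrad_le_of_holder hh
          (hs.continuous hr) (hM r (Ioo_subset_Icc_self hr)) (hH r (Ioo_subset_Icc_self hr))) x
        refine h1.trans (le_of_eq ?_)
        rw [mul_div_cancel₀ _ two_ne_zero, inv_sqrt_eq_rpow (sub_pos.2 hrt).le, neg_zero,
          Real.rpow_zero, show (-(3 / 4) : ℝ) = -(1 / 2) + -(1 / 4) by norm_num,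
          Real.rpow_add (sub_pos.2 hrt)]
        ring
    refine ⟨fun t x => gaussGrad (2⁻¹ * (t - a)) (gaussGrad (2⁻¹ * (t - a)) (v a)) x +
      ∫ r in a..t, gaussGrad ((t - r) / 2) (gaussGrad ((t - r) / 2) (f r)) x, ?_, ?_⟩
    · have h2 : TorusCont (Ioo a b) (fun t => gaussGrad (2⁻¹ * (t - a)) (v a)) :=
        torusCont_gaussGrad_shift (by norm_num) (hv.continuous haT) (hv.per a haT)
      refine TorusCont.add ⟨?_, fun t ht => ((h2.per t ht).gaussGrad _)⟩
        ⟨hk.continuousOn_integral (by norm_num) (by norm_num), fun t ht x j => ?_⟩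
      · exact continuousOn_gaussGrad (h := fun t => 2⁻¹ * (t - a)) h2.cont h2.per (by fun_prop)
          fun t ht => by have := ht.1; linarith
      · refine intervalIntegral.integral_congr_uIoo fun r hr => ?_
        rw [uIoo_of_le ht.1.le] at hr
        exact ((hs.per r ⟨hr.1, hr.2.trans ht.2⟩).gaussGrad _).gaussGrad _ x j
    · intro t ht x
      rw [funext fun x => h.fderiv_eq hv hf ha ht.1 (ht.2.trans hb) x]
      have h3 := hasFDerivAt_gaussGrad (sub_pos.2 ht.1) (hv.continuous haT) hN x
      rw [div_eq_inv_mul] at h3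
      refine h3.add (hs.kernelGrad.hasFDerivAt_integral (by norm_num) (by norm_num) hk
        (by norm_num) (by norm_num) (fun t r y har hrt htb => ?_) ht.1 ht.2 x)
      have hr : r ∈ Ioo a b := ⟨har, hrt.trans htb⟩
      exact hasFDerivAt_gaussGrad (sub_pos.2 hrt) (hs.continuous hr)
        (hM r (Ioo_subset_Icc_self hr)) y
  refine ⟨fun t ht x => ?_, torusCont_of_local fun a b ha hab hb => ?_⟩
  · obtain ⟨b, htb, hb⟩ := exists_between ht.2
    obtain ⟨w, -, hw⟩ := key (t / 2) b (half_pos ht.1) (by linarith [ht.1]) hb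
    exact (hw t ⟨half_lt_self ht.1, htb⟩ x).differentiableAt
  · obtain ⟨w, hwc, hw⟩ := key a b ha hab hb
    exact hwc.congr fun t ht x => (hw t ht x).fderiv

end Mild

/-! ### Towers of derivatives -/

/-- `u` has `k` spatial derivatives, jointly continuous on `(0, T) × 𝕋³`; if `b` is true then the
top derivative is locally Hölder continuous in space. -/
def Reg (b : Bool) (T : ℝ) : ℕ → ∀ {F : Type u} [NormedAddCommGroup F] [NormedSpace ℝ F],
    (ℝ → E3 → F) → Prop
  | 0, _, _, _, u => TorusCont (Ioo 0 T) u ∧ (b = true → LocHolder T u)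
  | k + 1, _, _, _, u => TorusCont (Ioo 0 T) u ∧ (∀ t ∈ Ioo 0 T, Differentiable ℝ (u t)) ∧
      Reg b T k (fun t => fderiv ℝ (u t))

section Reg

variable {b : Bool} {T : ℝ}

theorem Reg.torusCont {k : ℕ} {F : Type u} [NormedAddCommGroup F] [NormedSpace ℝ F]
    {u : ℝ → E3 → F} (h : Reg b T k u) : TorusCont (Ioo 0 T) u := by
  cases k with
  | zero => exact h.1
  | succ k => exact h.1

theorem LocHolder.congr {F : Type u} [NormedAddCommGroup F] {u w : ℝ → E3 → F}
    (h : LocHolder T u) (hw : ∀ t ∈ Ioo 0 T, w t = u t) : LocHolder T w := fun a c ha hc => by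
  obtain ⟨N, hN⟩ := h a c ha hc
  exact ⟨N, fun t ht => by rw [hw t (Icc_subset_Ioo_zero ha hc ht)]; exact hN t ht⟩

theorem LocHolder.add {F : Type u} [NormedAddCommGroup F] {u w : ℝ → E3 → F}
    (h : LocHolder T u) (hw : LocHolder T w) : LocHolder T (fun t x => u t x + w t x) :=
  fun a c ha hc => by
    obtain ⟨N, hN⟩ := h a c ha hc
    obtain ⟨N', hN'⟩ := hw a c ha hc
    refine ⟨N + N', fun t ht x y => ?_⟩
    rw [add_sub_add_comm, add_mul]
    exact (norm_add_le _ _).trans (add_le_add (hN t ht x y) (hN' t ht x y))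

theorem Reg.congr : ∀ {k : ℕ} {F : Type u} [NormedAddCommGroup F] [NormedSpace ℝ F]
    {u w : ℝ → E3 → F}, Reg b T k u → (∀ t ∈ Ioo 0 T, w t = u t) → Reg b T k w
  | 0, _, _, _, _, _, h, hw => ⟨h.1.congr fun t ht x => by rw [hw t ht], fun hb =>
      (h.2 hb).congr hw⟩
  | _ + 1, _, _, _, _, _, h, hw => ⟨h.1.congr fun t ht x => by rw [hw t ht],
      fun t ht => by rw [hw t ht]; exact h.2.1 t ht,
      h.2.2.congr fun t ht => by rw [hw t ht]⟩

theorem Reg.add : ∀ {k : ℕ} {F : Type u} [NormedAddCommGroup F] [NormedSpace ℝ F]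
    {u w : ℝ → E3 → F}, Reg b T k u → Reg b T k w → Reg b T k (fun t x => u t x + w t x)
  | 0, _, _, _, _, _, h, hw => ⟨h.1.add hw.1, fun hb => (h.2 hb).add (hw.2 hb)⟩
  | _ + 1, _, _, _, _, _, h, hw => ⟨h.1.add hw.1,
      fun t ht => (h.2.1 t ht).add (hw.2.1 t ht),
      (h.2.2.add hw.2.2).congr fun t ht => funext fun x =>
        fderiv_fun_add (h.2.1 t ht x) (hw.2.1 t ht x)⟩

/-- Interpolation between the sup bound `2 M` and the Lipschitz bound `K ‖x - y‖`, by their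
geometric mean. -/
theorem locHolder_of_fderiv {F : Type u} [NormedAddCommGroup F] [NormedSpace ℝ F] {u : ℝ → E3 → F}
    (hu : TorusCont (Ioo 0 T) u) (hd : ∀ t ∈ Ioo 0 T, Differentiable ℝ (u t))
    (hu' : TorusCont (Ioo 0 T) (fun t => fderiv ℝ (u t))) : LocHolder T u := by
  intro a c ha hc
  obtain ⟨M, hM0, hM⟩ := hu.exists_bound_Icc (Icc_subset_Ioo_zero ha hc)
  obtain ⟨K, hK0, hK⟩ := hu'.exists_bound_Icc (Icc_subset_Ioo_zero ha hc)
  refine ⟨√(2 * M * K), fun t ht x y => ?_⟩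
  rw [← Real.sqrt_mul (by positivity)]
  refine Real.le_sqrt_of_sq_le ?_
  have h1 : ‖u t x - u t y‖ ≤ 2 * M := (norm_sub_le _ _).trans (by linarith [hM t ht x, hM t ht y])
  have h2 : ‖u t x - u t y‖ ≤ K * ‖x - y‖ :=
    convex_univ.norm_image_sub_le_of_norm_fderiv_le
      (fun z _ => hd t (Icc_subset_Ioo_zero ha hc ht) z) (fun z _ => hK t ht z)
      (mem_univ y) (mem_univ x)
  calc ‖u t x - u t y‖ ^ 2 = ‖u t x - u t y‖ * ‖u t x - u t y‖ := sq _
    _ ≤ 2 * M * (K * ‖x - y‖) := mul_le_mul h1 h2 (norm_nonneg _) (by positivity)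
    _ = _ := by ring

theorem Reg.of_succ : ∀ {k : ℕ} {F : Type u} [NormedAddCommGroup F] [NormedSpace ℝ F]
    {u : ℝ → E3 → F}, Reg b T (k + 1) u → Reg b T k u
  | 0, _, _, _, _, h => ⟨h.1, fun _ => locHolder_of_fderiv h.1 h.2.1 h.2.2.torusCont⟩
  | _ + 1, _, _, _, _, h => ⟨h.1, h.2.1, h.2.2.of_succ⟩

theorem TorusCont.bilin {F G H : Type*} [NormedAddCommGroup F] [NormedSpace ℝ F]
    [NormedAddCommGroup G] [NormedSpace ℝ G] [NormedAddCommGroup H] [NormedSpace ℝ H] {S : Set ℝ}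
    (B : F →L[ℝ] G →L[ℝ] H) {u : ℝ → E3 → F} {w : ℝ → E3 → G} (hu : TorusCont S u)
    (hw : TorusCont S w) : TorusCont S (fun t x => B (u t x) (w t x)) :=
  ⟨(B.continuous.comp_continuousOn hu.cont).clm_apply hw.cont, fun t ht x j => by
    simp only [hu.per t ht x j, hw.per t ht x j]⟩

theorem LocHolder.bilin {F G H : Type u} [NormedAddCommGroup F] [NormedSpace ℝ F]
    [NormedAddCommGroup G] [NormedSpace ℝ G] [NormedAddCommGroup H] [NormedSpace ℝ H]
    (B : F →L[ℝ] G →L[ℝ] H) {u : ℝ → E3 → F} {w : ℝ → E3 → G} (hu : TorusCont (Ioo 0 T) u)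
    (hw : TorusCont (Ioo 0 T) w) (hu' : LocHolder T u) (hw' : LocHolder T w) :
    LocHolder T (fun t x => B (u t x) (w t x)) := by
  intro a c ha hc
  obtain ⟨N, hN⟩ := hu' a c ha hc
  obtain ⟨N', hN'⟩ := hw' a c ha hc
  obtain ⟨M, hM0, hM⟩ := hu.exists_bound_Icc (Icc_subset_Ioo_zero ha hc)
  obtain ⟨M', hM0', hM'⟩ := hw.exists_bound_Icc (Icc_subset_Ioo_zero ha hc)
  refine ⟨‖B‖ * N * M' + ‖B‖ * M * N', fun t ht x y => ?_⟩
  have h1 : B (u t x) (w t x) - B (u t y) (w t y) =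
      B (u t x - u t y) (w t x) + B (u t y) (w t x - w t y) := by
    simp only [map_sub, sub_apply]
    abel
  rw [h1]
  have hx := hN t ht x y
  have hx' := hN' t ht x y
  calc _ ≤ ‖B‖ * (N * √‖x - y‖) * M' + ‖B‖ * M * (N' * √‖x - y‖) := by
        refine (norm_add_le _ _).trans (add_le_add ((B.le_opNorm₂ _ _).trans ?_)
          ((B.le_opNorm₂ _ _).trans ?_))
        · have := (norm_nonneg _).trans hx
          gcongr
          exact hM' t ht x
        · gcongr
          exact hM t ht y
    _ = _ := by ring

theorem Reg.bilin : ∀ {k : ℕ} {F G H : Type u} [NormedAddCommGroup F] [NormedSpace ℝ F]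
    [NormedAddCommGroup G] [NormedSpace ℝ G] [NormedAddCommGroup H] [NormedSpace ℝ H]
    (B : F →L[ℝ] G →L[ℝ] H) {u : ℝ → E3 → F} {w : ℝ → E3 → G}, Reg b T k u → Reg b T k w →
    Reg b T k (fun t x => B (u t x) (w t x))
  | 0, _, _, _, _, _, _, _, _, _, B, _, _, h, hw => ⟨h.1.bilin B hw.1, fun hb =>
      LocHolder.bilin B h.1 hw.1 (h.2 hb) (hw.2 hb)⟩
  | k + 1, _, _, _, _, _, _, _, _, _, B, _, _, h, hw => ⟨h.1.bilin B hw.1, fun t ht x =>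
      (B.hasFDerivAt_of_bilinear (h.2.1 t ht x).hasFDerivAt
        (hw.2.1 t ht x).hasFDerivAt).differentiableAt,
      ((Reg.bilin (B.precompR E3) h.of_succ hw.2.2).add
        (Reg.bilin (B.precompL E3) h.2.2 hw.of_succ)).congr fun t ht => funext fun x =>
          B.fderiv_of_bilinear (h.2.1 t ht x) (hw.2.1 t ht x)⟩

/-- A continuous source suffices to gain one derivative, together with half-Hölder continuity of
that derivative. -/
theorem Mild.reg : ∀ {k : ℕ} {F : Type u} [NormedAddCommGroup F] [NormedSpace ℝ F]
    [CompleteSpace F] {v f : ℝ → E3 → F}, Mild T v f → TorusCont (Ioo 0 T) v → Reg false T k f →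
    Reg true T (k + 1) v
  | 0, _, _, _, _, _, _, h, hv, hf => ⟨hv, fun t ht => h.differentiable hv hf.1 ht,
      h.torusCont_fderiv hv hf.1, fun _ => h.locHolder_fderiv hv hf.1⟩
  | _ + 1, _, _, _, _, _, _, h, hv, hf => ⟨hv, fun t ht => h.differentiable hv hf.1 ht,
      (h.fderiv hv hf.1 hf.2.1 hf.2.2.torusCont).reg (h.torusCont_fderiv hv hf.1) hf.2.2⟩

/-- With a Hölder source the gain is a full two derivatives; the Hölder information is spent. -/
theorem Mild.reg_of_holder : ∀ {k : ℕ} {F : Type u} [NormedAddCommGroup F] [NormedSpace ℝ F]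
    [CompleteSpace F] {v f : ℝ → E3 → F}, Mild T v f → TorusCont (Ioo 0 T) v → Reg true T k f →
    Reg false T (k + 2) v
  | 0, _, _, _, _, _, _, h, hv, hf =>
    have h2 := h.fderiv_fderiv hv hf.1 (hf.2 rfl)
    ⟨hv, fun t ht => h.differentiable hv hf.1 ht, h.torusCont_fderiv hv hf.1, h2.1, h2.2, by simp⟩
  | _ + 1, _, _, _, _, _, _, h, hv, hf => ⟨hv, fun t ht => h.differentiable hv hf.1 ht,
      (h.fderiv hv hf.1 hf.2.1 hf.2.2.torusCont).reg_of_holder (h.torusCont_fderiv hv hf.1) hf.2.2⟩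

/-- The nonlinearity `B(U, ∂U) + C(U, U, U)`. -/
def nonlin {F : Type u} [NormedAddCommGroup F] [NormedSpace ℝ F]
    (B : F →L[ℝ] (E3 →L[ℝ] F) →L[ℝ] F) (C : F →L[ℝ] F →L[ℝ] F →L[ℝ] F) (U : ℝ → E3 → F)
    (t : ℝ) (x : E3) : F := B (U t x) (fderiv ℝ (U t) x) + C (U t x) (U t x) (U t x)

variable {F : Type u} [NormedAddCommGroup F] [NormedSpace ℝ F]
  {B : F →L[ℝ] (E3 →L[ℝ] F) →L[ℝ] F} {C : F →L[ℝ] F →L[ℝ] F →L[ℝ] F} {U : ℝ → E3 → F}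

theorem Reg.nonlin {k : ℕ} (h : Reg b T (k + 1) U) : Reg b T k (nonlin B C U) :=
  (Reg.bilin B h.of_succ h.2.2).add (Reg.bilin (ContinuousLinearMap.id ℝ (F →L[ℝ] F))
    (Reg.bilin C h.of_succ h.of_succ) h.of_succ)

/-- Bootstrapping: mild solutions of `∂_t U = Δ U + B(U, ∂U) + C(U, U, U)` are smooth. -/
theorem Mild.reg_nonlin [CompleteSpace F] (h : Mild T U (YM.nonlin B C U)) (h1 : Reg false T 1 U) :
    ∀ k : ℕ, Reg false T (k + 1) U
  | 0 => h1
  -- The nonlinearity loses one derivative, so gaining one would not advance. The first pass,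
  -- `Mild.reg`, only adds Hölder continuity to the top derivative of `U`. The nonlinearity inherits
  -- it, and the second pass then gains two.
  | k + 1 => h.reg_of_holder h1.1 ((h.reg h1.1 (h.reg_nonlin h1 k).nonlin).nonlin)

/-- Continuous maps from `(0, T)` to the smooth functions on the torus. -/
structure SmoothCurve (T : ℝ) (U : ℝ → E3 → F) : Prop where
  per : ∀ t ∈ Ioo 0 T, Periodic (U t)
  smooth : ∀ t ∈ Ioo 0 T, ContDiff ℝ ∞ (U t)
  cont : ∀ n : ℕ, ContinuousOn
    (fun p : ℝ × E3 => iteratedFDeriv ℝ n (U p.1) p.2) (Ioo 0 T ×ˢ univ)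

theorem Reg.contDiff : ∀ {k : ℕ} {F : Type u} [NormedAddCommGroup F] [NormedSpace ℝ F]
    {u : ℝ → E3 → F}, Reg b T k u → ∀ t ∈ Ioo 0 T, ContDiff ℝ k (u t)
  | 0, _, _, _, _, h => fun t ht => contDiff_zero.2 (h.1.continuous ht)
  | k + 1, _, _, _, _, h => fun t ht => by
    push_cast
    exact contDiff_succ_iff_fderiv.2 ⟨h.2.1 t ht, by simp, h.2.2.contDiff t ht⟩

theorem Reg.continuousOn_iteratedFDeriv : ∀ {k : ℕ} {F : Type u} [NormedAddCommGroup F]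
    [NormedSpace ℝ F] {u : ℝ → E3 → F}, Reg b T k u → ContinuousOn
      (fun p : ℝ × E3 => iteratedFDeriv ℝ k (u p.1) p.2) (Ioo 0 T ×ˢ univ)
  | 0, F, _, _, _, h => by
    simp only [iteratedFDeriv_zero_eq_comp]
    exact (continuousMultilinearCurryFin0 ℝ E3 F).symm.continuous.comp_continuousOn h.1.cont
  | k + 1, F, _, _, _, h => by
    simp only [iteratedFDeriv_succ_eq_comp_right]
    exact (continuousMultilinearCurryRightEquiv' ℝ k E3 F).symm.continuous.comp_continuousOn
      h.2.2.continuousOn_iteratedFDeriv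

theorem smoothCurve_of_reg (h : ∀ k : ℕ, Reg b T (k + 1) U) : SmoothCurve T U :=
  ⟨(h 0).1.per, fun t ht => contDiff_infty.2 fun n => (h n).of_succ.contDiff t ht,
    fun n => (h n).of_succ.continuousOn_iteratedFDeriv⟩

namespace SmoothCurve

theorem torusCont (h : SmoothCurve T U) : TorusCont (Ioo 0 T) U :=
  ⟨by
    have := h.cont 0
    simp only [iteratedFDeriv_zero_eq_comp] at this
    exact ((continuousMultilinearCurryFin0 ℝ E3 F).continuous.comp_continuousOn this).congr
      fun z _ => by simp, h.per⟩

theorem torusCont_fderiv (h : SmoothCurve T U) : TorusCont (Ioo 0 T) (fun t => fderiv ℝ (U t)) :=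
  ⟨((continuousMultilinearCurryFin1 ℝ E3 F).continuous.comp_continuousOn (h.cont 1)).congr
      fun z _ => by ext v; simp [iteratedFDeriv_one_apply], fun t ht => (h.per t ht).fderiv⟩

theorem torusCont_laplacian [CompleteSpace F] (h : SmoothCurve T U) :
    TorusCont (Ioo 0 T) (fun t => Laplacian.laplacian (U t)) := by
  refine ⟨?_, fun t ht => (h.per t ht).laplacian⟩
  have h2 : ∀ z : ℝ × E3, Laplacian.laplacian (U z.1) z.2 = ∑ i : Fin 3,
      iteratedFDeriv ℝ 2 (U z.1) z.2 ![EuclideanSpace.basisFun (Fin 3) ℝ i, EuclideanSpace.basisFun (Fin 3) ℝ i] := fun z => by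
    rw [InnerProductSpace.laplacian_eq_iteratedFDeriv_orthonormalBasis _
      (EuclideanSpace.basisFun (Fin 3) ℝ)]
  simp only [h2]
  refine continuousOn_finsetSum _ fun i _ => ?_
  exact (ContinuousMultilinearMap.apply ℝ (fun _ : Fin 2 => E3) F
    _).continuous.comp_continuousOn (h.cont 2)

theorem torusCont_nonlin (h : SmoothCurve T U) : TorusCont (Ioo 0 T) (YM.nonlin B C U) :=
  (h.torusCont.bilin B h.torusCont_fderiv).add
    (TorusCont.bilin (ContinuousLinearMap.id ℝ (F →L[ℝ] F)) (h.torusCont.bilin C h.torusCont)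
      h.torusCont)

end SmoothCurve

end Reg

/-! ### Mild and classical solutions -/

section Classical

/-- The integral is small because its interval shrinks to a point, so only continuity of the kernel
at the corner matters and no derivative in the first variable is needed. -/
theorem hasDerivWithinAt_integral_diag {F : Type u} [NormedAddCommGroup F] [NormedSpace ℝ F]
    [CompleteSpace F] {K : ℝ → ℝ → F} {t : ℝ}
    (hc : ContinuousWithinAt (fun z : ℝ × ℝ => K z.1 z.2) {z | t ≤ z.2 ∧ z.2 ≤ z.1} (t, t))
    (hint : ∀ᶠ t' in 𝓝[>] t, IntervalIntegrable (K t') volume t t') :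
    HasDerivWithinAt (fun t' => ∫ r in t..t', K t' r) (K t t) (Ici t) t := by
  rw [hasDerivWithinAt_iff_isLittleO, Asymptotics.isLittleO_iff]
  intro ε hε
  rw [intervalIntegral.integral_same]
  obtain ⟨δ, hδ, hd⟩ := Metric.continuousWithinAt_iff.1 hc ε hε
  have hint' : ∀ᶠ t' in 𝓝[≥] t, t' ≠ t → IntervalIntegrable (K t') volume t t' := by
    rw [← Ioi_insert, nhdsWithin_insert, eventually_sup]
    exact ⟨by simp, hint.mono fun _ h _ => h⟩
  filter_upwards [hint', eventually_mem_nhdsWithin,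
    nhdsWithin_le_nhds (Metric.ball_mem_nhds t hδ)] with t' hi ht' hb
  rcases eq_or_ne t' t with rfl | hne
  · simp
  have hlt : t < t' := lt_of_le_of_ne ht' hne.symm
  rw [sub_zero, Real.norm_of_nonneg (sub_nonneg.2 hlt.le)]
  have h1 : (∫ r in t..t', K t' r) - (t' - t) • K t t = ∫ r in t..t', (K t' r - K t t) := by
    rw [intervalIntegral.integral_sub (hi hne) (by simp), intervalIntegral.integral_const]
  rw [h1]
  refine (intervalIntegral.norm_integral_le_of_norm_le_const (C := ε) fun r hr => ?_).trans
    (by rw [abs_of_pos (sub_pos.2 hlt)])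
  rw [uIoc_of_le hlt.le] at hr
  rw [Metric.mem_ball, Real.dist_eq, abs_of_pos (sub_pos.2 hlt)] at hb
  have := hd (x := (t', r)) ⟨hr.1.le, hr.2⟩ (by
    rw [Prod.dist_eq, Real.dist_eq, Real.dist_eq, abs_of_pos (sub_pos.2 hlt),
      abs_of_pos (sub_pos.2 hr.1)]
    exact max_lt hb (by linarith [hr.2]))
  rw [dist_eq_norm] at this
  exact this.le

variable {F : Type u} [NormedAddCommGroup F] [NormedSpace ℝ F] [CompleteSpace F]
  {T : ℝ} {v f : ℝ → E3 → F}

theorem TorusCont.intervalIntegrable {a b c d : ℝ} (hf : TorusCont (Ioo a b) f) (hc : a < c)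
    (hd : d < b) (hcd : c ≤ d) (x : E3) : IntervalIntegrable (fun r => f r x) volume c d :=
  ((hf.continuousOn_time x).mono fun r hr => by
    rw [uIcc_of_le hcd] at hr
    exact ⟨hc.trans_le hr.1, hr.2.trans_lt hd⟩).intervalIntegrable

theorem TorusCont.continuousWithinAt_gauss_diag (hf : TorusCont (Ioo 0 T) f) {t s : ℝ}
    (ht : t ∈ Ioo 0 T) (x : E3) : ContinuousWithinAt
      (fun z : ℝ × ℝ => gauss (s - z.1) (f z.2) x) {z | t ≤ z.2 ∧ z.2 ≤ z.1} (t, t) := by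
  have h1 := (continuousOn_gauss (X := ℝ × ℝ) (S := univ ×ˢ Ioo 0 T) (u := fun z => f z.2)
    (h := fun z => s - z.1) (hf.cont.comp (f := fun z : (ℝ × ℝ) × E3 => (z.1.2, z.2)) (by fun_prop)
      fun z hz => ⟨hz.1.2, mem_univ _⟩) (fun z hz => hf.per _ hz.2) (by fun_prop))
  have h2 := (h1.comp (f := fun z : ℝ × ℝ => (z, x)) (s := univ ×ˢ Ioo 0 T) (by fun_prop)
    fun z hz => ⟨hz, mem_univ _⟩) (t, t) ⟨mem_univ _, ht⟩
  refine (h2.continuousAt ?_).continuousWithinAt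
  exact (isOpen_univ.prod isOpen_Ioo).mem_nhds ⟨mem_univ _, ht⟩

/-- Subtracting a primitive of `g` leaves a continuous function with vanishing right derivative,
hence a constant. -/
theorem hasDerivAt_of_right_deriv {φ g : ℝ → F} (hφ : ContinuousOn φ (Ioo 0 T))
    (hg : ContinuousOn g (Ioo 0 T))
    (hd : ∀ t ∈ Ioo 0 T, HasDerivWithinAt φ (g t) (Ici t) t) :
    ∀ t ∈ Ioo 0 T, HasDerivAt φ (g t) t := by
  intro t ht
  obtain ⟨a, ha, hat⟩ := exists_between ht.1
  obtain ⟨b, htb, hb⟩ := exists_between ht.2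
  have hsub : Icc a b ⊆ Ioo 0 T := Icc_subset_Ioo_zero ha hb
  have hgt : ∀ r ∈ Ioo 0 T, HasDerivAt (fun r => ∫ σ in a..r, g σ) (g r) r := fun r hr =>
    intervalIntegral.integral_hasDerivAt_right
      ((hg.mono fun σ hσ => by
        rcases le_total a r with h | h
        · rw [uIcc_of_le h] at hσ
          exact ⟨ha.trans_le hσ.1, hσ.2.trans_lt hr.2⟩
        · rw [uIcc_of_ge h] at hσ
          exact ⟨hr.1.trans_le hσ.1, hσ.2.trans_lt (hat.trans ht.2)⟩).intervalIntegrable)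
      (hg.stronglyMeasurableAtFilter isOpen_Ioo r hr)
      ((hg r hr).continuousAt (isOpen_Ioo.mem_nhds hr))
  have hconst : ∀ r ∈ Icc a b, φ r - ∫ σ in a..r, g σ = φ a - ∫ σ in a..a, g σ := by
    refine constant_of_has_deriv_right_zero ?_ fun r hr => ?_
    · exact (hφ.mono hsub).sub fun r hr => (hgt r (hsub hr)).continuousAt.continuousWithinAt
    · have hr' := hsub (Ico_subset_Icc_self hr)
      have h3 := (hd r hr').sub (hgt r hr').hasDerivWithinAt
      rw [sub_self] at h3
      exact h3
  refine ((hgt t ht).const_add (φ a)).congr_of_eventuallyEq ?_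
  filter_upwards [Icc_mem_nhds hat htb] with r hr
  have := hconst r hr
  rw [intervalIntegral.integral_same, sub_zero] at this
  rw [← this]
  abel

/-- Smooth mild solutions are classical. -/
theorem Mild.hasDerivAt (h : Mild T v f) (hv : SmoothCurve T v) (hf : TorusCont (Ioo 0 T) f) :
    ∀ t ∈ Ioo 0 T, ∀ x,
      HasDerivAt (fun r => v r x) (Laplacian.laplacian (v t) x + f t x) t := by
  intro t ht x
  -- The mild formula restarted at `t` describes only later times, so it yields a one-sided
  -- derivative.
  refine hasDerivAt_of_right_deriv (φ := fun r => v r x)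
    (g := fun r => Laplacian.laplacian (v r) x + f r x) (hv.torusCont.continuousOn_time x)
    ((hv.torusCont_laplacian.add hf).continuousOn_time x) (fun t ht => ?_) t ht
  have hc2 : ContDiff ℝ 2 (v t) := (hv.smooth t ht).of_le (by norm_cast)
  have hlc := continuous_laplacian hc2
  have hgt : ContinuousOn (fun k => gauss k (Laplacian.laplacian (v t)) x) (Ici 0) :=
    continuousOn_gauss_time (hv.per t ht).laplacian hlc x
  have h1 : HasDerivWithinAt (fun t' => ∫ r in t..t', gauss (r - t) (Laplacian.laplacian (v t)) x)
      (gauss (t - t) (Laplacian.laplacian (v t)) x) (Ici t) t := by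
    have hco : ContinuousOn (fun r => gauss (r - t) (Laplacian.laplacian (v t)) x) (Ici t) :=
      hgt.comp (f := fun r => r - t) (by fun_prop) fun r hr => mem_Ici.2 (sub_nonneg.2 hr)
    refine hasDerivWithinAt_integral_diag
      (K := fun _ r => gauss (r - t) (Laplacian.laplacian (v t)) x) ?_ ?_
    · exact (hco.comp (f := fun z : ℝ × ℝ => z.2) (s := {z | t ≤ z.2 ∧ z.2 ≤ z.1}) (by fun_prop)
        fun z hz => hz.1) (t, t) ⟨le_rfl, le_rfl⟩
    · filter_upwards [self_mem_nhdsWithin] with t' ht'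
      refine (hco.mono fun r hr => ?_).intervalIntegrable
      rw [uIcc_of_le (le_of_lt ht')] at hr
      exact hr.1
  have h2 : HasDerivWithinAt (fun t' => duh t f t' x) (gauss (t - t) (f t) x) (Ici t) t := by
    refine hasDerivWithinAt_integral_diag (K := fun t' r => gauss (t' - r) (f r) x) ?_ ?_
    · have h3 := (continuousOn_gauss (X := ℝ × ℝ) (S := univ ×ˢ Ioo 0 T) (u := fun z => f z.2)
        (h := fun z => z.1 - z.2)
        (hf.cont.comp (f := fun z : (ℝ × ℝ) × E3 => (z.1.2, z.2)) (by fun_prop)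
        fun z hz => ⟨hz.1.2, mem_univ _⟩) (fun z hz => hf.per _ hz.2) (by fun_prop))
      have h4 := (h3.comp (f := fun z : ℝ × ℝ => (z, x)) (s := univ ×ˢ Ioo 0 T) (by fun_prop)
        fun z hz => ⟨hz, mem_univ _⟩) (t, t) ⟨mem_univ _, ht⟩
      refine (h4.continuousAt ?_).continuousWithinAt
      exact (isOpen_univ.prod isOpen_Ioo).mem_nhds ⟨mem_univ _, ht⟩
    · obtain ⟨b, htb, hb⟩ := exists_between ht.2
      filter_upwards [Ioo_mem_nhdsGT htb] with t' ht'
      obtain ⟨M, -, -, hs⟩ := hf.source (Icc_subset_Ioo_zero ht.1 hb)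
      exact hs.kernel.intervalIntegrable (by norm_num) (by norm_num) ht'.1 ht'.2 x
  rw [sub_self, gauss_zero] at h1 h2
  refine ((h1.add h2).const_add (v t x)).congr_of_eventuallyEq ?_ ?_
  · filter_upwards [self_mem_nhdsWithin, nhdsWithin_le_nhds (Iio_mem_nhds ht.2)] with t' ht' htT
    rcases eq_or_lt_of_le (show t ≤ t' from ht') with rfl | hlt
    · simp [duh]
    · rw [h t t' ht.1 hlt htT x, Pi.add_apply, ← add_assoc]
      congr 1
      rw [intervalIntegral.integral_comp_sub_right
        (fun r => gauss r (Laplacian.laplacian (v t)) x) t, sub_self,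
        ← gauss_sub_self (hv.per t ht) hc2 (sub_nonneg.2 hlt.le)]
      abel
  · simp [duh]

/-- Classical solutions are mild. -/
theorem SmoothCurve.mild (hv : SmoothCurve T v) (hf : TorusCont (Ioo 0 T) f)
    (hd : ∀ t ∈ Ioo 0 T, ∀ x,
      HasDerivAt (fun r => v r x) (Laplacian.laplacian (v t) x + f t x) t) : Mild T v f := by
  intro a t ha hat ht x
  have hV := hv.torusCont
  have hL := hv.torusCont_laplacian
  have hmem : ∀ r ∈ Icc a t, r ∈ Ioo 0 T := Icc_subset_Ioo_zero ha ht
  have hcd : ContinuousOn (fun r => gauss (t - r) (f r) x) (Ioo 0 T) :=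
    (continuousOn_gauss (h := fun r => t - r) hf.cont hf.per (by fun_prop)).comp
      (f := fun r => (r, x)) (by fun_prop) fun r hr => ⟨hr, mem_univ _⟩
  have hcv : ContinuousOn (fun r => gauss (t - r) (v r) x) (Ioo 0 T) :=
    (continuousOn_gauss (h := fun r => t - r) hV.cont hV.per (by fun_prop)).comp
      (f := fun r => (r, x)) (by fun_prop) fun r hr => ⟨hr, mem_univ _⟩
  have hgt : ∀ r ∈ Icc a t, HasDerivAt (fun r => ∫ σ in a..r, gauss (t - σ) (f σ) x)
      (gauss (t - r) (f r) x) r := fun r hr =>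
    intervalIntegral.integral_hasDerivAt_right
      ((hcd.mono fun σ hσ => by
        rw [uIcc_of_le hr.1] at hσ
        exact ⟨ha.trans_le hσ.1, hσ.2.trans_lt (hmem r hr).2⟩).intervalIntegrable)
      (hcd.stronglyMeasurableAtFilter isOpen_Ioo r (hmem r hr))
      ((hcd r (hmem r hr)).continuousAt (isOpen_Ioo.mem_nhds (hmem r hr)))
  -- Variation of constants: `r ↦ P_{t-r} v_r` has derivative `P_{t-r} f_r`, and integrating it from
  -- `a` to `t` is the mild formula.
  have hright : ∀ r ∈ Ico a t, HasDerivWithinAt (fun r => gauss (t - r) (v r) x)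
      (gauss (t - r) (f r) x) (Ici r) r := by
    intro r hr
    have hrT := hmem r (Ico_subset_Icc_self hr)
    have hc2 : ContDiff ℝ 2 (v r) := (hv.smooth r hrT).of_le (by norm_cast)
    have hlc := continuous_laplacian hc2
    -- This is the time derivative of `v_σ - P_{σ-r} v_r`. It reduces to `f_r` at `σ = r`, where the
    -- two Laplacians cancel.
    set W : ℝ → E3 → F := fun σ y => Laplacian.laplacian (v σ) y + f σ y -
      gauss (σ - r) (Laplacian.laplacian (v r)) y with hW
    have hWc : TorusCont (Ioo 0 T) W := (hL.add hf).sub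
      ⟨continuousOn_gauss (u := fun _ : ℝ => Laplacian.laplacian (v r)) (h := fun t => t - r)
        (hlc.comp continuous_snd).continuousOn (fun _ _ => (hv.per r hrT).laplacian) (by fun_prop),
        fun t _ => (hv.per r hrT).laplacian.gauss _⟩
    have hWr : W r = f r := by
      funext y
      simp [hW, gauss_zero]
    have hdiag := hasDerivWithinAt_integral_diag (K := fun r' σ => gauss (t - r') (W σ) x)
      (t := r) (hWc.continuousWithinAt_gauss_diag hrT x) (by
        filter_upwards [Ioo_mem_nhdsGT hr.2] with r' hr'
        have : ContinuousOn (fun σ => gauss (t - r') (W σ) x) (Ioo 0 T) :=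
          (continuousOn_gauss (h := fun _ => t - r') hWc.cont hWc.per (by fun_prop)).comp
            (f := fun r => (r, x)) (by fun_prop) fun r hr => ⟨hr, mem_univ _⟩
        refine (this.mono fun σ hσ => ?_).intervalIntegrable
        rw [uIcc_of_le hr'.1.le] at hσ
        exact ⟨hrT.1.trans_le hσ.1, hσ.2.trans_lt (hr'.2.trans ht)⟩)
    simp only [hWr] at hdiag
    refine (hdiag.const_add (gauss (t - r) (v r) x)).congr_of_eventuallyEq ?_ (by simp)
    filter_upwards [self_mem_nhdsWithin, nhdsWithin_le_nhds (Iio_mem_nhds hr.2)] with r' hr' hr't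
    rcases eq_or_lt_of_le (show r ≤ r' from hr') with rfl | hlt
    · simp
    have hr'T : r' ∈ Ioo 0 T := ⟨hrT.1.trans hlt, lt_trans hr't ht⟩
    obtain ⟨N, -, hN⟩ := hV.exists_bound hrT
    obtain ⟨N', -, hN'⟩ := hV.exists_bound hr'T
    have e1 : ∀ y, v r' y - gauss (r' - r) (v r) y = ∫ σ in r..r', W σ y := by
      intro y
      have hi1 : IntervalIntegrable (fun σ => Laplacian.laplacian (v σ) y + f σ y) volume r r' :=
        (hL.add hf).intervalIntegrable hrT.1 hr'T.2 hlt.le y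
      have hi2 : IntervalIntegrable (fun σ => gauss (σ - r) (Laplacian.laplacian (v r)) y)
          volume r r' := by
        refine ((continuousOn_gauss_time (hv.per r hrT).laplacian hlc y).comp
          (f := fun σ => σ - r) (s := uIcc r r') (by fun_prop) fun σ hσ => ?_).intervalIntegrable
        rw [uIcc_of_le hlt.le] at hσ
        exact sub_nonneg.2 hσ.1
      rw [intervalIntegral.integral_sub hi1 hi2,
        intervalIntegral.integral_eq_sub_of_hasDerivAt (fun σ hσ => hd σ ?_ y) hi1,
        intervalIntegral.integral_comp_sub_right
          (fun k => gauss k (Laplacian.laplacian (v r)) y) r, sub_self,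
        ← gauss_sub_self (hv.per r hrT) hc2 (sub_nonneg.2 hlt.le)]
      · abel
      · rw [uIcc_of_le hlt.le] at hσ
        exact ⟨hrT.1.trans_le hσ.1, hσ.2.trans_lt hr'T.2⟩
    have e2 : gauss (t - r') (v r') x - gauss (t - r) (v r) x =
        gauss (t - r') (fun y => ∫ σ in r..r', W σ y) x := by
      rw [← funext e1, gauss_sub (hV.continuous hr'T) (continuous_gauss (hV.continuous hrT) hN)
        hN' (norm_gauss_le hN), gauss_gauss (sub_nonneg.2 (le_of_lt hr't))
        (sub_nonneg.2 hlt.le) (hV.continuous hrT) hN, sub_add_sub_cancel]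
    obtain ⟨b, hb, hbT⟩ := exists_between hr'T.2
    obtain ⟨M, hM0, hM⟩ := hWc.exists_bound_Icc (Icc_subset_Ioo_zero hrT.1 hbT)
    have hk : SingularKernel r b 0 0 M (fun _ σ => W σ) :=
      ⟨hWc.cont.comp (f := fun z : (ℝ × ℝ) × E3 => (z.1.2, z.2)) (by fun_prop)
        fun z hz => ⟨⟨hrT.1.trans hz.1.1, hz.1.2.1.trans (hz.1.2.2.trans hbT)⟩, mem_univ _⟩,
        fun t' σ y h1 h2 h3 => by simpa using hM σ ⟨h1.le, (h2.trans h3).le⟩ y⟩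
    rw [hk.gauss_integral (by norm_num) (by norm_num) hlt hb] at e2
    rw [← e2]
    abel
  have hconst := constant_of_has_deriv_right_zero
    (f := fun r => gauss (t - r) (v r) x - ∫ σ in a..r, gauss (t - σ) (f σ) x) (a := a) (b := t)
    ((hcv.mono hmem).sub fun r hr => (hgt r hr).continuousAt.continuousWithinAt)
    (fun r hr => by
      have h3 := (hright r hr).sub (hgt r (Ico_subset_Icc_self hr)).hasDerivWithinAt
      rw [sub_self] at h3
      exact h3)
    t ⟨hat.le, le_rfl⟩
  simp only [sub_self, gauss_zero, intervalIntegral.integral_same, sub_zero] at hconst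
  rw [← hconst, duh]
  abel

end Classical

/-! ### Quantitative bounds on the heat flow of a distribution -/

section HeatBounds

theorem reg_zero {b : Bool} {T : ℝ} : ∀ (k : ℕ) {F : Type u} [NormedAddCommGroup F]
    [NormedSpace ℝ F], Reg b T k (fun (_ : ℝ) (_ : E3) => (0 : F))
  | 0, _, _, _ => ⟨⟨continuousOn_const, fun _ _ _ _ => rfl⟩, fun _ _ _ _ _ => ⟨0, by simp⟩⟩
  | k + 1, _, _, _ => ⟨⟨continuousOn_const, fun _ _ _ _ => rfl⟩,
      fun _ _ => differentiable_const _,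
      (reg_zero k).congr fun _ _ => funext fun _ => by simp⟩

variable {F : Type u} [NormedAddCommGroup F] [NormedSpace ℝ F] [CompleteSpace F]

theorem torusCont_heat (T : ℝ) (A : TDist F) : TorusCont (Ioo 0 T) (fun t => heat t A) :=
  torusCont_of_local fun a b ha hab hb =>
    (torusCont_gauss_shift (continuous_heat ha A) (periodic_heat a A)).congr fun t ht x => by
      rw [gauss_heat ha (sub_nonneg.2 ht.1.le), add_sub_cancel]

theorem mild_heat (T : ℝ) (A : TDist F) : Mild T (fun t => heat t A) (fun _ _ => 0) := by
  intro a t ha hat ht x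
  rw [gauss_heat ha (sub_nonneg.2 hat.le), add_sub_cancel]
  simp [duh, gauss]

theorem smoothCurve_heat (T : ℝ) (A : TDist F) : SmoothCurve T (fun t => heat t A) :=
  smoothCurve_of_reg (b := true) fun k => (mild_heat T A).reg (torusCont_heat T A) (reg_zero k)

theorem fderiv_heat_eq {s : ℝ} (hs : 0 < s) (A : TDist F) :
    fderiv ℝ (heat s A) = gaussGrad (s / 2) (heat (s / 2) A) := by
  have h2 := half_pos hs
  obtain ⟨M, -, hM⟩ := (periodic_heat (s / 2) A).exists_bound (continuous_heat h2 A)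
  rw [← fderiv_gauss h2 (continuous_heat h2 A) hM]
  congr 1
  funext x
  rw [gauss_heat h2 h2.le, add_halves]

theorem norm_fderiv_heat_le {s : ℝ} (hs : 0 < s) (A : TDist F) {N : ℝ}
    (hN : ∀ x, ‖heat (s / 2) A x‖ ≤ N) (x : E3) :
    ‖fderiv ℝ (heat s A) x‖ ≤ gmMean * N * s ^ (-(1 / 2) : ℝ) := by
  rw [fderiv_heat_eq hs A]
  refine (norm_gaussGrad_le hN x).trans (le_of_eq ?_)
  rw [mul_div_cancel₀ _ two_ne_zero, inv_sqrt_eq_rpow hs.le]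
  ring

/-- Use a segment of length `κ s^{1/2+θ}`, shorter than `s^θ` and hence admissible. The mean value
gives `s^{(1/2+θ)(α-1)} = s^{η/2}`. The gradient error carries the assumed bound at time `s/2` with
an additional factor `κ s^θ`. -/
theorem norm_heat_step {α θ S κ s D e : ℝ} (hθ : 0 < θ) (hκ : 0 < κ)
    (hκ4 : κ ≤ 1 / 4) {A : TDist F} (hs : s ∈ Ioo (0 : ℝ) 1)
    (hS : ∀ x v, ‖v‖ ≤ 1 / 4 → ‖v‖ < s ^ θ → ‖lineInt (heat s A) x v‖ ≤ S * ‖v‖ ^ α)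
    (hD : ∀ y, ‖heat (s / 2) A y‖ ≤ D * (s / 2) ^ e) (x : E3) :
    ‖heat s A x‖ ≤ κ ^ (α - 1) * S * s ^ (etaOf α θ / 2) +
      κ * gmMean * 2 ^ (-e) * D * s ^ (θ + e) := by
  have hs0 := hs.1
  have hse : 0 < s ^ (1 / 2 + θ) := Real.rpow_pos_of_pos hs0 _
  have hr : 0 < κ * s ^ (1 / 2 + θ) := mul_pos hκ hse
  have hnorm : ‖(κ * s ^ (1 / 2 + θ)) • (EuclideanSpace.single 0 1 : E3)‖ = κ * s ^ (1 / 2 + θ) := by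
    rw [norm_smul, PiLp.norm_single, norm_one, mul_one, Real.norm_of_nonneg hr.le]
  have h1 : s ^ (1 / 2 + θ) ≤ 1 := Real.rpow_le_one hs0.le hs.2.le (by linarith)
  have h2 : s ^ (1 / 2 + θ) ≤ s ^ θ :=
    Real.rpow_le_rpow_of_exponent_ge hs0 hs.2.le (by linarith)
  have hl := hS x ((κ * s ^ (1 / 2 + θ)) • EuclideanSpace.single 0 1)
    (by rw [hnorm]; nlinarith) (by rw [hnorm]; nlinarith)
  rw [hnorm] at hl
  have hdiff : Differentiable ℝ (heat s A) :=
    ((smoothCurve_heat 1 A).smooth s hs).differentiable (by simp)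
  refine (norm_le_lineInt hdiff (norm_fderiv_heat_le hs0 A hD) x hr).trans (add_le_add ?_ ?_)
  · rw [div_le_iff₀ hr]
    refine hl.trans (le_of_eq ?_)
    have e1 : (κ * s ^ (1 / 2 + θ)) ^ α = κ ^ (α - 1) * s ^ (etaOf α θ / 2) *
        (κ * s ^ (1 / 2 + θ)) := by
      rw [Real.mul_rpow hκ.le hse.le, ← Real.rpow_mul hs0.le, mul_mul_mul_comm, ← Real.rpow_add_one
        hκ.ne', ← Real.rpow_add hs0, etaOf]
      congr 2 <;> ring
    rw [e1]
    ring
  · refine le_of_eq ?_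
    have e2 : s ^ (θ + e) = s ^ (1 / 2 + θ) * s ^ e * s ^ (-(1 / 2) : ℝ) := by
      rw [← Real.rpow_add hs0, ← Real.rpow_add hs0]
      congr 1
      ring
    rw [Real.div_rpow hs0.le zero_le_two, e2, Real.rpow_neg zero_le_two]
    ring

/-- Every application of `norm_heat_step` improves the exponent by `θ`, so finitely many lead from
the crude power of `exists_norm_heat_le` to `η/2`. The constant is not yet uniform in `A`. -/
theorem exists_norm_heat_le_rpow {α θ S : ℝ} (hθ : 0 < θ) (hS0 : 0 ≤ S) (hα : α < 1)
    {A : TDist F}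
    (hS : ∀ s ∈ Ioo (0 : ℝ) 1, ∀ x v, ‖v‖ ≤ 1 / 4 → ‖v‖ < s ^ θ →
      ‖lineInt (heat s A) x v‖ ≤ S * ‖v‖ ^ α) :
    ∃ C, 0 ≤ C ∧ ∀ s ∈ Ioo (0 : ℝ) 1, ∀ x, ‖heat s A x‖ ≤ C * s ^ (etaOf α θ / 2) := by
  have step : ∀ n : ℕ, (∃ C, 0 ≤ C ∧ ∀ s ∈ Ioo (0 : ℝ) 1, ∀ x,
      ‖heat s A x‖ ≤ C * s ^ (etaOf α θ / 2 - n * θ)) →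
      ∃ C, 0 ≤ C ∧ ∀ s ∈ Ioo (0 : ℝ) 1, ∀ x, ‖heat s A x‖ ≤ C * s ^ (etaOf α θ / 2) := by
    intro n
    induction n with
    | zero => simp
    | succ n ih =>
      rintro ⟨C, hC0, hC⟩
      have := gmMean_nonneg
      refine ih ⟨(1 / 4) ^ (α - 1) * S + (1 / 4) * gmMean *
        2 ^ (-(etaOf α θ / 2 - ((n + 1 : ℕ) : ℝ) * θ)) * C, by positivity, fun s hs x => ?_⟩
      have hs2 : s / 2 ∈ Ioo (0 : ℝ) 1 := ⟨half_pos hs.1, by linarith [hs.1, hs.2]⟩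
      refine (norm_heat_step hθ (by norm_num) le_rfl hs (hS s hs) (hC _ hs2) x).trans ?_
      rw [add_mul]
      have e1 : θ + (etaOf α θ / 2 - ((n + 1 : ℕ) : ℝ) * θ) = etaOf α θ / 2 - n * θ := by
        push_cast
        ring
      rw [e1]
      gcongr ?_ * ?_ + _
      exact Real.rpow_le_rpow_of_exponent_ge hs.1 hs.2.le (by
        have : 0 ≤ (n : ℝ) * θ := by positivity
        linarith)
  obtain ⟨N, C, hC0, hC⟩ := exists_norm_heat_le A
  obtain ⟨n, hn⟩ := exists_nat_ge (N / θ)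
  refine step n ⟨C, hC0, fun s hs x => (hC s ⟨hs.1, hs.2.le⟩ x).trans ?_⟩
  gcongr
  rw [inv_pow, ← Real.rpow_natCast, ← Real.rpow_neg hs.1.le]
  refine Real.rpow_le_rpow_of_exponent_ge hs.1 hs.2.le ?_
  rw [div_le_iff₀ hθ] at hn
  have : etaOf α θ ≤ 0 := by
    rw [etaOf]
    exact mul_nonpos_of_nonneg_of_nonpos (by linarith) (by linarith)
  linarith

variable (F) in
/-- `|P_s A| ≲ s^{η/2}` and `|∂P_s A| ≲ s^{(η-1)/2}`. -/
theorem exists_heat_bounds {α θ : ℝ} (hθ : 0 < θ) (hα : α < 1) :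
    ∃ K, 0 < K ∧ ∀ (A : TDist F) (S : ℝ), 0 ≤ S →
      (∀ s ∈ Ioo (0 : ℝ) 1, ∀ x v, ‖v‖ ≤ 1 / 4 → ‖v‖ < s ^ θ →
        ‖lineInt (heat s A) x v‖ ≤ S * ‖v‖ ^ α) →
      ∀ s ∈ Ioo (0 : ℝ) 1, ∀ x, ‖heat s A x‖ ≤ K * S * s ^ (etaOf α θ / 2) ∧
        ‖fderiv ℝ (heat s A) x‖ ≤ K * S * s ^ ((etaOf α θ - 1) / 2) := by
  set η := etaOf α θ with hη
  have hm := gmMean_nonneg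
  have h2p : (0 : ℝ) < 2 ^ (-(η / 2)) := Real.rpow_pos_of_pos two_pos _
  have hη0 : η ≤ 0 := by
    rw [hη, etaOf]
    exact mul_nonpos_of_nonneg_of_nonpos (by linarith) (by linarith)
  have h2p1 : (1 : ℝ) ≤ 2 ^ (-(η / 2)) := Real.one_le_rpow one_le_two (by linarith)
  -- Chosen so that, with `e = η/2`, the error coefficient in `norm_heat_step` is at most one half.
  set κ : ℝ := (4 * (1 + gmMean) * 2 ^ (-(η / 2)))⁻¹ with hκdef
  have hden : 4 ≤ 4 * (1 + gmMean) * 2 ^ (-(η / 2)) := by nlinarith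
  have hκ : 0 < κ := inv_pos.2 (by linarith)
  have hκ4 : κ ≤ 1 / 4 := by
    rw [hκdef, one_div]
    exact inv_anti₀ (by norm_num) hden
  have hκ2 : κ * gmMean * 2 ^ (-(η / 2)) ≤ 1 / 2 := by
    rw [hκdef, mul_assoc, inv_mul_le_iff₀ (by linarith)]
    nlinarith
  have hK1 : 0 < κ ^ (α - 1) := Real.rpow_pos_of_pos hκ _
  refine ⟨2 * κ ^ (α - 1) + gmMean * (2 * κ ^ (α - 1)) * 2 ^ (-(η / 2)), by positivity,
    fun A S hS0 hS => ?_⟩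
  obtain ⟨C, hC0, hC⟩ := exists_norm_heat_le_rpow hθ hS0 hα hS
  -- The non-uniform constant `C` is halved at each iteration and vanishes in the limit; the
  -- coefficient `2 κ^{α-1} S` is reproduced.
  have key : ∀ n : ℕ, ∀ s ∈ Ioo (0 : ℝ) 1, ∀ x,
      ‖heat s A x‖ ≤ (2 * κ ^ (α - 1) * S + (1 / 2) ^ n * C) * s ^ (η / 2) := by
    intro n
    induction n with
    | zero =>
      intro s hs x
      refine (hC s hs x).trans ?_
      have := Real.rpow_nonneg hs.1.le (η / 2)
      gcongr
      rw [pow_zero, one_mul]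
      have : 0 ≤ 2 * κ ^ (α - 1) * S := by positivity
      linarith
    | succ n ih =>
      intro s hs x
      have hs2 : s / 2 ∈ Ioo (0 : ℝ) 1 := ⟨half_pos hs.1, by linarith [hs.1, hs.2]⟩
      refine (norm_heat_step hθ hκ hκ4 hs (hS s hs) (ih _ hs2) x).trans ?_
      have hse : s ^ (θ + η / 2) ≤ s ^ (η / 2) :=
        Real.rpow_le_rpow_of_exponent_ge hs.1 hs.2.le (by linarith)
      calc _ ≤ κ ^ (α - 1) * S * s ^ (η / 2) +
            1 / 2 * (2 * κ ^ (α - 1) * S + (1 / 2) ^ n * C) * s ^ (η / 2) := by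
              have := Real.rpow_nonneg hs.1.le (θ + η / 2)
              gcongr
        _ = _ := by ring
  have hfirst : ∀ s ∈ Ioo (0 : ℝ) 1, ∀ x, ‖heat s A x‖ ≤ 2 * κ ^ (α - 1) * S * s ^ (η / 2) := by
    intro s hs x
    have hlim : Tendsto (fun n : ℕ => (2 * κ ^ (α - 1) * S + (1 / 2) ^ n * C) * s ^ (η / 2)) atTop
        (𝓝 ((2 * κ ^ (α - 1) * S + 0 * C) * s ^ (η / 2))) :=
      (((tendsto_pow_atTop_nhds_zero_of_lt_one (by norm_num) (by norm_num)).mul_const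
        C).const_add _).mul_const _
    rw [zero_mul, add_zero] at hlim
    exact ge_of_tendsto' hlim fun n => key n s hs x
  intro s hs x
  have hs2 : s / 2 ∈ Ioo (0 : ℝ) 1 := ⟨half_pos hs.1, by linarith [hs.1, hs.2]⟩
  have hp1 := Real.rpow_nonneg hs.1.le (η / 2)
  have hp2 := Real.rpow_nonneg hs.1.le ((η - 1) / 2)
  constructor
  · refine (hfirst s hs x).trans ?_
    gcongr
    have : 0 ≤ gmMean * (2 * κ ^ (α - 1)) * 2 ^ (-(η / 2)) := by positivity
    linarith
  · refine (norm_fderiv_heat_le hs.1 A (hfirst _ hs2) x).trans ?_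
    rw [Real.div_rpow hs.1.le zero_le_two]
    calc _ = gmMean * (2 * κ ^ (α - 1)) * 2 ^ (-(η / 2)) * S * s ^ ((η - 1) / 2) := by
          rw [show (η - 1) / 2 = η / 2 + -(1 / 2) by ring, Real.rpow_add hs.1,
            Real.rpow_neg zero_le_two]
          ring
      _ ≤ _ := by
        gcongr
        linarith

end HeatBounds

/-! ### The nonlinearity -/

section Algebra

variable {𝔤 : Type u} [CompactLieAlgebra 𝔤] [FiniteDimensional ℝ 𝔤]

variable (𝔤) in
/-- The bilinear map `(u, p) ↦ ∑_j [u_j, 2 (p_j)_i - (p_i)_j]`. -/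
def bracketLin : Conn 𝔤 →ₗ[ℝ] PiLp 2 (fun _ : Fin 3 => Conn 𝔤) →ₗ[ℝ] Conn 𝔤 :=
  LinearMap.mk₂ ℝ (fun u p => WithLp.toLp 2 fun i : Fin 3 =>
      ∑ j : Fin 3, ⁅u j, (2 : ℝ) • p j i - p i j⁆)
    (fun u u' p => by ext i; simp only [PiLp.add_apply, add_lie, Finset.sum_add_distrib])
    (fun c u p => by ext i; simp only [PiLp.smul_apply, smul_lie, ← Finset.smul_sum])
    (fun u p p' => by
      ext i
      simp only [PiLp.add_apply, ← Finset.sum_add_distrib, ← lie_add]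
      refine Finset.sum_congr rfl fun j _ => ?_
      congr 1
      module)
    (fun c u p => by
      ext i
      simp only [PiLp.smul_apply, Finset.smul_sum, ← lie_smul]
      refine Finset.sum_congr rfl fun j _ => ?_
      congr 1
      module)

variable (𝔤) in
/-- The partial derivatives of a total derivative. -/
def partials : (E3 →L[ℝ] Conn 𝔤) →ₗ[ℝ] PiLp 2 (fun _ : Fin 3 => Conn 𝔤) where
  toFun D := WithLp.toLp 2 fun j => D (EuclideanSpace.single j 1)
  map_add' _ _ := rfl
  map_smul' _ _ := rfl

variable (𝔤) in
def quadB : Conn 𝔤 →L[ℝ] (E3 →L[ℝ] Conn 𝔤) →L[ℝ] Conn 𝔤 :=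
  ((bracketLin 𝔤).compl₂ (partials 𝔤)).toContinuousBilinearMap

-- The quadratic term is a linear image of `P_s A ⊗ ∇P_s A`. Linear maps commute with line
-- integrals, so the bounds in `Σ(A)` pass to it.
variable (𝔤) in
def quadL : QuadTarget 𝔤 →L[ℝ] Conn 𝔤 :=
  LinearMap.toContinuousLinearMap (TensorProduct.lift (bracketLin 𝔤))

variable (𝔤) in
def cubicLin (u : Conn 𝔤) : Conn 𝔤 →ₗ[ℝ] Conn 𝔤 →ₗ[ℝ] Conn 𝔤 :=
  LinearMap.mk₂ ℝ (fun v w => WithLp.toLp 2 fun i : Fin 3 => ∑ j : Fin 3, ⁅u j, ⁅v j, w i⁆⁆)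
    (fun v v' w => by ext i; simp [add_lie, Finset.sum_add_distrib])
    (fun c v w => by ext i; simp [Finset.smul_sum])
    (fun v w w' => by ext i; simp [Finset.sum_add_distrib])
    (fun c v w => by ext i; simp [Finset.smul_sum])

variable (𝔤) in
def cubicC : Conn 𝔤 →L[ℝ] Conn 𝔤 →L[ℝ] Conn 𝔤 →L[ℝ] Conn 𝔤 :=
  LinearMap.toContinuousLinearMap
    { toFun := fun u => (cubicLin 𝔤 u).toContinuousBilinearMap
      map_add' := fun u u' => by
        ext v w i
        simp [cubicLin, Finset.sum_add_distrib]
      map_smul' := fun c u => by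
        ext v w i
        simp [cubicLin, Finset.smul_sum] }

theorem quadTerm_eq (u : E3 → Conn 𝔤) (x : E3) : quadTerm u x = quadB 𝔤 (u x) (fderiv ℝ u x) := rfl

theorem cubicTerm_eq (u : E3 → Conn 𝔤) (x : E3) :
    cubicTerm u x = cubicC 𝔤 (u x) (u x) (u x) := rfl

theorem quadTerm_heat (s : ℝ) (A : TDist (Conn 𝔤)) (x : E3) :
    quadTerm (heat s A) x = quadL 𝔤 (quad s A x) := rfl

theorem norm_lineInt_clm {F G : Type*} [NormedAddCommGroup F] [NormedSpace ℝ F]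
    [NormedAddCommGroup G] [NormedSpace ℝ G] [CompleteSpace F] [CompleteSpace G] (L : F →L[ℝ] G)
    {f : E3 → F} (hf : Continuous f) (x v : E3) :
    ‖lineInt (fun y => L (f y)) x v‖ ≤ ‖L‖ * ‖lineInt f x v‖ := by
  have h : lineInt (fun y => L (f y)) x v = L (lineInt f x v) := by
    have hc : Continuous fun t : ℝ => ‖v‖ • f (x + t • v) := by fun_prop
    rw [lineInt, lineInt, ← L.intervalIntegral_comp_comm (hc.intervalIntegrable _ _)]
    simp only [map_smul]
  rw [h]
  exact L.le_opNorm _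

theorem continuous_quad {s : ℝ} (hs : s ∈ Ioo (0 : ℝ) 1) (A : TDist (Conn 𝔤)) :
    Continuous (quad s A) := by
  have h := smoothCurve_heat 1 A
  have h1 := h.torusCont.continuous hs
  have h2 := h.torusCont_fderiv.continuous hs
  let m := LinearMap.toContinuousBilinearMap
    (TensorProduct.mk ℝ (Conn 𝔤) (PiLp 2 (fun _ : Fin 3 => Conn 𝔤)))
  have h3 : Continuous fun x => LinearMap.toContinuousLinearMap (partials 𝔤)
    (fderiv ℝ (heat s A) x) := by fun_prop
  exact (m.continuous.comp h1).clm_apply h3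

/-! ### Extraction of bounds from the size functional -/

/-- Degenerate segments have `b = 0`, where the quotient is `0` by convention and carries no
information. Hence the separate hypothesis `hz`. -/
theorem norm_le_mul_of_ofReal_div_le {a b : ℝ} {S : ℝ≥0∞} (hS : S ≠ ⊤) {c : ℝ} (hc : 0 < c)
    (hb : 0 ≤ b) (hz : b = 0 → a = 0) (h : ENNReal.ofReal c * ENNReal.ofReal (a / b) ≤ S) :
    c * a ≤ S.toReal * b := by
  rcases hb.eq_or_lt with h0 | h0
  · rw [hz h0.symm, ← h0, mul_zero, mul_zero]
  · rw [← ENNReal.ofReal_mul hc.le, ENNReal.ofReal_le_iff_le_toReal hS] at h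
    rwa [← div_le_iff₀ h0, mul_div_assoc]

theorem lineInt_zero_dir {F : Type*} [NormedAddCommGroup F] [NormedSpace ℝ F] (f : E3 → F) (x : E3) :
    lineInt f x 0 = 0 := by simp [lineInt]

theorem norm_lineInt_heat_le {α θ γ δ : ℝ} (hα : 0 < α) {A : TDist (Conn 𝔤)}
    (hA : sigma α θ γ δ A < ⊤) {s : ℝ} (hs : s ∈ Ioo (0 : ℝ) 1) (x v : E3) (hv : ‖v‖ ≤ 1 / 4)
    (hv' : ‖v‖ < s ^ θ) :
    ‖lineInt (heat s A) x v‖ ≤ (sigma α θ γ δ A).toReal * ‖v‖ ^ α := by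
  rw [← one_mul ‖lineInt (heat s A) x v‖]
  refine norm_le_mul_of_ofReal_div_le hA.ne one_pos (Real.rpow_nonneg (norm_nonneg _) _)
    (fun h => ?_) ?_
  · rw [Real.rpow_eq_zero (norm_nonneg _) hα.ne', norm_eq_zero] at h
    rw [h, lineInt_zero_dir, norm_zero]
  · rw [ENNReal.ofReal_one, one_mul, sigma]
    refine le_trans ?_ le_self_add
    refine le_trans ?_ (le_iSup₂ (f := fun s (_ : s ∈ Ioo (0 : ℝ) 1) =>
      grNormLt α (s ^ θ) (heat s A)) s hs)
    exact le_iSup₂_of_le x v (le_iSup₂_of_le hv hv' le_rfl)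

theorem norm_lineInt_quad_le {α θ γ δ : ℝ} (hγ : 0 < γ) {A : TDist (Conn 𝔤)}
    (hA : sigma α θ γ δ A < ⊤) {s : ℝ} (hs : s ∈ Ioo (0 : ℝ) 1) (x v : E3) (hv : ‖v‖ ≤ 1 / 4) :
    ‖lineInt (quad s A) x v‖ ≤ (sigma α θ γ δ A).toReal * s ^ (-δ) * ‖v‖ ^ γ := by
  have hp : 0 < s ^ δ := Real.rpow_pos_of_pos hs.1 _
  have h := norm_le_mul_of_ofReal_div_le (a := ‖lineInt (quad s A) x v‖) (b := ‖v‖ ^ γ) hA.ne hp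
    (Real.rpow_nonneg (norm_nonneg _) _)
    (fun h => by
      rw [Real.rpow_eq_zero (norm_nonneg _) hγ.ne', norm_eq_zero] at h
      rw [h, lineInt_zero_dir, norm_zero]) (by
    rw [sigma]
    refine le_trans ?_ le_add_self
    refine le_trans ?_ (le_iSup₂ (f := fun s (_ : s ∈ Ioo (0 : ℝ) 1) =>
      ENNReal.ofReal (s ^ δ) * grNorm γ (quad s A)) s hs)
    gcongr
    exact le_iSup₂_of_le x v (le_iSup_of_le hv le_rfl))
  rw [Real.rpow_neg hs.1.le]
  calc _ = (s ^ δ)⁻¹ * (s ^ δ * ‖lineInt (quad s A) x v‖) := by field_simp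
    _ ≤ (s ^ δ)⁻¹ * ((sigma α θ γ δ A).toReal * ‖v‖ ^ γ) := by gcongr
    _ = _ := by ring

theorem norm_lineInt_quadTerm_le {α θ γ δ : ℝ} (hγ : 0 < γ) {A : TDist (Conn 𝔤)}
    (hA : sigma α θ γ δ A < ⊤) {s : ℝ} (hs : s ∈ Ioo (0 : ℝ) 1) (x v : E3) (hv : ‖v‖ ≤ 1 / 4) :
    ‖lineInt (quadTerm (heat s A)) x v‖ ≤
      ‖quadL 𝔤‖ * (sigma α θ γ δ A).toReal * s ^ (-δ) * ‖v‖ ^ γ := by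
  have h1 : quadTerm (heat s A) = fun y => quadL 𝔤 (quad s A y) :=
    funext fun y => quadTerm_heat s A y
  rw [h1]
  refine (norm_lineInt_clm _ (continuous_quad hs A) x v).trans ?_
  rw [mul_assoc, mul_assoc, ← mul_assoc _ (s ^ (-δ))]
  gcongr
  exact norm_lineInt_quad_le hγ hA hs x v hv

theorem torusCont_quadTerm_heat (T : ℝ) (A : TDist (Conn 𝔤)) :
    TorusCont (Ioo 0 T) (fun r => quadTerm (heat r A)) :=
  ((smoothCurve_heat T A).torusCont.bilin (quadB 𝔤) (smoothCurve_heat T A).torusCont_fderiv)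

variable (𝔤) in
/-- The quadratic term of the heat flow is a weakly singular source. -/
theorem exists_source_quadTerm {γ δ : ℝ} (hγ : 0 < γ) (hγ1 : γ ≤ 1) :
    ∃ K, 0 < K ∧ ∀ (α θ : ℝ) (A : TDist (Conn 𝔤)), sigma α θ γ δ A < ⊤ →
      Source 0 1 ((1 - γ) / 2) δ (K * (sigma α θ γ δ A).toReal)
        (fun r => quadTerm (heat r A)) := by
  obtain ⟨C, hC0, hC⟩ := exists_norm_gauss_le_of_lineInt (F := Conn 𝔤) hγ hγ1
  refine ⟨C * (‖quadL 𝔤‖ + 1), by positivity, fun α θ A hA =>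
    { torusCont_quadTerm_heat 1 A with bound := fun r h x hr hh hrh => ?_ }⟩
  have hr1 : r ∈ Ioo (0 : ℝ) 1 := ⟨hr, by linarith⟩
  have htc := torusCont_quadTerm_heat 1 A
  refine (hC _ (htc.continuous hr1) (htc.per r hr1) _
    (fun x v hv => norm_lineInt_quadTerm_le hγ hA hr1 x v hv) h ⟨hh, by linarith⟩ x).trans ?_
  have h1 : (γ - 1) / 2 = -((1 - γ) / 2) := by ring
  have h2 := Real.rpow_nonneg hr.le (-δ)
  have h3 := Real.rpow_nonneg hh.le (-((1 - γ) / 2))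
  have h4 : 0 ≤ (sigma α θ γ δ A).toReal := ENNReal.toReal_nonneg
  rw [sub_zero, h1]
  calc _ ≤ C * ((‖quadL 𝔤‖ + 1) * (sigma α θ γ δ A).toReal * r ^ (-δ)) * h ^ (-((1 - γ) / 2)) := by
        gcongr
        linarith
    _ = _ := by ring

end Algebra

/-! ### A fixed point theorem -/

/-- Banach's fixed point theorem for the iterates of `0`. Functions matter only for times in `S`,
where the sup distance does not separate their extensions, so the uniform limit on `S` is taken
directly. -/
theorem exists_torusCont_fixedPoint {E : Type*} [NormedAddCommGroup E] [CompleteSpace E] {S : Set ℝ}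
    {ρ : ℝ} (hρ : 0 ≤ ρ) (Φ : (ℝ → E3 → E) → ℝ → E3 → E)
    (hΦ : ∀ y, TorusCont S y → (∀ t ∈ S, ∀ x, ‖y t x‖ ≤ ρ) →
      TorusCont S (Φ y) ∧ ∀ t ∈ S, ∀ x, ‖Φ y t x‖ ≤ ρ)
    (hlip : ∀ y y', TorusCont S y → (∀ t ∈ S, ∀ x, ‖y t x‖ ≤ ρ) →
      TorusCont S y' → (∀ t ∈ S, ∀ x, ‖y' t x‖ ≤ ρ) → ∀ D, 0 ≤ D →
      (∀ t ∈ S, ∀ x, ‖y t x - y' t x‖ ≤ D) → ∀ t ∈ S, ∀ x, ‖Φ y t x - Φ y' t x‖ ≤ D / 2) :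
    ∃ y, TorusCont S y ∧ (∀ t ∈ S, ∀ x, ‖y t x‖ ≤ ρ) ∧ ∀ t ∈ S, ∀ x, y t x = Φ y t x := by
  set Y : ℕ → ℝ → E3 → E := fun n => Φ^[n] (fun _ _ => 0) with hY
  have hsucc : ∀ n, Y (n + 1) = Φ (Y n) := fun n => Function.iterate_succ_apply' Φ n _
  have hcl : ∀ n, TorusCont S (Y n) ∧ ∀ t ∈ S, ∀ x, ‖Y n t x‖ ≤ ρ := by
    intro n
    induction n with
    | zero => exact ⟨⟨continuousOn_const, fun _ _ _ _ => rfl⟩, fun _ _ _ => by simpa [hY] using hρ⟩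
    | succ n ih =>
      rw [hsucc]
      exact hΦ _ ih.1 ih.2
  have hdist : ∀ n, ∀ t ∈ S, ∀ x, ‖Y n t x - Y (n + 1) t x‖ ≤ ρ * (1 / 2) ^ n := by
    intro n
    induction n with
    | zero => exact fun t ht x => by simpa [hY] using (hcl 1).2 t ht x
    | succ n ih =>
      intro t ht x
      have h := hlip _ _ (hcl n).1 (hcl n).2 (hcl (n + 1)).1 (hcl (n + 1)).2 _ (by positivity) ih t
        ht x
      rw [← hsucc, ← hsucc] at h
      exact h.trans (le_of_eq (by ring))
  have hlim : ∀ t ∈ S, ∀ x, ∃ l, Tendsto (fun n => Y n t x) atTop (𝓝 l) := fun t ht x =>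
    cauchySeq_tendsto_of_complete (cauchySeq_of_le_geometric (1 / 2) ρ (by norm_num) fun n => by
      rw [dist_eq_norm]
      exact hdist n t ht x)
  choose! y hy using hlim
  have hyd : ∀ n, ∀ t ∈ S, ∀ x, ‖Y n t x - y t x‖ ≤ 2 * ρ * (1 / 2) ^ n := fun n t ht x => by
    have h := dist_le_of_le_geometric_of_tendsto (1 / 2) ρ (by norm_num) (fun n => by
      rw [dist_eq_norm]
      exact hdist n t ht x) (hy t ht x) n
    rw [dist_eq_norm] at h
    exact h.trans (le_of_eq (by ring))
  have hpow : Tendsto (fun n : ℕ => 2 * ρ * (1 / 2 : ℝ) ^ n) atTop (𝓝 0) := by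
    simpa using (tendsto_pow_atTop_nhds_zero_of_lt_one (r := (1 / 2 : ℝ)) (by norm_num)
      (by norm_num)).const_mul (2 * ρ)
  have hyc : TorusCont S y := by
    refine ⟨?_, fun t ht x j => ?_⟩
    · refine TendstoUniformlyOn.continuousOn (F := fun n (z : ℝ × E3) => Y n z.1 z.2) (p := atTop) ?_
        (Frequently.of_forall fun n => (hcl n).1.cont)
      rw [Metric.tendstoUniformlyOn_iff]
      intro ε hε
      filter_upwards [hpow.eventually_lt_const hε] with n hn z hz
      rw [dist_comm, dist_eq_norm]
      exact (hyd n z.1 hz.1 z.2).trans_lt hn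
    · refine tendsto_nhds_unique (hy t ht _) ?_
      simp only [(hcl _).1.per t ht x j]
      exact hy t ht x
  have hyb : ∀ t ∈ S, ∀ x, ‖y t x‖ ≤ ρ := fun t ht x =>
    le_of_tendsto' (hy t ht x).norm fun n => (hcl n).2 t ht x
  refine ⟨y, hyc, hyb, fun t ht x => ?_⟩
  refine tendsto_nhds_unique ((tendsto_add_atTop_iff_nat 1).2 (hy t ht x)) ?_
  rw [tendsto_iff_norm_sub_tendsto_zero]
  refine squeeze_zero (fun _ => norm_nonneg _) (fun n => ?_) hpow
  rw [hsucc]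
  have h := hlip _ _ (hcl n).1 (hcl n).2 hyc hyb _ (by positivity) (hyd n) t ht x
  have : 0 ≤ 2 * ρ * (1 / 2 : ℝ) ^ n := by positivity
  linarith

/-! ### Estimates for the nonlinearity -/

/-- Conditions on the exponents under which the flow is well-posed. -/
structure Exponents (η μ ν : ℝ) : Prop where
  nu_pos : 0 < ν
  mu_mem : μ ∈ Ioo (-(1 / 2) : ℝ) 0
  le_mixed : ν ≤ η / 2 + μ / 2 + 1 / 2
  le_cubic : ν ≤ 1 + 3 * η / 2
  le_quad : ν ≤ μ + 1 / 2

section Nonlinearity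

variable {F : Type u} [NormedAddCommGroup F] [NormedSpace ℝ F]
  (B : F →L[ℝ] (E3 →L[ℝ] F) →L[ℝ] F) (C : F →L[ℝ] F →L[ℝ] F →L[ℝ] F)

theorem rpow_mul_rpow_le {r e₁ e₂ e : ℝ} (hr : 0 < r) (hr1 : r ≤ 1) (he : e ≤ e₁ + e₂) :
    r ^ e₁ * r ^ e₂ ≤ r ^ e := by
  rw [← Real.rpow_add hr]
  exact Real.rpow_le_rpow_of_exponent_ge hr hr1 he

theorem norm_bilin_le_rpow {G H : Type*} [NormedAddCommGroup G] [NormedSpace ℝ G]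
    [NormedAddCommGroup H] [NormedSpace ℝ H]
    (B : G →L[ℝ] H →L[ℝ] F) {r e₁ e₂ e a b : ℝ} (hr : 0 < r) (hr1 : r ≤ 1) (he : e ≤ e₁ + e₂)
    (ha : 0 ≤ a) (hb : 0 ≤ b) {u : G} {v : H} (hu : ‖u‖ ≤ a * r ^ e₁) (hv : ‖v‖ ≤ b * r ^ e₂) :
    ‖B u v‖ ≤ ‖B‖ * (a * b) * r ^ e := by
  have h1 := Real.rpow_nonneg hr.le e₁
  have h2 := Real.rpow_nonneg hr.le e₂
  calc ‖B u v‖ ≤ ‖B‖ * ‖u‖ * ‖v‖ := B.le_opNorm₂ u v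
    _ ≤ ‖B‖ * (a * r ^ e₁) * (b * r ^ e₂) := by gcongr
    _ = ‖B‖ * (a * b) * (r ^ e₁ * r ^ e₂) := by ring
    _ ≤ _ := by
      gcongr
      exact rpow_mul_rpow_le hr hr1 he

theorem norm_trilin_le_rpow {r e a b c : ℝ} (hr : 0 < r) (ha : 0 ≤ a) (hb : 0 ≤ b) (hc : 0 ≤ c)
    {u v w : F} (hu : ‖u‖ ≤ a * r ^ e) (hv : ‖v‖ ≤ b * r ^ e) (hw : ‖w‖ ≤ c * r ^ e) :
    ‖C u v w‖ ≤ ‖C‖ * (a * b * c) * r ^ (3 * e) := by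
  have h1 := Real.rpow_nonneg hr.le e
  calc ‖C u v w‖ ≤ ‖C u v‖ * ‖w‖ := (C u v).le_opNorm w
    _ ≤ ‖C‖ * ‖u‖ * ‖v‖ * ‖w‖ := by
      gcongr
      exact C.le_opNorm₂ u v
    _ ≤ ‖C‖ * (a * r ^ e) * (b * r ^ e) * (c * r ^ e) := by gcongr
    _ = ‖C‖ * (a * b * c) * (r ^ e * r ^ e * r ^ e) := by ring
    _ = _ := by
      rw [← Real.rpow_add hr, ← Real.rpow_add hr]
      ring_nf

/-- Pointwise form of the nonlinearity. -/
def nlin (u : F) (p : E3 →L[ℝ] F) : F := B u p + C u u u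

variable {B C} {η μ ν : ℝ}

/-- The product `B h p`, of size `r^{η-1/2}`, cancels in the difference. Every remaining quadratic
product has a factor measured with `μ`, so `le_mixed` and `le_quad` apply. -/
theorem Exponents.norm_nlin_sub_le (hE : Exponents η μ ν) {r a ρ D : ℝ} (hr : 0 < r) (hr1 : r ≤ 1)
    (ha : 0 ≤ a) (hρ : 0 ≤ ρ) (hD : 0 ≤ D) {h w w' : F} {p z z' : E3 →L[ℝ] F}
    (hh : ‖h‖ ≤ a * r ^ (η / 2)) (hp : ‖p‖ ≤ a * r ^ ((η - 1) / 2))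
    (hw : ‖w‖ ≤ ρ * r ^ (μ / 2)) (hw' : ‖w'‖ ≤ ρ * r ^ (μ / 2))
    (hz' : ‖z'‖ ≤ ρ * r ^ ((μ - 1) / 2))
    (hdw : ‖w - w'‖ ≤ D * r ^ (μ / 2)) (hdz : ‖z - z'‖ ≤ D * r ^ ((μ - 1) / 2)) :
    ‖nlin B C (h + w) (p + z) - nlin B C (h + w') (p + z')‖ ≤
      3 * (‖B‖ + ‖C‖) * ((a + ρ) + (a + ρ) ^ 2) * D * r ^ (ν - 1) := by
  -- For the cubic terms it suffices to use the worse of the two exponents for every factor: `3η/2`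
  -- is covered by `le_cubic`, and `3μ/2` by `le_quad`, as `μ > -1`.
  set κ := min η μ / 2 with hκ
  have hκη : κ ≤ η / 2 := by rw [hκ]; linarith [min_le_left η μ]
  have hκμ : κ ≤ μ / 2 := by rw [hκ]; linarith [min_le_right η μ]
  have hμ := hE.mu_mem
  have h3κ : ν - 1 ≤ 3 * κ := by
    rcases min_choice η μ with h | h <;> rw [hκ, h]
    · linarith [hE.le_cubic]
    · linarith [hE.le_quad, hμ.1]
  have hup : ∀ {u : F} {c e : ℝ}, 0 ≤ c → κ ≤ e → ‖u‖ ≤ c * r ^ e → ‖u‖ ≤ c * r ^ κ :=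
    fun hc he hu => hu.trans (mul_le_mul_of_nonneg_left
      (Real.rpow_le_rpow_of_exponent_ge hr hr1 he) hc)
  have hU : ‖h + w‖ ≤ (a + ρ) * r ^ κ := by
    rw [add_mul]
    exact (norm_add_le _ _).trans (add_le_add (hup ha hκη hh) (hup hρ hκμ hw))
  have hV : ‖h + w'‖ ≤ (a + ρ) * r ^ κ := by
    rw [add_mul]
    exact (norm_add_le _ _).trans (add_le_add (hup ha hκη hh) (hup hρ hκμ hw'))
  have hd := hup hD hκμ hdw
  have hσ : 0 ≤ a + ρ := add_nonneg ha hρ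
  have e1 : nlin B C (h + w) (p + z) - nlin B C (h + w') (p + z') =
      (B h (z - z') + B w (z - z') + (B (w - w') p + B (w - w') z')) +
      (C (w - w') (h + w) (h + w) + C (h + w') (w - w') (h + w) +
        C (h + w') (h + w') (w - w')) := by
    simp only [nlin, map_add, map_sub, add_apply, sub_apply]
    abel
  have hm := hE.le_mixed
  have hq := hE.le_quad
  have b1 := norm_bilin_le_rpow B hr hr1 (e := ν - 1) (by linarith) ha hD hh hdz
  have b2 := norm_bilin_le_rpow B hr hr1 (e := ν - 1) (by linarith) hρ hD hw hdz
  have b3 := norm_bilin_le_rpow B hr hr1 (e := ν - 1) (by linarith) hD ha hdw hp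
  have b4 := norm_bilin_le_rpow B hr hr1 (e := ν - 1) (by linarith) hD hρ hdw hz'
  have c1 := norm_trilin_le_rpow C hr hD hσ hσ hd hU hU
  have c2 := norm_trilin_le_rpow C hr hσ hD hσ hV hd hU
  have c3 := norm_trilin_le_rpow C hr hσ hσ hD hV hV hd
  have hr3 : r ^ (3 * κ) ≤ r ^ (ν - 1) := Real.rpow_le_rpow_of_exponent_ge hr hr1 h3κ
  have hrn := Real.rpow_nonneg hr.le (ν - 1)
  rw [e1]
  calc _ ≤ (‖B h (z - z')‖ + ‖B w (z - z')‖ + (‖B (w - w') p‖ + ‖B (w - w') z'‖)) +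
        (‖C (w - w') (h + w) (h + w)‖ + ‖C (h + w') (w - w') (h + w)‖ +
        ‖C (h + w') (h + w') (w - w')‖) :=
        (norm_add_le _ _).trans (add_le_add ((norm_add_le _ _).trans (add_le_add (norm_add_le _ _)
          (norm_add_le _ _))) ((norm_add_le _ _).trans (add_le_add (norm_add_le _ _) le_rfl)))
    _ ≤ 2 * ‖B‖ * (a + ρ) * D * r ^ (ν - 1) + 3 * ‖C‖ * (a + ρ) ^ 2 * D * r ^ (3 * κ) := by
        linarith
    _ ≤ 2 * ‖B‖ * (a + ρ) * D * r ^ (ν - 1) + 3 * ‖C‖ * (a + ρ) ^ 2 * D * r ^ (ν - 1) := by gcongr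
    _ = (2 * ‖B‖ * (a + ρ) + 3 * ‖C‖ * (a + ρ) ^ 2) * (D * r ^ (ν - 1)) := by ring
    _ ≤ (3 * (‖B‖ + ‖C‖) * ((a + ρ) + (a + ρ) ^ 2)) * (D * r ^ (ν - 1)) := by
        gcongr
        have h1 : 0 ≤ ‖B‖ * (a + ρ) := by positivity
        have h2 : 0 ≤ ‖B‖ * (a + ρ) ^ 2 := by positivity
        have h3 : 0 ≤ ‖C‖ * (a + ρ) := by positivity
        linarith
    _ = _ := by ring

/-- The difference estimate with `w' = 0`, plus the single leftover term `C h h h`, which `le_cubic`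
controls. -/
theorem Exponents.norm_nlin_sub_quad_le (hE : Exponents η μ ν) {r a ρ : ℝ} (hr : 0 < r)
    (hr1 : r ≤ 1) (ha : 0 ≤ a) (hρ : 0 ≤ ρ) {h w : F} {p z : E3 →L[ℝ] F}
    (hh : ‖h‖ ≤ a * r ^ (η / 2)) (hp : ‖p‖ ≤ a * r ^ ((η - 1) / 2))
    (hw : ‖w‖ ≤ ρ * r ^ (μ / 2)) (hz : ‖z‖ ≤ ρ * r ^ ((μ - 1) / 2)) :
    ‖nlin B C (h + w) (p + z) - B h p‖ ≤
      4 * (‖B‖ + ‖C‖) * ((a + ρ) ^ 2 + (a + ρ) ^ 3) * r ^ (ν - 1) := by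
  have h1 := hE.norm_nlin_sub_le (B := B) (C := C) hr hr1 ha hρ hρ (w' := 0) (z' := 0) (w := w)
    (z := z) hh hp hw (by rw [norm_zero]; positivity) (by rw [norm_zero]; positivity)
    (by rwa [sub_zero]) (by rwa [sub_zero])
  have h2 := norm_trilin_le_rpow C hr ha ha ha hh hh hh
  have h3 : r ^ (3 * (η / 2)) ≤ r ^ (ν - 1) :=
    Real.rpow_le_rpow_of_exponent_ge hr hr1 (by linarith [hE.le_cubic])
  have hrn := Real.rpow_nonneg hr.le (ν - 1)
  rw [add_zero, add_zero] at h1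
  have e1 : nlin B C (h + w) (p + z) - B h p =
      (nlin B C (h + w) (p + z) - nlin B C h p) + C h h h := by
    simp only [nlin]
    abel
  rw [e1]
  calc _ ≤ 3 * (‖B‖ + ‖C‖) * ((a + ρ) + (a + ρ) ^ 2) * ρ * r ^ (ν - 1) +
        ‖C‖ * (a * a * a) * r ^ (3 * (η / 2)) := (norm_add_le _ _).trans (add_le_add h1 h2)
    _ ≤ 3 * (‖B‖ + ‖C‖) * ((a + ρ) + (a + ρ) ^ 2) * (a + ρ) * r ^ (ν - 1) +
        ‖C‖ * ((a + ρ) * (a + ρ) * (a + ρ)) * r ^ (ν - 1) := by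
        gcongr <;> linarith
    _ = (3 * (‖B‖ + ‖C‖) * ((a + ρ) ^ 2 + (a + ρ) ^ 3) + ‖C‖ * (a + ρ) ^ 3) * r ^ (ν - 1) := by ring
    _ ≤ _ := by
        gcongr
        have hσ : 0 ≤ a + ρ := add_nonneg ha hρ
        have h1 : 0 ≤ ‖B‖ * (a + ρ) ^ 2 := by positivity
        have h2 : 0 ≤ ‖B‖ * (a + ρ) ^ 3 := by positivity
        have h3 : 0 ≤ ‖C‖ * (a + ρ) ^ 2 := by positivity
        linarith

theorem TorusCont.nlin {S : Set ℝ} {u : ℝ → E3 → F} {p : ℝ → E3 → E3 →L[ℝ] F} (hu : TorusCont S u)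
    (hp : TorusCont S p) : TorusCont S (fun t x => nlin B C (u t x) (p t x)) :=
  (hu.bilin B hp).add (TorusCont.bilin (ContinuousLinearMap.id ℝ (F →L[ℝ] F)) (hu.bilin C hu) hu)

end Nonlinearity

/-! ### Existence of mild solutions -/

section Existence

variable {F : Type u} [NormedAddCommGroup F] [NormedSpace ℝ F] [CompleteSpace F]

theorem Source.duh_sub {a T p q M p' q' M' : ℝ} {f g : ℝ → E3 → F} (hf : Source a T p q M f)
    (hg : Source a T p' q' M' g) (hp : p < 1) (hq : q < 1) (hp' : p' < 1) (hq' : q' < 1) {t : ℝ}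
    (ht : t ∈ Ioo a T) (x : E3) :
    duh a (fun t x => f t x - g t x) t x = duh a f t x - duh a g t x := by
  rw [duh, duh, duh, ← intervalIntegral.integral_sub
    (hf.kernel.intervalIntegrable hp hq ht.1 ht.2 x)
    (hg.kernel.intervalIntegrable hp' hq' ht.1 ht.2 x)]
  refine intervalIntegral.integral_congr_uIoo fun r hr => ?_
  rw [uIoo_of_le ht.1.le] at hr
  have hr' : r ∈ Ioo a T := ⟨hr.1, hr.2.trans ht.2⟩
  obtain ⟨N, -, hN⟩ := hf.exists_bound hr'
  obtain ⟨N', -, hN'⟩ := hg.exists_bound hr'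
  exact gauss_sub (hf.continuous hr') (hg.continuous hr') hN hN' x

theorem Source.duhGrad_sub {a T p q M p' q' M' : ℝ} {f g : ℝ → E3 → F} (hf : Source a T p q M f)
    (hg : Source a T p' q' M' g) (hp : p < 1 / 2) (hq : q < 1) (hp' : p' < 1 / 2) (hq' : q' < 1)
    {t : ℝ} (ht : t ∈ Ioo a T) (x : E3) :
    duhGrad a (fun t x => f t x - g t x) t x = duhGrad a f t x - duhGrad a g t x := by
  rw [duhGrad, duhGrad, duhGrad, ← intervalIntegral.integral_sub
    (hf.kernelGrad.intervalIntegrable (by linarith) hq ht.1 ht.2 x)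
    (hg.kernelGrad.intervalIntegrable (by linarith) hq' ht.1 ht.2 x)]
  refine intervalIntegral.integral_congr_uIoo fun r hr => ?_
  rw [uIoo_of_le ht.1.le] at hr
  have hr' : r ∈ Ioo a T := ⟨hr.1, hr.2.trans ht.2⟩
  obtain ⟨N, -, hN⟩ := hf.exists_bound hr'
  obtain ⟨N', -, hN'⟩ := hg.exists_bound hr'
  exact gaussGrad_sub (hf.continuous hr') (hg.continuous hr') hN hN' x

/-- The constant in the estimates for sources of size `r^{ν-1}`. -/
def duhConst (ν : ℝ) : ℝ := betaI 0 (1 - ν) + gmMean * betaI (1 / 2) (1 - ν)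

theorem duhConst_nonneg (ν : ℝ) : 0 ≤ duhConst ν :=
  add_nonneg (betaI_nonneg _ _) (mul_nonneg gmMean_nonneg (betaI_nonneg _ _))

theorem Source.norm_duh_le_rpow {T ν M : ℝ} {g : ℝ → E3 → F} (hν : 0 < ν) (hM : 0 ≤ M)
    (hg : Source 0 T 0 (1 - ν) M g) {t : ℝ} (ht : t ∈ Ioo 0 T) (x : E3) :
    ‖duh 0 g t x‖ ≤ duhConst ν * M * t ^ ν := by
  refine (hg.norm_duh_le zero_lt_one (by linarith) ht x).trans ?_
  have := Real.rpow_nonneg ht.1.le ν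
  rw [sub_zero, sub_zero, sub_sub_cancel]
  calc M * (t ^ ν * betaI 0 (1 - ν)) = betaI 0 (1 - ν) * M * t ^ ν := by ring
    _ ≤ _ := by
      gcongr
      exact le_add_of_nonneg_right (mul_nonneg gmMean_nonneg (betaI_nonneg _ _))

theorem Source.norm_duhGrad_le_rpow {T ν M : ℝ} {g : ℝ → E3 → F} (hν : 0 < ν) (hM : 0 ≤ M)
    (hg : Source 0 T 0 (1 - ν) M g) {t : ℝ} (ht : t ∈ Ioo 0 T) (x : E3) :
    ‖duhGrad 0 g t x‖ ≤ duhConst ν * M * t ^ (ν - 1 / 2) := by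
  refine (hg.norm_duhGrad_le (by norm_num) (by linarith) ht x).trans ?_
  have := Real.rpow_nonneg ht.1.le (ν - 1 / 2)
  rw [sub_zero, zero_add, Real.rpow_zero, mul_one, show 1 - 1 / 2 - (1 - ν) = ν - 1 / 2 by ring]
  calc gmMean * M * (t ^ (ν - 1 / 2) * betaI (1 / 2) (1 - ν)) =
        gmMean * betaI (1 / 2) (1 - ν) * M * t ^ (ν - 1 / 2) := by ring
    _ ≤ _ := by
      gcongr
      exact le_add_of_nonneg_left (betaI_nonneg _ _)

theorem TorusCont.rpow_smul {G : Type*} [NormedAddCommGroup G] [NormedSpace ℝ G] {T : ℝ}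
    {u : ℝ → E3 → G} (hu : TorusCont (Ioo 0 T) u) (e : ℝ) :
    TorusCont (Ioo 0 T) (fun t x => t ^ e • u t x) :=
  ⟨ContinuousOn.smul (continuousOn_fst.rpow_const fun z hz => Or.inl hz.1.1.ne') hu.cont,
    fun t ht x j => by simp only [hu.per t ht x j]⟩

theorem TorusCont.fst {G G' : Type*} [NormedAddCommGroup G] [NormedAddCommGroup G'] {S : Set ℝ}
    {u : ℝ → E3 → G × G'} (hu : TorusCont S u) : TorusCont S (fun t x => (u t x).1) :=
  ⟨hu.cont.fst, fun t ht x j => by simp only [hu.per t ht x j]⟩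

theorem TorusCont.snd {G G' : Type*} [NormedAddCommGroup G] [NormedAddCommGroup G'] {S : Set ℝ}
    {u : ℝ → E3 → G × G'} (hu : TorusCont S u) : TorusCont S (fun t x => (u t x).2) :=
  ⟨hu.cont.snd, fun t ht x j => by simp only [hu.per t ht x j]⟩

theorem TorusCont.prodMk {G G' : Type*} [NormedAddCommGroup G] [NormedAddCommGroup G'] {S : Set ℝ}
    {u : ℝ → E3 → G} {v : ℝ → E3 → G'} (hu : TorusCont S u) (hv : TorusCont S v) :
    TorusCont S (fun t x => (u t x, v t x)) :=
  ⟨hu.cont.prodMk hv.cont, fun t ht x j => by simp only [hu.per t ht x j, hv.per t ht x j]⟩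

/-- The part of the nonlinearity left after subtracting the quadratic term of `H`. -/
def remainder (B : F →L[ℝ] (E3 →L[ℝ] F) →L[ℝ] F) (C : F →L[ℝ] F →L[ℝ] F →L[ℝ] F)
    (H : ℝ → E3 → F) (P : ℝ → E3 → E3 →L[ℝ] F) (w : ℝ → E3 → F) (z : ℝ → E3 → E3 →L[ℝ] F)
    (t : ℝ) (x : E3) : F :=
  nlin B C (H t x + w t x) (P t x + z t x) - B (H t x) (P t x)

/-- `w` and its gradient `z` are treated as independent unknowns, so the contraction only involves
continuous functions; that `z` is the derivative of `w` follows afterwards from the two integral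
equations. Hypothesis `h1` keeps the ball of radius `ρ` invariant, and `h2` makes the map contract
by one half. -/
theorem exists_mild_solution {B : F →L[ℝ] (E3 →L[ℝ] F) →L[ℝ] F}
    {C : F →L[ℝ] F →L[ℝ] F →L[ℝ] F} {η μ ν : ℝ} (hE : Exponents η μ ν) {T a a₀ ρ : ℝ} (hT1 : T ≤ 1)
    (ha : 0 ≤ a) (hρ : 0 ≤ ρ)
    {H v : ℝ → E3 → F} {P v' : ℝ → E3 → E3 →L[ℝ] F} (hH : TorusCont (Ioo 0 T) H)
    (hP : TorusCont (Ioo 0 T) P) (hv : TorusCont (Ioo 0 T) v) (hv' : TorusCont (Ioo 0 T) v')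
    (hHb : ∀ t ∈ Ioo 0 T, ∀ x, ‖H t x‖ ≤ a * t ^ (η / 2))
    (hPb : ∀ t ∈ Ioo 0 T, ∀ x, ‖P t x‖ ≤ a * t ^ ((η - 1) / 2))
    (hvb : ∀ t ∈ Ioo 0 T, ∀ x, ‖v t x‖ ≤ a₀ * t ^ (μ / 2))
    (hvb' : ∀ t ∈ Ioo 0 T, ∀ x, ‖v' t x‖ ≤ a₀ * t ^ ((μ - 1) / 2))
    (h1 : a₀ + duhConst ν * (4 * (‖B‖ + ‖C‖) * ((a + ρ) ^ 2 + (a + ρ) ^ 3)) * T ^ ν ≤ ρ)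
    (h2 : duhConst ν * (3 * (‖B‖ + ‖C‖) * ((a + ρ) + (a + ρ) ^ 2)) * T ^ ν ≤ 1 / 2) :
    ∃ w z, TorusCont (Ioo 0 T) w ∧ TorusCont (Ioo 0 T) z ∧
      (∀ t ∈ Ioo 0 T, ∀ x, ‖w t x‖ ≤ ρ * t ^ (μ / 2)) ∧
      (∀ t ∈ Ioo 0 T, ∀ x, ‖z t x‖ ≤ ρ * t ^ ((μ - 1) / 2)) ∧
      Source 0 T 0 (1 - ν) (4 * (‖B‖ + ‖C‖) * ((a + ρ) ^ 2 + (a + ρ) ^ 3))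
        (remainder B C H P w z) ∧
      (∀ t ∈ Ioo 0 T, ∀ x, w t x = v t x + duh 0 (remainder B C H P w z) t x) ∧
      (∀ t ∈ Ioo 0 T, ∀ x, z t x = v' t x + duhGrad 0 (remainder B C H P w z) t x) := by
  have hν := hE.nu_pos
  have hμ := hE.mu_mem.2
  set S := Ioo 0 T with hS
  let w : (ℝ → E3 → F × (E3 →L[ℝ] F)) → ℝ → E3 → F := fun y t x => t ^ (μ / 2) • (y t x).1
  let z : (ℝ → E3 → F × (E3 →L[ℝ] F)) → ℝ → E3 → E3 →L[ℝ] F :=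
    fun y t x => t ^ ((μ - 1) / 2) • (y t x).2
  have hw : ∀ y, TorusCont S y → TorusCont S (w y) := fun y hy => hy.fst.rpow_smul _
  have hz : ∀ y, TorusCont S y → TorusCont S (z y) := fun y hy => hy.snd.rpow_smul _
  have hnorm : ∀ {G : Type u} [NormedAddCommGroup G] [NormedSpace ℝ G] {t : ℝ} (_ : t ∈ S) {e c : ℝ}
      {g : G}, ‖g‖ ≤ c → ‖t ^ e • g‖ ≤ c * t ^ e := by
    intro G _ _ t ht e c g hg
    rw [norm_smul, Real.norm_of_nonneg (Real.rpow_nonneg ht.1.le _), mul_comm]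
    exact mul_le_mul_of_nonneg_right hg (Real.rpow_nonneg ht.1.le _)
  have hfst : ∀ {q : F × (E3 →L[ℝ] F)} {c : ℝ}, ‖q‖ ≤ c → ‖q.1‖ ≤ c := fun h =>
    (norm_fst_le _).trans h
  have hsnd : ∀ {q : F × (E3 →L[ℝ] F)} {c : ℝ}, ‖q‖ ≤ c → ‖q.2‖ ≤ c := fun h =>
    (norm_snd_le _).trans h
  have hwd : ∀ y y' t x, w y t x - w y' t x = t ^ (μ / 2) • (y t x - y' t x).1 :=
    fun y y' t x => (smul_sub _ _ _).symm
  have hzd : ∀ y y' t x, z y t x - z y' t x = t ^ ((μ - 1) / 2) • (y t x - y' t x).2 :=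
    fun y y' t x => (smul_sub _ _ _).symm
  set M := 4 * (‖B‖ + ‖C‖) * ((a + ρ) ^ 2 + (a + ρ) ^ 3) with hM
  have hM0 : 0 ≤ M := by positivity
  have hR : ∀ y, TorusCont S y → TorusCont S (remainder B C H P (w y) (z y)) := fun y hy =>
    ((hH.add (hw y hy)).nlin (hP.add (hz y hy))).sub (hH.bilin B hP)
  have hsrc : ∀ y, TorusCont S y → (∀ t ∈ S, ∀ x, ‖y t x‖ ≤ ρ) →
      Source 0 T 0 (1 - ν) M (remainder B C H P (w y) (z y)) := by
    intro y hy hb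
    refine Source.of_norm_le (hR y hy) fun r hr x => ?_
    rw [sub_zero, neg_sub]
    exact hE.norm_nlin_sub_quad_le hr.1 (hr.2.le.trans hT1) ha hρ (hHb r hr x) (hPb r hr x)
      (hnorm hr (hfst (hb r hr x))) (hnorm hr (hsnd (hb r hr x)))
  -- The unknown `y` is the pair `(w, z)` divided by its weights, so the weighted norm becomes the
  -- sup norm.
  let Φ : (ℝ → E3 → F × (E3 →L[ℝ] F)) → ℝ → E3 → F × (E3 →L[ℝ] F) := fun y t x =>
    (t ^ (-(μ / 2)) • (v t x + duh 0 (remainder B C H P (w y) (z y)) t x),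
      t ^ (-((μ - 1) / 2)) • (v' t x + duhGrad 0 (remainder B C H P (w y) (z y)) t x))
  have hpw : ∀ {t : ℝ} (_ : t ∈ S) (e : ℝ), t ^ (-e) * t ^ e = 1 := fun ht e => by
    rw [← Real.rpow_add ht.1, neg_add_cancel, Real.rpow_zero]
  -- Since `μ < 0` and `t ≤ 1`, dividing by the weight only helps. The same power of `T` serves the
  -- gradient, whose bound and weight both lose `t^{1/2}`.
  have hpT : ∀ {t : ℝ} (_ : t ∈ S), t ^ (-(μ / 2)) * t ^ ν ≤ T ^ ν := fun {t} ht => by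
    rw [← Real.rpow_add ht.1]
    exact (Real.rpow_le_rpow_of_exponent_ge ht.1 (ht.2.le.trans hT1) (by linarith)).trans
      (Real.rpow_le_rpow ht.1.le ht.2.le hν.le)
  have hpT' : ∀ {t : ℝ} (_ : t ∈ S), t ^ (-((μ - 1) / 2)) * t ^ (ν - 1 / 2) ≤ T ^ ν :=
    fun {t} ht => by
      refine le_trans (le_of_eq ?_) (hpT ht)
      rw [← Real.rpow_add ht.1, ← Real.rpow_add ht.1]
      ring_nf
  have hsm : ∀ {G : Type u} [NormedAddCommGroup G] [NormedSpace ℝ G] {t : ℝ} (_ : t ∈ S) (e : ℝ)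
      {g : G} {N : ℝ}, ‖g‖ ≤ N → ‖t ^ e • g‖ ≤ t ^ e * N := by
    intro G _ _ t ht e g N hg
    rw [norm_smul, Real.norm_of_nonneg (Real.rpow_nonneg ht.1.le _)]
    exact mul_le_mul_of_nonneg_left hg (Real.rpow_nonneg ht.1.le _)
  have hkc := duhConst_nonneg ν
  have hΦ1 : ∀ y, TorusCont S y → (∀ t ∈ S, ∀ x, ‖y t x‖ ≤ ρ) →
      TorusCont S (Φ y) ∧ ∀ t ∈ S, ∀ x, ‖Φ y t x‖ ≤ ρ := by
    intro y hyc hyb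
    have hs := hsrc y hyc hyb
    refine ⟨((hv.add (hs.torusCont_duh zero_lt_one (by linarith))).rpow_smul _).prodMk
      ((hv'.add (hs.torusCont_duhGrad (by norm_num) (by linarith))).rpow_smul _), fun t ht x => ?_⟩
    refine norm_prod_le_iff.2 ⟨(hsm ht _ (norm_add_le_of_le (hvb t ht x)
      (hs.norm_duh_le_rpow hν hM0 ht x))).trans (le_trans ?_ h1),
      (hsm ht _ (norm_add_le_of_le (hvb' t ht x)
      (hs.norm_duhGrad_le_rpow hν hM0 ht x))).trans (le_trans ?_ h1)⟩
    · calc _ = a₀ * (t ^ (-(μ / 2)) * t ^ (μ / 2)) +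
            duhConst ν * M * (t ^ (-(μ / 2)) * t ^ ν) := by ring
        _ ≤ a₀ * 1 + duhConst ν * M * T ^ ν := by
          rw [hpw ht]
          gcongr
          exact hpT ht
        _ = _ := by ring
    · calc _ = a₀ * (t ^ (-((μ - 1) / 2)) * t ^ ((μ - 1) / 2)) +
            duhConst ν * M * (t ^ (-((μ - 1) / 2)) * t ^ (ν - 1 / 2)) := by ring
        _ ≤ a₀ * 1 + duhConst ν * M * T ^ ν := by
          rw [hpw ht]
          gcongr
          exact hpT' ht
        _ = _ := by ring
  have hΦ2 : ∀ y y', TorusCont S y → (∀ t ∈ S, ∀ x, ‖y t x‖ ≤ ρ) →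
      TorusCont S y' → (∀ t ∈ S, ∀ x, ‖y' t x‖ ≤ ρ) → ∀ D, 0 ≤ D →
      (∀ t ∈ S, ∀ x, ‖y t x - y' t x‖ ≤ D) → ∀ t ∈ S, ∀ x, ‖Φ y t x - Φ y' t x‖ ≤ D / 2 := by
    intro y y' hyc hyb hyc' hyb' D hD hd t ht x
    have hs := hsrc y hyc hyb
    have hs' := hsrc y' hyc' hyb'
    set M' := 3 * (‖B‖ + ‖C‖) * ((a + ρ) + (a + ρ) ^ 2) * D with hM'
    have hM0' : 0 ≤ M' := by positivity
    have hsd : Source 0 T 0 (1 - ν) M' (fun t x => remainder B C H P (w y) (z y) t x -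
        remainder B C H P (w y') (z y') t x) := by
      refine Source.of_norm_le ((hR y hyc).sub (hR y' hyc')) fun r hr x => ?_
      rw [sub_zero, neg_sub, remainder, remainder, sub_sub_sub_cancel_right]
      exact hE.norm_nlin_sub_le hr.1 (hr.2.le.trans hT1) ha hρ hD (hHb r hr x) (hPb r hr x)
        (hnorm hr (hfst (hyb r hr x))) (hnorm hr (hfst (hyb' r hr x)))
        (hnorm hr (hsnd (hyb' r hr x)))
        (by rw [hwd]; exact hnorm hr (hfst (hd r hr x)))
        (by rw [hzd]; exact hnorm hr (hsnd (hd r hr x)))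
    have e1 := hs.duh_sub hs' zero_lt_one (by linarith) zero_lt_one (by linarith) ht x
    have e2 := hs.duhGrad_sub hs' (by norm_num) (by linarith) (by norm_num) (by linarith) ht x
    have hfin : duhConst ν * M' * T ^ ν ≤ D / 2 := by
      calc _ = duhConst ν * (3 * (‖B‖ + ‖C‖) * ((a + ρ) + (a + ρ) ^ 2)) * T ^ ν * D := by
            rw [hM']; ring
        _ ≤ 1 / 2 * D := by gcongr
        _ = _ := by ring
    refine norm_prod_le_iff.2 ⟨?_, ?_⟩
    · simp only [Φ, Prod.fst_sub]
      rw [← smul_sub, add_sub_add_left_eq_sub, ← e1]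
      refine (hsm ht _ (hsd.norm_duh_le_rpow hν hM0' ht x)).trans (le_trans ?_ hfin)
      calc _ = duhConst ν * M' * (t ^ (-(μ / 2)) * t ^ ν) := by ring
        _ ≤ _ := by
          gcongr
          exact hpT ht
    · simp only [Φ, Prod.snd_sub]
      rw [← smul_sub, add_sub_add_left_eq_sub, ← e2]
      refine (hsm ht _ (hsd.norm_duhGrad_le_rpow hν hM0' ht x)).trans (le_trans ?_ hfin)
      calc _ = duhConst ν * M' * (t ^ (-((μ - 1) / 2)) * t ^ (ν - 1 / 2)) := by ring
        _ ≤ _ := by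
          gcongr
          exact hpT' ht
  obtain ⟨y, hyc, hyb, hy⟩ := exists_torusCont_fixedPoint (S := S) hρ Φ hΦ1 hΦ2
  refine ⟨w y, z y, hw y hyc, hz y hyc, fun t ht x => hnorm ht (hfst (hyb t ht x)),
    fun t ht x => hnorm ht (hsnd (hyb t ht x)), hsrc y hyc hyb, fun t ht x => ?_, fun t ht x => ?_⟩
  · change t ^ (μ / 2) • (y t x).1 = _
    rw [hy t ht x]
    simp only [Φ]
    rw [smul_smul, mul_comm, hpw ht, one_smul]
  · change t ^ ((μ - 1) / 2) • (y t x).2 = _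
    rw [hy t ht x]
    simp only [Φ]
    rw [smul_smul, mul_comm, hpw ht, one_smul]

end Existence

/-! ### Pairings with test functions -/

section Pairing

variable {F : Type u} [NormedAddCommGroup F] [NormedSpace ℝ F] [CompleteSpace F]

theorem integrable_cell_of_continuous {f : E3 → F} (hf : Continuous f) (hper : Periodic f) :
    Integrable f (volume.restrict cell) := by
  obtain ⟨M, -, hM⟩ := hper.exists_bound hf
  exact Integrable.of_bound (C := M) (aesm_of_continuous hf _) (Eventually.of_forall hM)

theorem norm_integral_cell_le {f : E3 → F} {M : ℝ} (hM : ∀ x, ‖f x‖ ≤ M) :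
    ‖∫ x in cell, f x‖ ≤ M * volume.real cell :=
  norm_setIntegral_le_of_norm_le_const volume_cell_lt_top fun x _ => hM x

/-- A continuous periodic function tested against a smooth one is controlled by the integrals of the
function along segments. -/
theorem exists_norm_pairing_le (φ : TestFn) : ∃ K, 0 ≤ K ∧ ∀ f : E3 → F, Continuous f → Periodic f →
    ∀ L, (∀ x v, ‖v‖ ≤ 1 / 4 → ‖lineInt f x v‖ ≤ L) →
    ‖∫ x in cell, (φ : E3 → ℝ) x • f x‖ ≤ K * L := by
  have hφ : ContDiff ℝ ∞ (φ : E3 → ℝ) := φ.2.1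
  have hφp : Periodic (φ : E3 → ℝ) := φ.2.2
  obtain ⟨M, hM0, hM⟩ := hφp.exists_bound hφ.continuous
  obtain ⟨M', hM0', hM'⟩ := hφp.fderiv.exists_bound (hφ.continuous_fderiv (by simp))
  set e : E3 := EuclideanSpace.single 0 1 with he
  have hne : ‖e‖ = 1 := by rw [he, PiLp.norm_single, norm_one]
  refine ⟨4 * ((M + M') * volume.real cell), by positivity, fun f hf hper L hL => ?_⟩
  have hL0 : 0 ≤ L := (norm_nonneg _).trans (hL 0 0 (by simp))
  have hG : ∀ x, ∀ τ ∈ Icc (0 : ℝ) (1 / 4), ‖∫ σ in (0 : ℝ)..τ, f (x + σ • e)‖ ≤ L := by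
    intro x τ hτ
    have h1 : lineInt f x (τ • e) = ∫ σ in (0 : ℝ)..τ, f (x + σ • e) := by
      rw [lineInt, norm_smul, hne, mul_one, Real.norm_of_nonneg hτ.1, intervalIntegral.integral_smul]
      simp_rw [smul_smul]
      rw [intervalIntegral.smul_integral_comp_mul_right (fun σ => f (x + σ • e))]
      simp
    rw [← h1]
    exact hL x _ (by rw [norm_smul, hne, mul_one, Real.norm_of_nonneg hτ.1]; exact hτ.2)
  -- Integration by parts along one coordinate direction: `f` is replaced by its primitive, which is
  -- a line integral, and the derivative falls on `φ`.
  have hparts : ∀ x, ‖∫ τ in (0 : ℝ)..(1 / 4), (φ : E3 → ℝ) (x + τ • e) • f (x + τ • e)‖ ≤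
      (M + M') * L := by
    intro x
    have hd1 : ∀ τ : ℝ, HasDerivAt (fun τ : ℝ => (φ : E3 → ℝ) (x + τ • e))
        (fderiv ℝ (φ : E3 → ℝ) (x + τ • e) e) τ := fun τ => by
      have := ((hφ.differentiable (by simp)) (x + τ • e)).hasFDerivAt.comp_hasDerivAt τ
        (((hasDerivAt_id τ).smul_const e).const_add x)
      rw [one_smul] at this
      exact this
    have hcf : Continuous fun σ : ℝ => f (x + σ • e) := by fun_prop
    have hd2 : ∀ τ : ℝ, HasDerivAt (fun τ => ∫ σ in (0 : ℝ)..τ, f (x + σ • e)) (f (x + τ • e)) τ :=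
      fun τ => intervalIntegral.integral_hasDerivAt_right (hcf.intervalIntegrable _ _)
        (hcf.stronglyMeasurableAtFilter _ _) hcf.continuousAt
    have hcG : Continuous fun τ : ℝ => ∫ σ in (0 : ℝ)..τ, f (x + σ • e) :=
      continuous_iff_continuousAt.2 fun τ => (hd2 τ).continuousAt
    have hcφ : Continuous fun τ : ℝ => (φ : E3 → ℝ) (x + τ • e) :=
      hφ.continuous.comp (by fun_prop)
    have hcφ' : Continuous fun τ : ℝ => fderiv ℝ (φ : E3 → ℝ) (x + τ • e) e :=
      ((hφ.continuous_fderiv (by simp)).comp (by fun_prop)).clm_apply continuous_const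
    have hi1 : IntervalIntegrable (fun τ : ℝ => (φ : E3 → ℝ) (x + τ • e) • f (x + τ • e))
        volume 0 (1 / 4) := (hcφ.smul hcf).intervalIntegrable _ _
    have hi2 : IntervalIntegrable (fun τ : ℝ => fderiv ℝ (φ : E3 → ℝ) (x + τ • e) e •
        ∫ σ in (0 : ℝ)..τ, f (x + σ • e)) volume 0 (1 / 4) :=
      (hcφ'.smul hcG).intervalIntegrable _ _
    have h1 := intervalIntegral.integral_eq_sub_of_hasDerivAt
      (fun τ _ => (hd1 τ).smul (hd2 τ)) (hi1.add hi2)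
    rw [intervalIntegral.integral_add hi1 hi2] at h1
    have hq : (1 / 4 : ℝ) ∈ Icc (0 : ℝ) (1 / 4) := ⟨by norm_num, le_rfl⟩
    rw [eq_sub_of_add_eq h1]
    simp only [Pi.smul_apply', intervalIntegral.integral_same, smul_zero, sub_zero]
    refine (norm_sub_le _ _).trans ?_
    rw [add_mul]
    refine add_le_add ?_ ?_
    · rw [norm_smul]
      exact mul_le_mul (hM _) (hG x _ hq) (norm_nonneg _) hM0
    · refine (intervalIntegral.norm_integral_le_of_norm_le_const (C := M' * L)
        fun τ hτ => ?_).trans ?_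
      · rw [uIoc_of_le (by norm_num)] at hτ
        rw [norm_smul]
        refine mul_le_mul ?_ (hG x τ ⟨hτ.1.le, hτ.2⟩) (norm_nonneg _) hM0'
        exact ((fderiv ℝ (φ : E3 → ℝ) (x + τ • e)).le_opNorm e).trans
          (by rw [hne, mul_one]; exact hM' _)
      · have : 0 ≤ M' * L := by positivity
        rw [sub_zero, abs_of_pos (by norm_num)]
        linarith
  have hψc : Continuous fun x => (φ : E3 → ℝ) x • f x := hφ.continuous.smul hf
  have hψp : Periodic fun x => (φ : E3 → ℝ) x • f x := fun x j => by simp only [hφp x j, hper x j]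
  obtain ⟨N, -, hN⟩ := hψp.exists_bound hψc
  -- Translation along `e` does not change the integral over the cell, so averaging over segments of
  -- length `1/4` costs only the factor `4`.
  have hswap : ∫ x in cell, (∫ τ in (0 : ℝ)..(1 / 4), (φ : E3 → ℝ) (x + τ • e) • f (x + τ • e)) =
      (1 / 4 : ℝ) • ∫ x in cell, (φ : E3 → ℝ) x • f x := by
    have h1 : ∀ τ : ℝ, ∫ x in cell, (φ : E3 → ℝ) (x + τ • e) • f (x + τ • e) =
        ∫ x in cell, (φ : E3 → ℝ) x • f x := fun τ => hψp.integral_cell_add (τ • e)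
    simp only [intervalIntegral.integral_of_le (show (0 : ℝ) ≤ 1 / 4 by norm_num)]
    rw [integral_integral_swap]
    · simp only [h1]
      rw [setIntegral_const]
      simp
    · refine Integrable.of_bound (C := N) ?_ (Eventually.of_forall fun z => hN _)
      exact (hψc.comp (f := fun z : E3 × ℝ => z.1 + z.2 • e) (by fun_prop)).aestronglyMeasurable
  have h4 : ∫ x in cell, (φ : E3 → ℝ) x • f x = (4 : ℝ) •
      ∫ x in cell, (∫ τ in (0 : ℝ)..(1 / 4), (φ : E3 → ℝ) (x + τ • e) • f (x + τ • e)) := by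
    rw [hswap, smul_smul]
    norm_num
  rw [h4, norm_smul, Real.norm_of_nonneg (by norm_num), mul_assoc]
  gcongr
  refine (norm_integral_cell_le hparts).trans (le_of_eq (by ring))

theorem SingularKernel.integral_smul_swap {a T p q M : ℝ} {k : ℝ → ℝ → E3 → F}
    (hk : SingularKernel a T p q M k) (hp : p < 1) (hq : q < 1) {t : ℝ} (hat : a < t) (ht : t < T)
    (φ : TestFn) : ∫ x in cell, (φ : E3 → ℝ) x • ∫ r in a..t, k t r x =
      ∫ r in a..t, ∫ x in cell, (φ : E3 → ℝ) x • k t r x := by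
  obtain ⟨N, hN0, hN⟩ := φ.2.2.exists_bound φ.2.1.continuous
  simp only [intervalIntegral.integral_of_le hat.le, integral_Ioc_eq_integral_Ioo, ← integral_smul]
  refine integral_integral_swap ?_
  have h1 := ((intervalIntegrable_singular hp hq hat).const_mul M)
  rw [intervalIntegrable_iff_integrableOn_Ioo_of_le hat.le] at h1
  have h2 := (integrable_const (μ := volume.restrict cell) N).mul_prod h1
  have hco : ContinuousOn (fun z : E3 × ℝ => (φ : E3 → ℝ) z.1 • k t z.2 z.1) (univ ×ˢ Ioo a t) :=
    (φ.2.1.continuous.comp continuous_fst).continuousOn.smul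
      (hk.cont.comp (f := fun z : E3 × ℝ => ((t, z.2), z.1)) (by fun_prop)
        fun z hz => ⟨⟨hz.2.1, hz.2.2, ht⟩, mem_univ _⟩)
  have hmu : (volume.restrict cell).prod (volume.restrict (Ioo a t)) =
      (((volume : Measure E3).restrict cell).prod (volume : Measure ℝ)).restrict
        (univ ×ˢ Ioo a t) := by
    rw [← Measure.prod_restrict, Measure.restrict_univ]
  refine Integrable.mono' h2 ?_ ?_
  · rw [hmu]
    exact hco.aestronglyMeasurable (MeasurableSet.univ.prod measurableSet_Ioo)
  · rw [hmu]
    refine (ae_restrict_iff' (MeasurableSet.univ.prod measurableSet_Ioo)).2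
      (Eventually.of_forall fun z hz => ?_)
    refine (norm_smul _ _).trans_le ?_
    exact mul_le_mul (hN _) (hk.bound t z.2 _ hz.2.1 hz.2.2 ht) (norm_nonneg _) hN0

/-- The Duhamel integral of a source that is controlled along segments tends to zero in the sense of
distributions. -/
theorem Source.tendsto_pairing_duh {T p δ M : ℝ} {f : ℝ → E3 → F} (hf : Source 0 T p δ M f)
    (hT : 0 < T) (hp : p < 1) (hδ : δ < 1) {L : ℝ}
    (hL : ∀ r ∈ Ioo 0 T, ∀ x v, ‖v‖ ≤ 1 / 4 → ‖lineInt (f r) x v‖ ≤ L * r ^ (-δ)) (φ : TestFn) :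
    Tendsto (fun t => ∫ x in cell, (φ : E3 → ℝ) x • duh 0 f t x) (𝓝[>] 0) (𝓝 0) := by
  obtain ⟨K, hK0, hK⟩ := exists_norm_pairing_le (F := F) φ
  -- The exponent `p` is absent: `P_{t-r}` does not increase line integrals, so the pairing has the
  -- integrable bound `r^{-δ}`. The sup norm, of order `t^{1-p-δ}`, need not tend to zero.
  have hlim : Tendsto (fun t : ℝ => K * L * ((t - 0) ^ (1 - 0 - δ) * betaI 0 δ)) (𝓝[>] 0) (𝓝 0) := by
    have h1 : Tendsto (fun t : ℝ => t ^ (1 - δ)) (𝓝 0) (𝓝 (0 ^ (1 - δ))) :=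
      (Real.continuousAt_rpow_const 0 (1 - δ) (Or.inr (by linarith))).tendsto
    rw [Real.zero_rpow (by linarith)] at h1
    have h2 := ((h1.mono_left (nhdsWithin_le_nhds (s := Ioi 0))).mul_const
      (betaI 0 δ)).const_mul (K * L)
    simpa using h2
  refine squeeze_zero_norm' ?_ hlim
  filter_upwards [Ioo_mem_nhdsGT hT] with t ht
  rw [← integral_singular ht.1, ← intervalIntegral.integral_const_mul]
  simp only [duh]
  rw [hf.kernel.integral_smul_swap hp hδ ht.1 ht.2 φ]
  refine intervalIntegral.norm_integral_le_of_norm_le ht.1.le ?_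
    ((intervalIntegrable_singular zero_lt_one hδ ht.1).const_mul _)
  have h1 : ∀ᵐ r : ℝ, r ≠ t := by simp [ae_iff]
  refine h1.mono fun r hr1 hr => ?_
  have hrt := lt_of_le_of_ne hr.2 hr1
  have hr' : r ∈ Ioo 0 T := ⟨hr.1, hrt.trans ht.2⟩
  obtain ⟨N, -, hN⟩ := hf.exists_bound hr'
  refine (hK _ (continuous_gauss (hf.continuous hr') hN) ((hf.per r hr').gauss _)
    (L * r ^ (-δ)) fun x v hv => norm_lineInt_gauss_le (hf.continuous hr') hN _
      (fun y => hL r hr' y v hv) x).trans (le_of_eq ?_)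
  rw [neg_zero, Real.rpow_zero, sub_zero]
  ring

theorem tendsto_pairing_of_norm_le {T e M : ℝ} (he : 0 < e) (hT : 0 < T) {u : ℝ → E3 → F}
    (hu : ∀ t ∈ Ioo 0 T, ∀ x, ‖u t x‖ ≤ M * t ^ e) (φ : TestFn) :
    Tendsto (fun t => ∫ x in cell, (φ : E3 → ℝ) x • u t x) (𝓝[>] 0) (𝓝 0) := by
  obtain ⟨N, hN0, hN⟩ := φ.2.2.exists_bound φ.2.1.continuous
  have hlim : Tendsto (fun t : ℝ => N * (M * t ^ e) * volume.real cell) (𝓝[>] 0) (𝓝 0) := by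
    have h1 : Tendsto (fun t : ℝ => t ^ e) (𝓝 0) (𝓝 (0 ^ e)) :=
      (Real.continuousAt_rpow_const 0 e (Or.inr he.le)).tendsto
    rw [Real.zero_rpow he.ne'] at h1
    have h2 := (((h1.mono_left (nhdsWithin_le_nhds (s := Ioi 0))).const_mul
      M).const_mul N).mul_const (volume.real cell)
    simpa using h2
  refine squeeze_zero_norm' ?_ hlim
  filter_upwards [Ioo_mem_nhdsGT hT] with t ht
  refine norm_integral_cell_le fun x => ?_
  rw [norm_smul]
  exact mul_le_mul (hN x) (hu t ht x) (norm_nonneg _) hN0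

theorem tendsto_pairing_heat (A : TDist F) (φ : TestFn) :
    Tendsto (fun t => ∫ x in cell, (φ : E3 → ℝ) x • heat t A x) (𝓝[>] 0) (𝓝 (A.toLin φ)) := by
  refine (tendsto_toLin_gaussTest A φ).congr' ?_
  filter_upwards [self_mem_nhdsWithin] with t ht
  exact toLin_gaussTest A φ ht

end Pairing

/-! ### Existence of the flow -/

/-- Solutions of `∂_t U = Δ U + B(U, ∂U) + C(U, U, U)` on `(0, T)` with initial value `A`. -/
structure IsFlow {F : Type u} [NormedAddCommGroup F] [NormedSpace ℝ F]
    (B : F →L[ℝ] (E3 →L[ℝ] F) →L[ℝ] F) (C : F →L[ℝ] F →L[ℝ] F →L[ℝ] F) (μ : ℝ) (A : TDist F) (T : ℝ)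
    (U : ℝ → E3 → F) : Prop extends SmoothCurve T U where
  equation : ∀ t ∈ Ioo 0 T, ∀ x, HasDerivAt (fun r => U r x)
    (Laplacian.laplacian (U t) x + nonlin B C U t x) t
  initial : ∀ φ : TestFn, Tendsto (fun t => ∫ x in cell, (φ : E3 → ℝ) x • U t x)
    (𝓝[>] 0) (𝓝 (A.toLin φ))
  wellposed : ∃ K : ℝ, ∀ᶠ t in 𝓝[>] (0 : ℝ), ∀ x,
    ‖U t x - heat t A x‖ ≤ K * t ^ (μ / 2) ∧
    ‖fderiv ℝ (fun y => U t y - heat t A y) x‖ ≤ K * t ^ ((μ - 1) / 2)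

section Flow

variable {F : Type u} [NormedAddCommGroup F] [NormedSpace ℝ F] [CompleteSpace F]
  {B : F →L[ℝ] (E3 →L[ℝ] F) →L[ℝ] F} {C : F →L[ℝ] F →L[ℝ] F →L[ℝ] F}

/-- The quadratic term of the heat flow of `A`. -/
def quadHeat (B : F →L[ℝ] (E3 →L[ℝ] F) →L[ℝ] F) (A : TDist F) (t : ℝ) (x : E3) : F :=
  B (heat t A x) (fderiv ℝ (heat t A) x)

theorem TorusCont.duh_sub {T : ℝ} {f g : ℝ → E3 → F} (hf : TorusCont (Ioo 0 T) f)
    (hg : TorusCont (Ioo 0 T) g) {a t : ℝ} (ha : 0 < a) (hat : a < t) (ht : t < T) (x : E3) :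
    duh a (fun t x => f t x - g t x) t x = duh a f t x - duh a g t x := by
  obtain ⟨b, htb, hb⟩ := exists_between ht
  obtain ⟨M, -, -, hs⟩ := hf.source (Icc_subset_Ioo_zero ha hb)
  obtain ⟨M', -, -, hs'⟩ := hg.source (Icc_subset_Ioo_zero ha hb)
  exact hs.duh_sub hs' (by norm_num) (by norm_num) (by norm_num) (by norm_num) ⟨hat, htb⟩ x

/-- The flow is the heat flow plus the fixed point `w` of `exists_mild_solution`; the remainder is
the Duhamel integral of `g`. Bootstrapping makes it smooth and hence classical. -/
theorem exists_flow {η μ ν : ℝ} (hE : Exponents η μ ν) (A : TDist F)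
    {T a a₀ ρ p δ MQ LQ : ℝ} (hT : 0 < T) (hT1 : T ≤ 1) (ha : 0 ≤ a) (hρ : 0 ≤ ρ)
    (hHb : ∀ t ∈ Ioo 0 T, ∀ x, ‖heat t A x‖ ≤ a * t ^ (η / 2))
    (hPb : ∀ t ∈ Ioo 0 T, ∀ x, ‖fderiv ℝ (heat t A) x‖ ≤ a * t ^ ((η - 1) / 2))
    (hQ : Source 0 T p δ MQ (quadHeat B A)) (hp : p < 1 / 2) (hδ : δ < 1)
    (hQL : ∀ r ∈ Ioo 0 T, ∀ x v, ‖v‖ ≤ 1 / 4 → ‖lineInt (quadHeat B A r) x v‖ ≤ LQ * r ^ (-δ))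
    (hvb : ∀ t ∈ Ioo 0 T, ∀ x, ‖duh 0 (quadHeat B A) t x‖ ≤ a₀ * t ^ (μ / 2))
    (hvb' : ∀ t ∈ Ioo 0 T, ∀ x, ‖duhGrad 0 (quadHeat B A) t x‖ ≤ a₀ * t ^ ((μ - 1) / 2))
    (h1 : a₀ + duhConst ν * (4 * (‖B‖ + ‖C‖) * ((a + ρ) ^ 2 + (a + ρ) ^ 3)) * T ^ ν ≤ ρ)
    (h2 : duhConst ν * (3 * (‖B‖ + ‖C‖) * ((a + ρ) + (a + ρ) ^ 2)) * T ^ ν ≤ 1 / 2) :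
    ∃ U, IsFlow B C μ A T U ∧ ∀ t ∈ Ioo 0 T, ∀ x,
      ‖U t x - (heat t A x + duh 0 (quadHeat B A) t x)‖ ≤
        duhConst ν * (4 * (‖B‖ + ‖C‖) * ((a + ρ) ^ 2 + (a + ρ) ^ 3)) * t ^ ν := by
  have hν := hE.nu_pos
  have hH := smoothCurve_heat T A
  have hHc := hH.torusCont
  have hPc := hH.torusCont_fderiv
  obtain ⟨w, z, hw, hz, hwb, hzb, hg, hweq, hzeq⟩ := exists_mild_solution hE hT1 ha hρ hHc hPc
    (hQ.torusCont_duh (by linarith) hδ) (hQ.torusCont_duhGrad hp hδ) hHb hPb hvb hvb' h1 h2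
  set g := remainder B C (fun t => heat t A) (fun t => fderiv ℝ (heat t A)) w z with hgdef
  set M := 4 * (‖B‖ + ‖C‖) * ((a + ρ) ^ 2 + (a + ρ) ^ 3) with hM
  have hM0 : 0 ≤ M := by positivity
  -- Here the auxiliary unknown `z` is identified with the derivative of `w`.
  have hwd : ∀ t ∈ Ioo 0 T, ∀ x, HasFDerivAt (w t) (z t x) x := by
    intro t ht x
    rw [funext (hweq t ht), hzeq t ht x]
    exact (hQ.hasFDerivAt_duh hp hδ ht x).add (hg.hasFDerivAt_duh (by norm_num) (by linarith) ht x)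
  set U : ℝ → E3 → F := fun t x => heat t A x + w t x with hU
  have hUc : TorusCont (Ioo 0 T) U := hHc.add hw
  have hHd : ∀ t ∈ Ioo 0 T, Differentiable ℝ (heat t A) := fun t ht =>
    (hH.smooth t ht).differentiable (by simp)
  have hUd : ∀ t ∈ Ioo 0 T, ∀ x, HasFDerivAt (U t) (fderiv ℝ (heat t A) x + z t x) x :=
    fun t ht x => (hHd t ht x).hasFDerivAt.add (hwd t ht x)
  have hUd' : TorusCont (Ioo 0 T) (fun t => fderiv ℝ (U t)) :=
    (hPc.add hz).congr fun t ht x => (hUd t ht x).fderiv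
  have hNeq : ∀ t ∈ Ioo 0 T, ∀ x, nonlin B C U t x - quadHeat B A t x = g t x := by
    intro t ht x
    rw [nonlin, (hUd t ht x).fderiv]
    rfl
  have hreg : Reg false T 1 U := ⟨hUc, fun t ht x => (hUd t ht x).differentiableAt, hUd', by simp⟩
  have hNc : TorusCont (Ioo 0 T) (nonlin B C U) := hreg.nonlin.torusCont
  -- Down to time `0` the sources `quadHeat` and `g` obey different kinds of bounds. After a restart
  -- at `b > 0` both are bounded, and they recombine into the full nonlinearity.
  have hmild : Mild T U (nonlin B C U) := by
    intro b t hb hbt ht x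
    have hbT : b ∈ Ioo 0 T := ⟨hb, hbt.trans ht⟩
    have htT : t ∈ Ioo 0 T := ⟨hb.trans hbt, ht⟩
    have e1 : duh b g t x = duh b (nonlin B C U) t x - duh b (quadHeat B A) t x := by
      rw [← hNc.duh_sub hQ.toTorusCont hb hbt ht x]
      refine intervalIntegral.integral_congr_uIoo fun r hr => ?_
      rw [uIoo_of_le hbt.le] at hr
      simp only
      rw [funext (hNeq r ⟨hb.trans hr.1, hr.2.trans ht⟩)]
    obtain ⟨N₁, -, hN₁⟩ := hHc.exists_bound hbT
    obtain ⟨N₂, -, hN₂⟩ := hw.exists_bound hbT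
    obtain ⟨N₃, -, hN₃⟩ := (hQ.torusCont_duh (by linarith) hδ).exists_bound hbT
    obtain ⟨N₄, -, hN₄⟩ := (hg.torusCont_duh (by linarith) (by linarith)).exists_bound hbT
    have hadd : ∀ {f₁ f₂ : E3 → F} {N N' : ℝ}, Continuous f₁ → Continuous f₂ → (∀ x, ‖f₁ x‖ ≤ N) →
        (∀ x, ‖f₂ x‖ ≤ N') → gauss (t - b) (fun y => f₁ y + f₂ y) x =
          gauss (t - b) f₁ x + gauss (t - b) f₂ x := fun h₁ h₂ hN hN' =>
      integral_add (integrable_comp_gm h₁ hN x _) (integrable_comp_gm h₂ hN' x _)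
    have e2 : gauss (t - b) (U b) x = heat t A x + (gauss (t - b) (duh 0 (quadHeat B A) b) x +
        gauss (t - b) (duh 0 g b) x) := by
      rw [hU, hadd (hHc.continuous hbT) (hw.continuous hbT) hN₁ hN₂,
        gauss_heat hb (sub_nonneg.2 hbt.le), add_sub_cancel, funext (hweq b hbT),
        hadd ((hQ.torusCont_duh (by linarith) hδ).continuous hbT)
          ((hg.torusCont_duh (by linarith) (by linarith)).continuous hbT) hN₃ hN₄]
    rw [e2]
    simp only [hU]
    rw [hweq t htT x, hQ.duh_restart (by linarith) hδ hb hbt ht x,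
      hg.duh_restart (by linarith) (by linarith) hb hbt ht x, e1]
    abel
  have hsm : SmoothCurve T U := smoothCurve_of_reg (hmild.reg_nonlin hreg)
  refine ⟨U, { hsm with
    equation := hmild.hasDerivAt hsm hNc
    initial := fun φ => ?_
    wellposed := ⟨ρ, ?_⟩ }, fun t ht x => ?_⟩
  · have hφ := φ.2.1.continuous
    have h3 := hQ.tendsto_pairing_duh hT (by linarith) hδ hQL φ
    have h4 := tendsto_pairing_of_norm_le hν hT
      (fun t ht x => hg.norm_duh_le_rpow hν hM0 ht x) φ
    have h5 := (tendsto_pairing_heat A φ).add (h3.add h4)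
    rw [add_zero, add_zero] at h5
    refine h5.congr' ?_
    filter_upwards [Ioo_mem_nhdsGT hT] with t ht
    have hi : ∀ {u : ℝ → E3 → F}, TorusCont (Ioo 0 T) u →
        Integrable (fun x => (φ : E3 → ℝ) x • u t x) (volume.restrict cell) := fun hu =>
      integrable_cell_of_continuous (hφ.smul (hu.continuous ht)) fun x j => by
        simp only [φ.2.2 x j, hu.per t ht x j]
    have hi2 := hi (hQ.torusCont_duh (by linarith) hδ)
    have hi3 := hi (hg.torusCont_duh (by linarith) (by linarith))
    have hi4 : Integrable (fun x => (φ : E3 → ℝ) x • duh 0 (quadHeat B A) t x +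
        (φ : E3 → ℝ) x • duh 0 g t x) (volume.restrict cell) := hi2.add hi3
    rw [← integral_add hi2 hi3, ← integral_add (hi hHc) hi4]
    congr 1
    funext x
    simp only [hU]
    rw [hweq t ht x, smul_add, smul_add]
  · filter_upwards [Ioo_mem_nhdsGT hT] with t ht x
    have e1 : (fun y => U t y - heat t A y) = w t := funext fun y => add_sub_cancel_left _ _
    rw [e1, (hwd t ht x).fderiv]
    refine ⟨?_, hzb t ht x⟩
    simp only [hU, add_sub_cancel_left]
    exact hwb t ht x
  · simp only [hU]
    rw [hweq t ht x, ← add_assoc, add_sub_cancel_left]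
    exact hg.norm_duh_le_rpow hν hM0 ht x

end Flow

/-! ### Uniqueness of the flow -/

section Uniqueness

variable {F : Type u} [NormedAddCommGroup F] [NormedSpace ℝ F] [CompleteSpace F]
  {B : F →L[ℝ] (E3 →L[ℝ] F) →L[ℝ] F} {C : F →L[ℝ] F →L[ℝ] F →L[ℝ] F}
  {η μ ν T : ℝ} {A : TDist F} {U V : ℝ → E3 → F}

/-- Near `0` the bound is assumed. Away from `0` compactness gives a constant, and the weight is at
least one because `e ≤ 0` and `t ≤ 1`. -/
theorem TorusCont.exists_weighted_bound {G : Type*} [NormedAddCommGroup G] {u : ℝ → E3 → G}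
    (hu : TorusCont (Ioo 0 T) u) {e K : ℝ} (he : e ≤ 0)
    (hK : ∀ᶠ t in 𝓝[>] (0 : ℝ), ∀ x, ‖u t x‖ ≤ K * t ^ e) {T' : ℝ} (hT' : T' < T) (hT1 : T' ≤ 1) :
    ∃ N, 0 ≤ N ∧ ∀ t ∈ Ioc 0 T', ∀ x, ‖u t x‖ ≤ N * t ^ e := by
  obtain ⟨ε, hε, hεK⟩ := mem_nhdsGT_iff_exists_Ioo_subset.1 hK
  have hε0 : 0 < ε := hε
  obtain ⟨M, hM0, hM⟩ := hu.exists_bound_Icc (Icc_subset_Ioo_zero (half_pos hε0) hT')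
  refine ⟨max |K| M, le_max_of_le_right hM0, fun t ht x => ?_⟩
  have hte := Real.rpow_nonneg ht.1.le e
  rcases lt_or_ge t ε with h | h
  · refine (hεK ⟨ht.1, h⟩ x).trans (mul_le_mul_of_nonneg_right ?_ hte)
    exact (le_abs_self K).trans (le_max_left _ _)
  · have h1 : 1 ≤ t ^ e := Real.one_le_rpow_of_pos_of_le_one_of_nonpos ht.1 (ht.2.trans hT1) he
    calc ‖u t x‖ ≤ M := hM t ⟨by linarith, ht.2⟩ x
      _ ≤ max |K| M := le_max_right _ _
      _ ≤ _ := le_mul_of_one_le_right (le_max_of_le_right hM0) h1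

theorem IsFlow.mild (hU : IsFlow B C μ A T U) : Mild T U (nonlin B C U) :=
  hU.toSmoothCurve.mild hU.torusCont_nonlin hU.equation

theorem IsFlow.exists_bound (hU : IsFlow B C μ A T U) (hT : 0 < T) (hμ : μ < 0) {T' : ℝ}
    (hT' : T' < T) (hT1 : T' ≤ 1) : ∃ N, 0 ≤ N ∧ ∀ t ∈ Ioc 0 T', ∀ x, ‖U t x - heat t A x‖ ≤ N * t ^ (μ / 2) ∧
      ‖fderiv ℝ (U t) x - fderiv ℝ (heat t A) x‖ ≤ N * t ^ ((μ - 1) / 2) := by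
  obtain ⟨K, hK⟩ := hU.wellposed
  have hH := smoothCurve_heat T A
  obtain ⟨N₁, hN₁0, hN₁⟩ := (hU.torusCont.sub hH.torusCont).exists_weighted_bound
    (e := μ / 2) (K := K) (by linarith) (hK.mono fun t h x => (h x).1) hT' hT1
  obtain ⟨N₂, hN₂0, hN₂⟩ := (hU.torusCont_fderiv.sub hH.torusCont_fderiv).exists_weighted_bound
    (e := (μ - 1) / 2) (K := K) (by linarith) (by
      filter_upwards [hK, Ioo_mem_nhdsGT hT] with t h ht x
      have h2 := (h x).2
      rwa [fderiv_fun_sub (((hU.smooth t ht).differentiable (by simp)) x)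
        (((hH.smooth t ht).differentiable (by simp)) x)] at h2) hT' hT1
  refine ⟨max N₁ N₂, le_max_of_le_left hN₁0, fun t ht x => ⟨(hN₁ t ht x).trans ?_,
    (hN₂ t ht x).trans ?_⟩⟩
  · exact mul_le_mul_of_nonneg_right (le_max_left _ _) (Real.rpow_nonneg ht.1.le _)
  · exact mul_le_mul_of_nonneg_right (le_max_right _ _) (Real.rpow_nonneg ht.1.le _)

/-- With `y = l (t - r)` this trades the decay of an exponential weight for a small factor `l^{-ε}`
and a slightly stronger singularity. -/
theorem exp_neg_le_rpow {y ε : ℝ} (hy : 0 < y) (hε : 0 ≤ ε) (hε1 : ε ≤ 1) :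
    Real.exp (-y) ≤ y ^ (-ε) := by
  rw [Real.exp_neg, Real.rpow_neg hy.le]
  refine inv_anti₀ (Real.rpow_pos_of_pos hy _) ?_
  rcases le_total y 1 with h | h
  · exact (Real.rpow_le_one hy.le h hε).trans (Real.one_le_exp hy.le)
  · calc y ^ ε ≤ y ^ (1 : ℝ) := Real.rpow_le_rpow_of_exponent_le h hε1
      _ = y := Real.rpow_one y
      _ ≤ Real.exp y := by linarith [Real.add_one_le_exp y]

/-- The difference of two flows is the Duhamel integral of the difference of the nonlinearities. -/
theorem IsFlow.sub_eq_duh (hμ : μ ∈ Ioo (-1 : ℝ) 0) (hν : 0 < ν) (hU : IsFlow B C μ A T U)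
    (hV : IsFlow B C μ A T V) {T' M N : ℝ} (hT' : T' ≤ T)
    (hs : Source 0 T' 0 (1 - ν) M (fun t x => nonlin B C U t x - nonlin B C V t x))
    (hM : 0 ≤ M) (hN : ∀ t ∈ Ioo 0 T', ∀ x, ‖U t x - V t x‖ ≤ N * t ^ (μ / 2)) :
    ∀ t ∈ Ioo 0 T', ∀ x, U t x - V t x =
      duh 0 (fun t x => nonlin B C U t x - nonlin B C V t x) t x := by
  intro t ht x
  set f := fun t x => nonlin B C U t x - nonlin B C V t x with hf
  have htT : t ∈ Ioo 0 T := ⟨ht.1, ht.2.trans_le hT'⟩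
  have hd := hU.torusCont.sub hV.torusCont
  have hDc := hs.torusCont_duh zero_lt_one (by linarith)
  have hev : ∀ᶠ a in 𝓝[>] (0 : ℝ), a ∈ Ioo 0 (t / 2) := Ioo_mem_nhdsGT (half_pos ht.1)
  have hmem : ∀ {a : ℝ}, a ∈ Ioo 0 (t / 2) → a ∈ Ioo 0 T' := fun ha =>
    ⟨ha.1, by linarith [ha.2, ht.1, ht.2]⟩
  have hmemT : ∀ {a : ℝ}, a ∈ Ioo 0 (t / 2) → a ∈ Ioo 0 T := fun ha =>
    ⟨(hmem ha).1, (hmem ha).2.trans_le hT'⟩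
  -- The left side does not depend on `a`, so it vanishes once the right side tends to zero as `a →
  -- 0`.
  have key : ∀ a ∈ Ioo 0 (t / 2), U t x - V t x - duh 0 f t x =
      gauss (t - a) (fun y => U a y - V a y) x - gauss (t - a) (duh 0 f a) x := by
    intro a ha
    have hat : a < t := by linarith [ha.2, ht.1]
    obtain ⟨N₁, -, hN₁⟩ := hU.torusCont.exists_bound (hmemT ha)
    obtain ⟨N₂, -, hN₂⟩ := hV.torusCont.exists_bound (hmemT ha)
    rw [hU.mild a t ha.1 hat htT.2 x, hV.mild a t ha.1 hat htT.2 x,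
      hs.duh_restart zero_lt_one (by linarith) ha.1 hat ht.2 x,
      gauss_sub (hU.torusCont.continuous (hmemT ha)) (hV.torusCont.continuous (hmemT ha)) hN₁ hN₂,
      hf, hU.torusCont_nonlin.duh_sub hV.torusCont_nonlin ha.1 hat htT.2 x]
    abel
  have l1 : Tendsto (fun a => gauss (t - a) (duh 0 f a) x) (𝓝[>] 0) (𝓝 0) := by
    have h1 : Tendsto (fun t : ℝ => duhConst ν * M * t ^ ν) (𝓝[>] 0) (𝓝 0) := by
      have h1 : Tendsto (fun t : ℝ => t ^ ν) (𝓝 0) (𝓝 (0 ^ ν)) :=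
        (Real.continuousAt_rpow_const 0 ν (Or.inr hν.le)).tendsto
      rw [Real.zero_rpow hν.ne'] at h1
      simpa using (h1.mono_left (nhdsWithin_le_nhds (s := Ioi 0))).const_mul (duhConst ν * M)
    refine squeeze_zero_norm' ?_ h1
    filter_upwards [hev] with a ha
    exact norm_gauss_le (fun y => hs.norm_duh_le_rpow hν hM (hmem ha) y) x
  -- With the time frozen at `t` this is a pairing with the fixed test function `p_t(x - ·)`, and
  -- both solutions have the same distributional initial value.
  have l2 : Tendsto (fun a => gauss t (fun y => U a y - V a y) x) (𝓝[>] 0) (𝓝 0) := by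
    have h1 := (hU.initial (heatTest t x)).sub (hV.initial (heatTest t x))
    rw [sub_self] at h1
    refine h1.congr' ?_
    filter_upwards [hev] with a ha
    have hi : ∀ {u : ℝ → E3 → F}, TorusCont (Ioo 0 T) u → Integrable
        (fun y => ((heatTest t x : TestFn) : E3 → ℝ) y • u a y) (volume.restrict cell) := fun hu =>
      integrable_cell_of_continuous ((heatTest t x).2.1.continuous.smul
        (hu.continuous (hmemT ha))) fun y j => by
          simp only [(heatTest t x).2.2 y j, hu.per a (hmemT ha) y j]
    rw [← heatFn_eq_gauss ht.1 (hd.continuous (hmemT ha)) (hd.per a (hmemT ha)), heatFn,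
      ← integral_sub (hi hU.torusCont) (hi hV.torusCont)]
    congr 1
    funext y
    rw [smul_sub]
    rfl
  -- Exchanging `P_{t-a}` for `P_t` costs `√a` times the size `a^{μ/2}` of the difference, and `μ >
  -- -1`.
  have l3 : Tendsto (fun a => gauss t (fun y => U a y - V a y) x -
      gauss (t - a) (fun y => U a y - V a y) x) (𝓝[>] 0) (𝓝 0) := by
    have h1 : Tendsto (fun a : ℝ => (√t)⁻¹ * (gmMean * N) * √2 * gmMean * a ^ (1 / 2 + μ / 2))
        (𝓝[>] 0) (𝓝 0) := by
      have he : 0 < 1 / 2 + μ / 2 := by linarith [hμ.1]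
      have h1 : Tendsto (fun t : ℝ => t ^ (1 / 2 + μ / 2)) (𝓝 0) (𝓝 (0 ^ (1 / 2 + μ / 2))) :=
        (Real.continuousAt_rpow_const 0 _ (Or.inr he.le)).tendsto
      rw [Real.zero_rpow he.ne'] at h1
      simpa using (h1.mono_left (nhdsWithin_le_nhds (s := Ioi 0))).const_mul
        ((√t)⁻¹ * (gmMean * N) * √2 * gmMean)
    refine squeeze_zero_norm' ?_ h1
    filter_upwards [hev] with a ha
    have hda := hd.continuous (hmemT ha)
    have hb := hN a (hmem ha)
    have hta : 0 < t - a := by linarith [ha.2, ht.1]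
    have e1 : gauss t (fun y => U a y - V a y) x =
        gauss a (gauss (t - a) (fun y => U a y - V a y)) x := by
      rw [gauss_gauss ha.1.le hta.le hda hb, add_sub_cancel]
    rw [e1]
    have hbb : 0 ≤ N * a ^ (μ / 2) := (norm_nonneg _).trans (hb 0)
    have hsq : (√(2 * (t - a)))⁻¹ ≤ (√t)⁻¹ := inv_anti₀ (Real.sqrt_pos.2 ht.1)
      (Real.sqrt_le_sqrt (by linarith [ha.2]))
    have hm := gmMean_nonneg
    refine (norm_gauss_sub_self_le a (fun y =>
      (hasFDerivAt_gauss hta hda hb y).differentiableAt) (norm_gauss_le hb)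
      (N := (√t)⁻¹ * (gmMean * (N * a ^ (μ / 2)))) (fun y => ?_) x).trans (le_of_eq ?_)
    · rw [fderiv_gauss hta hda hb]
      refine (norm_gaussGrad_le hb y).trans ?_
      gcongr
    · rw [Real.sqrt_mul zero_le_two, Real.rpow_add ha.1, ← Real.sqrt_eq_rpow]
      ring
  have hlim : Tendsto (fun a => gauss (t - a) (fun y => U a y - V a y) x -
      gauss (t - a) (duh 0 f a) x) (𝓝[>] 0) (𝓝 0) := by
    have := (l2.sub l3).sub l1
    simpa using this
  have hconst : Tendsto (fun _ : ℝ => U t x - V t x - duh 0 f t x) (𝓝[>] 0) (𝓝 0) := by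
    refine hlim.congr' ?_
    filter_upwards [hev] with a ha
    exact (key a ha).symm
  exact sub_eq_zero.1 (tendsto_nhds_unique tendsto_const_nhds hconst)

/-- A Grönwall argument in the weighted norm with the extra factor `e^{-lt}`. For `l` large, one use
of the integral equation halves the norm of the difference, so no further smallness of `T'` is
required. -/
theorem IsFlow.unique_aux (hE : Exponents η μ ν) (hU : IsFlow B C μ A T U)
    (hV : IsFlow B C μ A T V) {T' a : ℝ} (hT0 : 0 < T') (hT' : T' < T) (hT1 : T' ≤ 1) (ha : 0 ≤ a)
    (hHb : ∀ t ∈ Ioo 0 T', ∀ x, ‖heat t A x‖ ≤ a * t ^ (η / 2))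
    (hPb : ∀ t ∈ Ioo 0 T', ∀ x, ‖fderiv ℝ (heat t A) x‖ ≤ a * t ^ ((η - 1) / 2)) :
    ∀ t ∈ Ioo 0 T', ∀ x, U t x = V t x := by
  have hν := hE.nu_pos
  have hμ := hE.mu_mem
  have hν1 : ν < 1 / 2 := by linarith [hE.le_quad, hμ.2]
  obtain ⟨N₁, hN₁0, hN₁⟩ := hU.exists_bound (hT0.trans hT') hμ.2 hT' hT1
  obtain ⟨N₂, hN₂0, hN₂⟩ := hV.exists_bound (hT0.trans hT') hμ.2 hT' hT1
  set ρ := max N₁ N₂ with hρ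
  have hρ0 : 0 ≤ ρ := le_max_of_le_left hN₁0
  have hsub : Ioo 0 T' ⊆ Ioo 0 T := Ioo_subset_Ioo_right hT'.le
  have hpn : ∀ {t : ℝ} (_ : t ∈ Ioo 0 T') (e : ℝ), 0 ≤ t ^ e := fun ht e =>
    Real.rpow_nonneg ht.1.le e
  have hUb : ∀ t ∈ Ioo 0 T', ∀ x, ‖U t x - heat t A x‖ ≤ ρ * t ^ (μ / 2) ∧
      ‖fderiv ℝ (U t) x - fderiv ℝ (heat t A) x‖ ≤ ρ * t ^ ((μ - 1) / 2) := fun t ht x =>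
    ⟨(hN₁ t ⟨ht.1, ht.2.le⟩ x).1.trans
      (mul_le_mul_of_nonneg_right (le_max_left _ _) (hpn ht _)),
    (hN₁ t ⟨ht.1, ht.2.le⟩ x).2.trans (mul_le_mul_of_nonneg_right (le_max_left _ _) (hpn ht _))⟩
  have hVb : ∀ t ∈ Ioo 0 T', ∀ x, ‖V t x - heat t A x‖ ≤ ρ * t ^ (μ / 2) ∧
      ‖fderiv ℝ (V t) x - fderiv ℝ (heat t A) x‖ ≤ ρ * t ^ ((μ - 1) / 2) := fun t ht x =>
    ⟨(hN₂ t ⟨ht.1, ht.2.le⟩ x).1.trans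
      (mul_le_mul_of_nonneg_right (le_max_right _ _) (hpn ht _)),
    (hN₂ t ⟨ht.1, ht.2.le⟩ x).2.trans (mul_le_mul_of_nonneg_right (le_max_right _ _) (hpn ht _))⟩
  set c := 3 * (‖B‖ + ‖C‖) * ((a + ρ) + (a + ρ) ^ 2) with hc
  have hc0 : 0 ≤ c := by positivity
  set f := fun t x => nonlin B C U t x - nonlin B C V t x with hf
  have hfc : TorusCont (Ioo 0 T') f := (hU.torusCont_nonlin.sub hV.torusCont_nonlin).mono hsub
  have hfb : ∀ t ∈ Ioo 0 T', ∀ D, 0 ≤ D → (∀ x, ‖U t x - V t x‖ ≤ D * t ^ (μ / 2)) →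
      (∀ x, ‖fderiv ℝ (U t) x - fderiv ℝ (V t) x‖ ≤ D * t ^ ((μ - 1) / 2)) →
      ∀ x, ‖f t x‖ ≤ c * D * t ^ (ν - 1) := by
    intro t ht D hD h1 h2 x
    have h3 := hE.norm_nlin_sub_le (B := B) (C := C) ht.1 (ht.2.le.trans hT1) ha hρ0 hD
      (w := U t x - heat t A x) (w' := V t x - heat t A x)
      (z := fderiv ℝ (U t) x - fderiv ℝ (heat t A) x)
      (z' := fderiv ℝ (V t) x - fderiv ℝ (heat t A) x) (hHb t ht x) (hPb t ht x) (hUb t ht x).1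
      (hVb t ht x).1 (hVb t ht x).2 (by rw [sub_sub_sub_cancel_right]; exact h1 x)
      (by rw [sub_sub_sub_cancel_right]; exact h2 x)
    rwa [add_sub_cancel, add_sub_cancel, add_sub_cancel, add_sub_cancel] at h3
  have hd0 : ∀ t ∈ Ioo 0 T', (∀ x, ‖U t x - V t x‖ ≤ 2 * ρ * t ^ (μ / 2)) ∧
      (∀ x, ‖fderiv ℝ (U t) x - fderiv ℝ (V t) x‖ ≤ 2 * ρ * t ^ ((μ - 1) / 2)) := by
    refine fun t ht => ⟨fun x => ?_, fun x => ?_⟩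
    · rw [← sub_sub_sub_cancel_right (U t x) (V t x) (heat t A x)]
      exact (norm_sub_le_of_le (hUb t ht x).1 (hVb t ht x).1).trans (le_of_eq (by ring))
    · rw [← sub_sub_sub_cancel_right (fderiv ℝ (U t) x) _ (fderiv ℝ (heat t A) x)]
      exact (norm_sub_le_of_le (hUb t ht x).2 (hVb t ht x).2).trans (le_of_eq (by ring))
  have hs : Source 0 T' 0 (1 - ν) (c * (2 * ρ)) f := Source.of_norm_le hfc fun r hr x => by
    rw [sub_zero, neg_sub]
    exact hfb r hr _ (by positivity) (hd0 r hr).1 (hd0 r hr).2 x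
  have hdeq : ∀ t ∈ Ioo 0 T', ∀ x, U t x - V t x = duh 0 f t x :=
    IsFlow.sub_eq_duh ⟨by linarith [hμ.1], hμ.2⟩ hν hU hV hT'.le hs (by positivity)
      fun t ht => (hd0 t ht).1
  have hdeq' : ∀ t ∈ Ioo 0 T', ∀ x, fderiv ℝ (U t) x - fderiv ℝ (V t) x = duhGrad 0 f t x := by
    intro t ht x
    rw [← (hs.hasFDerivAt_duh (by norm_num) (by linarith) ht x).fderiv, ← funext (hdeq t ht),
      fderiv_fun_sub (((hU.smooth t (hsub ht)).differentiable (by simp)) x)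
        (((hV.smooth t (hsub ht)).differentiable (by simp)) x)]
  -- Small enough that the kernels `(t - r)^{-ε}` and `(t - r)^{-1/2-ε}` stay integrable and a
  -- positive power `t^{ν-ε}` is left over.
  set ε := ν / 2 with hε
  have hε0 : 0 < ε := half_pos hν
  set b := betaI ε (1 - ν) + gmMean * betaI (1 / 2 + ε) (1 - ν) with hb
  have hb1 := betaI_nonneg ε (1 - ν)
  have hb2 := betaI_nonneg (1 / 2 + ε) (1 - ν)
  have hm := gmMean_nonneg
  have hb0 : 0 ≤ b := by positivity
  -- The witness is chosen so that `l^{-ε} = 1 / (2 c b + 1)`.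
  obtain ⟨l, hl0, hl⟩ : ∃ l : ℝ, 0 < l ∧ c * b * l ^ (-ε) ≤ 1 / 2 := by
    refine ⟨(2 * (c * b) + 1) ^ (1 / ε), by positivity, ?_⟩
    rw [← Real.rpow_mul (by positivity), mul_neg, one_div_mul_cancel hε0.ne', Real.rpow_neg_one,
      mul_inv_le_iff₀ (by positivity)]
    linarith
  have step : ∀ D, 0 ≤ D → (∀ t ∈ Ioo 0 T',
      (∀ x, ‖U t x - V t x‖ ≤ D * Real.exp (l * t) * t ^ (μ / 2)) ∧
      (∀ x, ‖fderiv ℝ (U t) x - fderiv ℝ (V t) x‖ ≤ D * Real.exp (l * t) * t ^ ((μ - 1) / 2))) →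
      (∀ t ∈ Ioo 0 T', (∀ x, ‖U t x - V t x‖ ≤ D / 2 * Real.exp (l * t) * t ^ (μ / 2)) ∧
      (∀ x, ‖fderiv ℝ (U t) x - fderiv ℝ (V t) x‖ ≤
        D / 2 * Real.exp (l * t) * t ^ ((μ - 1) / 2))) := by
    intro D hD h t ht
    have hfr : ∀ r ∈ Ioo 0 t, ∀ x, ‖f r x‖ ≤
        c * D * Real.exp (l * t) * l ^ (-ε) * (t - r) ^ (-ε) * r ^ (ν - 1) := by
      intro r hr x
      have hr' : r ∈ Ioo 0 T' := ⟨hr.1, hr.2.trans ht.2⟩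
      have htr : 0 < t - r := sub_pos.2 hr.2
      refine (hfb r hr' _ (by positivity) (h r hr').1 (h r hr').2 x).trans ?_
      have h1 : Real.exp (l * r) ≤ Real.exp (l * t) * (l ^ (-ε) * (t - r) ^ (-ε)) := by
        rw [← Real.mul_rpow hl0.le htr.le, show l * r = l * t + -(l * (t - r)) by ring, Real.exp_add]
        gcongr
        exact exp_neg_le_rpow (mul_pos hl0 htr) hε0.le (by linarith)
      have := hpn hr' (ν - 1)
      calc c * (D * Real.exp (l * r)) * r ^ (ν - 1) ≤
            c * (D * (Real.exp (l * t) * (l ^ (-ε) * (t - r) ^ (-ε)))) * r ^ (ν - 1) := by gcongr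
        _ = _ := by ring
    have hK0 : 0 ≤ c * D * Real.exp (l * t) * l ^ (-ε) := by
      have := Real.rpow_nonneg hl0.le (-ε)
      positivity
    have hne : ∀ᵐ r : ℝ, r ≠ t := by simp [ae_iff]
    have ht1 : t ≤ 1 := ht.2.le.trans hT1
    have hfin : ∀ {e₁ e₂ b' : ℝ}, 0 ≤ b' → b' ≤ b → e₂ ≤ e₁ →
        c * D * Real.exp (l * t) * l ^ (-ε) * (t ^ e₁ * b') ≤
          D / 2 * Real.exp (l * t) * t ^ e₂ := by
      intro e₁ e₂ b' hb'0 hb' he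
      have h1 : t ^ e₁ ≤ t ^ e₂ := Real.rpow_le_rpow_of_exponent_ge ht.1 ht1 he
      have := hpn ht e₁
      have := hpn ht e₂
      calc _ ≤ c * D * Real.exp (l * t) * l ^ (-ε) * (t ^ e₂ * b) := by gcongr
        _ = D * Real.exp (l * t) * t ^ e₂ * (c * b * l ^ (-ε)) := by ring
        _ ≤ D * Real.exp (l * t) * t ^ e₂ * (1 / 2) := by gcongr
        _ = _ := by ring
    constructor
    · intro x
      rw [hdeq t ht x, duh]
      refine (intervalIntegral.norm_integral_le_of_norm_le ht.1.le ?_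
        ((intervalIntegrable_singular (p := ε) (q := 1 - ν) (by linarith) (by linarith)
          ht.1).const_mul (c * D * Real.exp (l * t) * l ^ (-ε)))).trans ?_
      · refine hne.mono fun r hr1 hr => ?_
        refine (norm_gauss_le (hfr r ⟨hr.1, lt_of_le_of_ne hr.2 hr1⟩) x).trans (le_of_eq ?_)
        rw [sub_zero, neg_sub]
        ring
      · rw [intervalIntegral.integral_const_mul, integral_singular ht.1, sub_zero]
        exact hfin hb1 (le_add_of_nonneg_right (by positivity)) (by linarith [hμ.2])
    · intro x
      rw [hdeq' t ht x, duhGrad]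
      refine (intervalIntegral.norm_integral_le_of_norm_le ht.1.le ?_
        ((intervalIntegrable_singular (p := 1 / 2 + ε) (q := 1 - ν) (by linarith) (by linarith)
          ht.1).const_mul (c * D * Real.exp (l * t) * l ^ (-ε) * gmMean))).trans ?_
      · refine hne.mono fun r hr1 hr => ?_
        have hrt : r < t := lt_of_le_of_ne hr.2 hr1
        have hr' : r ∈ Ioo 0 T' := ⟨hr.1, hrt.trans ht.2⟩
        refine (norm_gaussGrad_le_of_gauss (sub_pos.2 hrt) (hfc.continuous hr')
          (hfr r ⟨hr.1, hrt⟩) (norm_gauss_le (hfr r ⟨hr.1, hrt⟩)) x).trans (le_of_eq ?_)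
        rw [sub_zero, neg_sub, neg_add, Real.rpow_add (sub_pos.2 hrt)]
        ring
      · rw [intervalIntegral.integral_const_mul, integral_singular ht.1, sub_zero, mul_assoc _ gmMean,
          mul_left_comm gmMean]
        exact hfin (by positivity) (le_add_of_nonneg_left hb1) (by linarith [hμ.2])
  have hall : ∀ n : ℕ, ∀ t ∈ Ioo 0 T',
      (∀ x, ‖U t x - V t x‖ ≤ 2 * ρ * (1 / 2) ^ n * Real.exp (l * t) * t ^ (μ / 2)) ∧
      (∀ x, ‖fderiv ℝ (U t) x - fderiv ℝ (V t) x‖ ≤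
        2 * ρ * (1 / 2) ^ n * Real.exp (l * t) * t ^ ((μ - 1) / 2)) := by
    intro n
    induction n with
    | zero =>
      intro t ht
      have h1 : 1 ≤ Real.exp (l * t) := Real.one_le_exp (mul_nonneg hl0.le ht.1.le)
      have h2 : 2 * ρ ≤ 2 * ρ * (1 / 2) ^ 0 * Real.exp (l * t) := by
        rw [pow_zero, mul_one]
        exact le_mul_of_one_le_right (by positivity) h1
      exact ⟨fun x => ((hd0 t ht).1 x).trans (mul_le_mul_of_nonneg_right h2 (hpn ht _)),
        fun x => ((hd0 t ht).2 x).trans (mul_le_mul_of_nonneg_right h2 (hpn ht _))⟩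
    | succ n ih =>
      have h1 := step _ (by positivity) ih
      have e1 : 2 * ρ * (1 / 2) ^ (n + 1) = 2 * ρ * (1 / 2) ^ n / 2 := by ring
      rw [e1]
      exact h1
  intro t ht x
  have hlim : Tendsto (fun n : ℕ => 2 * ρ * (1 / 2) ^ n * Real.exp (l * t) * t ^ (μ / 2)) atTop
      (𝓝 0) := by
    simpa using (((tendsto_pow_atTop_nhds_zero_of_lt_one (r := (1 / 2 : ℝ)) (by norm_num)
      (by norm_num)).const_mul (2 * ρ)).mul_const (Real.exp (l * t))).mul_const (t ^ (μ / 2))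
  have h0 := ge_of_tendsto' hlim fun n => (hall n t ht).1 x
  exact sub_eq_zero.1 (norm_le_zero_iff.1 h0)

end Uniqueness

/-! ### The Yang--Mills heat flow -/

section YangMills

variable {𝔤 : Type u} [CompactLieAlgebra 𝔤] [FiniteDimensional ℝ 𝔤]

theorem isYMHeatFlow_iff {μ : ℝ} {A : TDist (Conn 𝔤)} {T : ℝ} {U : ℝ → E3 → Conn 𝔤} :
    IsYMHeatFlow μ A T U ↔ IsFlow (quadB 𝔤) (cubicC 𝔤) μ A T U := by
  have e1 : ∀ t x, Laplacian.laplacian (U t) x + quadTerm (U t) x + cubicTerm (U t) x =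
      Laplacian.laplacian (U t) x + nonlin (quadB 𝔤) (cubicC 𝔤) U t x := fun t x => by
    rw [add_assoc, quadTerm_eq, cubicTerm_eq, nonlin]
  constructor
  · intro h
    exact ⟨⟨h.periodic, h.smooth, h.continuous_time⟩, fun t ht x => e1 t x ▸ h.equation t ht x,
      h.initial, h.wellposed_class⟩
  · intro h
    exact ⟨h.per, h.smooth, h.cont, fun t ht x => (e1 t x).symm ▸ h.equation t ht x, h.initial,
      h.wellposed⟩

theorem IsFlow.mono {F : Type u} [NormedAddCommGroup F] [NormedSpace ℝ F]
    {B : F →L[ℝ] (E3 →L[ℝ] F) →L[ℝ] F} {C : F →L[ℝ] F →L[ℝ] F →L[ℝ] F} {μ T T' : ℝ} {A : TDist F}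
    {U : ℝ → E3 → F} (h : IsFlow B C μ A T U) (hT : T' ≤ T) : IsFlow B C μ A T' U :=
  have hs : Ioo 0 T' ⊆ Ioo 0 T := Ioo_subset_Ioo_right hT
  ⟨⟨fun t ht => h.per t (hs ht), fun t ht => h.smooth t (hs ht),
    fun n => (h.cont n).mono (prod_mono hs subset_rfl)⟩, fun t ht => h.equation t (hs ht),
    h.initial, h.wellposed⟩

theorem Source.mono {F : Type u} [NormedAddCommGroup F] [NormedSpace ℝ F] {a T p q M : ℝ}
    {f : ℝ → E3 → F} (h : Source a T p q M f) {T' : ℝ} (hT : T' ≤ T) : Source a T' p q M f :=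
  { h.toTorusCont.mono (Ioo_subset_Ioo_right hT) with
    bound := fun r k x hr hk hrk => h.bound r k x hr hk (hrk.trans_le hT) }

theorem Init.exponents {α θ γ δ ν : ℝ} (hI : Init α θ γ δ) (hν_pos : 0 < ν)
    (hν_le : ν ≤ min (etaOf α θ / 2 + muOf γ δ / 2 + 1 / 2)
      (min (1 + 3 * etaOf α θ / 2) (muOf γ δ + 1 / 2))) :
    Exponents (etaOf α θ) (muOf γ δ) ν where
  nu_pos := hν_pos
  mu_mem := hI.mu_mem
  le_mixed := (le_min_iff.1 hν_le).1
  le_cubic := (le_min_iff.1 (le_min_iff.1 hν_le).2).1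
  le_quad := (le_min_iff.1 (le_min_iff.1 hν_le).2).2

theorem ymHeatFlow_eq_some {μ : ℝ} {A : TDist (Conn 𝔤)} {s : ℝ} {u : E3 → Conn 𝔤}
    (hu : IsFlowValue μ A s u) (huniq : ∀ u', IsFlowValue μ A s u' → u' = u) :
    ymHeatFlow μ A s = some u := by
  have h : ∃! u, IsFlowValue μ A s u := ⟨u, hu, huniq⟩
  rw [ymHeatFlow, dif_pos h, huniq _ h.choose_spec.1]

theorem duhamelIntegrand_eq {s : ℝ} (A : TDist (Conn 𝔤)) (x : E3) {r : ℝ} (hr : r ∈ Ioo 0 s) :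
    duhamelIntegrand s A x r = gauss (s - r) (quadHeat (quadB 𝔤) A r) x := by
  have h := torusCont_quadTerm_heat s A
  exact heatFn_eq_gauss (sub_pos.2 hr.2) (h.continuous hr) (h.per r hr) x

/-- Raising `s S^{2/ν} ≤ c` to the power `ν/2` gives `s^{ν/2} S ≤ c^{ν/2}`, which together with `s ≤
c` bounds both `s^ν S` and `s^ν S²` by `c^ν`. This is where the exponent `2/ν` comes from. -/
theorem small_time {W c ν S s : ℝ} (hν : 0 < ν) (hν1 : ν < 1) (hc1 : c ≤ 1)
    (hcW : 4 * c ^ ν * W ≤ 1 / 4) (hW : 0 ≤ W) (hS : 0 ≤ S) (hs : 0 < s) (hsc : s ≤ c)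
    (hsS : s * S ^ (2 / ν) ≤ c) : W * (S + S ^ 2) * (2 * s) ^ ν ≤ 1 / 4 := by
  have hc0 : 0 < c := hs.trans_le hsc
  set κ := c ^ (ν / 2) with hκ
  have hκ0 : 0 ≤ κ := Real.rpow_nonneg hc0.le _
  have hκκ : κ * κ = c ^ ν := by
    rw [hκ, ← Real.rpow_add hc0, add_halves]
  have h1 : s ^ (ν / 2) * S ≤ κ := by
    have := Real.rpow_le_rpow (by positivity) hsS (half_pos hν).le
    rwa [Real.mul_rpow hs.le (by positivity), ← Real.rpow_mul hS, div_mul_div_cancel₀ hν.ne',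
      div_self two_ne_zero, Real.rpow_one] at this
  have h2 : s ^ (ν / 2) ≤ κ := Real.rpow_le_rpow hs.le hsc (half_pos hν).le
  set τ := s ^ (ν / 2) with hτ
  have hτ0 : 0 ≤ τ := Real.rpow_nonneg hs.le _
  have hττ : τ * τ = s ^ ν := by
    rw [hτ, ← Real.rpow_add hs, add_halves]
  have h3 : (2 * s) ^ ν ≤ 2 * (τ * τ) := by
    rw [hττ, Real.mul_rpow zero_le_two hs.le]
    gcongr
    calc (2 : ℝ) ^ ν ≤ 2 ^ (1 : ℝ) := Real.rpow_le_rpow_of_exponent_le one_le_two hν1.le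
      _ = 2 := Real.rpow_one 2
  have h4 : S * (τ * τ) ≤ κ * κ := by
    calc S * (τ * τ) = (τ * S) * τ := by ring
      _ ≤ κ * κ := mul_le_mul h1 h2 hτ0 hκ0
  have h5 : S ^ 2 * (τ * τ) ≤ κ * κ := by
    calc S ^ 2 * (τ * τ) = (τ * S) * (τ * S) := by ring
      _ ≤ κ * κ := mul_le_mul h1 h1 (by positivity) hκ0
  calc W * (S + S ^ 2) * (2 * s) ^ ν ≤ W * (S + S ^ 2) * (2 * (τ * τ)) := by gcongr
    _ = 2 * W * (S * (τ * τ) + S ^ 2 * (τ * τ)) := by ring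
    _ ≤ 2 * W * (κ * κ + κ * κ) := by gcongr
    _ = 4 * c ^ ν * W := by rw [hκκ]; ring
    _ ≤ _ := hcW

theorem mul_sq_add_cube_le {L K S : ℝ} (hL : 0 ≤ L) (hK : 0 ≤ K) (hS : 0 ≤ S) :
    L * ((K * S) ^ 2 + (K * S) ^ 3) ≤ L * (K + K ^ 2 + K ^ 3) * (S ^ 2 + S ^ 3) := by
  rw [mul_assoc]
  refine mul_le_mul_of_nonneg_left ?_ hL
  have h : 0 ≤ (K + K ^ 3) * S ^ 2 + (K + K ^ 2) * S ^ 3 := by positivity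
  linarith

theorem mul_add_sq_le {L K S : ℝ} (hL : 0 ≤ L) (hK : 0 ≤ K) (hS : 0 ≤ S) :
    L * (K * S + (K * S) ^ 2) ≤ L * (K + K ^ 2 + K ^ 3) * (S + S ^ 2) := by
  rw [mul_assoc]
  refine mul_le_mul_of_nonneg_left ?_ hL
  have h : 0 ≤ (K ^ 2 + K ^ 3) * S + (K + K ^ 3) * S ^ 2 := by positivity
  linarith

theorem sq_le_add_cube {S : ℝ} (hS : 0 ≤ S) : S ^ 2 ≤ S + S ^ 3 := by
  nlinarith [mul_nonneg hS (sq_nonneg (1 - S))]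

theorem exists_threshold {W ν : ℝ} (hW : 0 ≤ W) (hν : 0 < ν) :
    ∃ c > (0 : ℝ), c ≤ 1 / 2 ∧ 4 * c ^ ν * W ≤ 1 / 4 := by
  have hc₀ : (0 : ℝ) < (16 * (W + 1))⁻¹ := by positivity
  have hcpos : 0 < min (1 / 2) (((16 * (W + 1))⁻¹) ^ (1 / ν)) :=
    lt_min (by norm_num) (Real.rpow_pos_of_pos hc₀ _)
  refine ⟨_, hcpos, min_le_left _ _, ?_⟩
  have h1 : (min (1 / 2) (((16 * (W + 1))⁻¹) ^ (1 / ν))) ^ ν ≤ (16 * (W + 1))⁻¹ := by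
    refine (Real.rpow_le_rpow hcpos.le (min_le_right _ _) hν.le).trans_eq ?_
    rw [← Real.rpow_mul hc₀.le, one_div_mul_cancel hν.ne', Real.rpow_one]
  calc _ ≤ 4 * (16 * (W + 1))⁻¹ * W := by gcongr
    _ ≤ 1 / 4 := by
      rw [mul_assoc, inv_mul_eq_div, mul_div_assoc', div_le_iff₀ (by positivity)]
      linarith

-- The abstract flow theorem is run on `(0, 2s)`, so that `s` is an interior time, with all radii
-- proportional to `Σ(A)`.
set_option maxHeartbeats 1000000 in
variable (𝔤) in
theorem exists_expansion (α θ γ δ ν : ℝ) (hI : Init α θ γ δ) (hν_pos : 0 < ν)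
    (hν_le : ν ≤ min (etaOf α θ / 2 + muOf γ δ / 2 + 1 / 2)
      (min (1 + 3 * etaOf α θ / 2) (muOf γ δ + 1 / 2))) :
    ∃ c > (0 : ℝ), ∃ q > (0 : ℝ), ∃ C > (0 : ℝ),
      ∀ A ∈ stateSpace 𝔤 α θ γ δ,
        ∀ s : ℝ, 0 < s → s ≤ c → s * (sigma α θ γ δ A).toReal ^ q ≤ c →
          (∀ x, IntervalIntegrable (duhamelIntegrand s A x) volume 0 s) ∧
          ∃ R : E3 → Conn 𝔤,
            ymHeatFlow (muOf γ δ) A s =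
              some (fun x => heat s A x + (∫ r in (0 : ℝ)..s, duhamelIntegrand s A x r) + R x) ∧
            ∀ x, ‖R x‖ ≤ C * s ^ ν * ((sigma α θ γ δ A).toReal + (sigma α θ γ δ A).toReal ^ 3) := by
  have hE := hI.exponents hν_pos hν_le
  set η := etaOf α θ with hη
  set μ := muOf γ δ with hμdef
  have hγ0 : 0 < γ := by linarith [hI.gamma_mem.1]
  have hδ1 := hI.delta_mem.2
  have hν1 : ν < 1 := by linarith [hE.le_quad, hE.mu_mem.2]
  obtain ⟨K₁, hK₁, hheat⟩ := exists_heat_bounds (Conn 𝔤) (α := α) hI.theta_pos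
    (by linarith [hI.alpha_mem.2])
  obtain ⟨K₂, hK₂, hquad⟩ := exists_source_quadTerm 𝔤 (δ := δ) hγ0 hI.gamma_mem.2
  set p := (1 - γ) / 2 with hp
  have hp1 : p < 1 / 2 := by rw [hp]; linarith
  have hm := gmMean_nonneg
  have hb1 := betaI_nonneg p δ
  have hb2 := betaI_nonneg (p + 1 / 2) δ
  have h2p : (0 : ℝ) < 2 ^ p := Real.rpow_pos_of_pos two_pos _
  -- Controls both the Duhamel integral of the quadratic term and its gradient. The added `1` gives
  -- `K₃ ≥ 1`, so that the contribution `S / 4` of the remainder fits into the ball of radius `2 K₃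
  -- S`.
  set K₃ := K₂ * betaI p δ + gmMean * 2 ^ p * K₂ * betaI (p + 1 / 2) δ + 1 with hK₃
  have hK₃1 : 1 ≤ K₃ := by
    rw [hK₃]
    have : 0 ≤ K₂ * betaI p δ + gmMean * 2 ^ p * K₂ * betaI (p + 1 / 2) δ := by positivity
    linarith
  set K₄ := K₁ + 2 * K₃ with hK₄
  have hK₄0 : 0 < K₄ := by linarith
  set Λ := duhConst ν * (4 * (‖quadB 𝔤‖ + ‖cubicC 𝔤‖)) with hΛ
  have hΛ0 : 0 ≤ Λ := mul_nonneg (duhConst_nonneg ν) (by positivity)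
  set W := Λ * (K₄ + K₄ ^ 2 + K₄ ^ 3) with hW
  have hW0 : 0 ≤ W := by positivity
  -- The bound `c ≤ 1/2` ensures `2 s ≤ 1`, which keeps all times in the range of the estimates.
  obtain ⟨c, hcpos, hc2, hcW⟩ := exists_threshold hW0 hν_pos
  refine ⟨c, hcpos, 2 / ν, by positivity, 2 * W + 1, by positivity,
    fun A hA s hs hsc hsS => ?_⟩
  set S := (sigma α θ γ δ A).toReal with hS
  have hS0 : 0 ≤ S := ENNReal.toReal_nonneg
  have hAσ : sigma α θ γ δ A < ⊤ := hA
  have hsmall := small_time hν_pos hν1 (hc2.trans (by norm_num)) hcW hW0 hS0 hs hsc hsS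
  have hT : 0 < 2 * s := by linarith
  have hT1 : 2 * s ≤ 1 := by linarith
  have hQ1 : Source 0 1 p δ (K₂ * S) (quadHeat (quadB 𝔤) A) := hquad α θ A hAσ
  have hQ := hQ1.mono hT1
  have hb : ∀ s ∈ Ioo (0 : ℝ) 1, ∀ x, ‖heat s A x‖ ≤ K₁ * S * s ^ (η / 2) ∧
      ‖fderiv ℝ (heat s A) x‖ ≤ K₁ * S * s ^ ((η - 1) / 2) :=
    hheat A S hS0 fun s hs x v hv hv' => norm_lineInt_heat_le hI.alpha_mem.1 hAσ hs x v hv hv'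
  have hsub : Ioo 0 (2 * s) ⊆ Ioo 0 1 := Ioo_subset_Ioo_right hT1
  have hσ : K₁ * S + 2 * K₃ * S = K₄ * S := by rw [hK₄]; ring
  have hTν : 0 ≤ (2 * s) ^ ν := Real.rpow_nonneg hT.le _
  have e1 : 1 - p - δ = μ / 2 := by rw [hp, hμdef, muOf]; ring
  have e2 : 1 - (p + 1 / 2) - δ = (μ - 1) / 2 := by rw [hp, hμdef, muOf]; ring
  have hpoly : Λ * ((K₄ * S) ^ 2 + (K₄ * S) ^ 3) ≤ W * (S ^ 2 + S ^ 3) :=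
    mul_sq_add_cube_le hΛ0 hK₄0.le hS0
  have hpoly' : Λ * (K₄ * S + (K₄ * S) ^ 2) ≤ W * (S + S ^ 2) :=
    mul_add_sq_le hΛ0 hK₄0.le hS0
  obtain ⟨U, hU, hUR⟩ := exists_flow (B := quadB 𝔤) (C := cubicC 𝔤) hE A (T := 2 * s)
    (a := K₁ * S) (a₀ := K₃ * S) (ρ := 2 * K₃ * S) (p := p) (δ := δ) (MQ := K₂ * S)
    (LQ := ‖quadL 𝔤‖ * S) hT hT1 (by positivity) (by positivity)
    (fun t ht x => (hb t (hsub ht) x).1) (fun t ht x => (hb t (hsub ht) x).2) hQ hp1 hδ1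
    (fun r hr x v hv => by
      refine (norm_lineInt_quadTerm_le hγ0 hAσ (hsub hr) x v hv).trans ?_
      have h1 := Real.rpow_nonneg hr.1.le (-δ)
      exact mul_le_of_le_one_right (by positivity)
        (Real.rpow_le_one (norm_nonneg _) (hv.trans (by norm_num)) hγ0.le))
    (fun t ht x => by
      refine (hQ.norm_duh_le (by linarith) hδ1 ht x).trans ?_
      have h1 := Real.rpow_nonneg ht.1.le (μ / 2)
      rw [sub_zero, e1]
      calc _ = (K₂ * betaI p δ) * S * t ^ (μ / 2) := by ring
        _ ≤ _ := by
          gcongr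
          rw [hK₃]
          have : 0 ≤ gmMean * 2 ^ p * K₂ * betaI (p + 1 / 2) δ := by positivity
          linarith)
    (fun t ht x => by
      refine (hQ.norm_duhGrad_le hp1 hδ1 ht x).trans ?_
      have h1 := Real.rpow_nonneg ht.1.le ((μ - 1) / 2)
      rw [sub_zero, e2]
      calc _ = (gmMean * 2 ^ p * K₂ * betaI (p + 1 / 2) δ) * S * t ^ ((μ - 1) / 2) := by ring
        _ ≤ _ := by
          gcongr
          rw [hK₃]
          have : 0 ≤ K₂ * betaI p δ := by positivity
          linarith)
    (by
      rw [hσ, ← mul_assoc (duhConst ν), ← hΛ]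
      calc K₃ * S + Λ * ((K₄ * S) ^ 2 + (K₄ * S) ^ 3) * (2 * s) ^ ν
          ≤ K₃ * S + W * (S ^ 2 + S ^ 3) * (2 * s) ^ ν := by gcongr
        _ = K₃ * S + S * (W * (S + S ^ 2) * (2 * s) ^ ν) := by ring
        _ ≤ K₃ * S + S * (1 / 4) := by gcongr
        _ = (K₃ + 1 / 4) * S := by ring
        _ ≤ 2 * K₃ * S := by
          gcongr
          linarith only [hK₃1])
    (by
      rw [hσ]
      have h3 : duhConst ν * (3 * (‖quadB 𝔤‖ + ‖cubicC 𝔤‖) * (K₄ * S + (K₄ * S) ^ 2)) ≤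
          Λ * (K₄ * S + (K₄ * S) ^ 2) := by
        have h4 : 0 ≤ duhConst ν * (‖quadB 𝔤‖ + ‖cubicC 𝔤‖) * (K₄ * S + (K₄ * S) ^ 2) :=
          mul_nonneg (mul_nonneg (duhConst_nonneg ν) (by positivity)) (by positivity)
        rw [hΛ]
        linarith only [h4]
      calc _ ≤ W * (S + S ^ 2) * (2 * s) ^ ν :=
            mul_le_mul_of_nonneg_right (h3.trans hpoly') hTν
        _ ≤ 1 / 4 := hsmall
        _ ≤ 1 / 2 := by norm_num)
  have hs2 : s ∈ Ioo 0 (2 * s) := ⟨hs, by linarith⟩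
  have hint : ∀ x, ∫ r in (0 : ℝ)..s, duhamelIntegrand s A x r = duh 0 (quadHeat (quadB 𝔤) A) s x :=
    fun x => intervalIntegral.integral_congr_uIoo fun r hr => by
      rw [uIoo_of_le hs.le] at hr
      exact duhamelIntegrand_eq A x hr
  refine ⟨fun x => ?_, fun x => U s x - (heat s A x + duh 0 (quadHeat (quadB 𝔤) A) s x), ?_,
    fun x => ?_⟩
  · refine (hQ.kernel.intervalIntegrable (by linarith) hδ1 hs hs2.2 x).congr_uIoo fun r hr => ?_
    rw [uIoo_of_le hs.le] at hr
    exact (duhamelIntegrand_eq A x hr).symm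
  · have e3 : (fun x => heat s A x + (∫ r in (0 : ℝ)..s, duhamelIntegrand s A x r) +
        (U s x - (heat s A x + duh 0 (quadHeat (quadB 𝔤) A) s x))) = U s := by
      funext x
      rw [hint, add_sub_cancel]
    rw [e3]
    refine ymHeatFlow_eq_some ⟨2 * s, U, hs2, isYMHeatFlow_iff.2 hU, rfl⟩ ?_
    rintro u' ⟨T', U', hsT', hU', rfl⟩
    have hs3 : s < min T' (2 * s) := lt_min hsT'.2 hs2.2
    -- An arbitrary solution may live on a different interval. The comparison takes place up to a
    -- time strictly between `s` and both lifetimes, where the weighted bounds are uniform.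
    obtain ⟨T'', hsT'', hT''⟩ := exists_between hs3
    have hT''1 : T'' ≤ 1 := hT''.le.trans ((min_le_right _ _).trans hT1)
    funext x
    exact ((isYMHeatFlow_iff.1 hU').mono (min_le_left _ _)).unique_aux hE
      (hU.mono (min_le_right _ _)) (hs.trans hsT'') hT'' hT''1 (a := K₁ * S) (by positivity)
      (fun t ht x => (hb t ⟨ht.1, ht.2.trans_le hT''1⟩ x).1)
      (fun t ht x => (hb t ⟨ht.1, ht.2.trans_le hT''1⟩ x).2) s ⟨hs, hsT''⟩ x
  · refine (hUR s hs2 x).trans ?_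
    have hsν := Real.rpow_nonneg hs.le ν
    rw [hσ, ← mul_assoc (duhConst ν), ← hΛ]
    have hS2 : S ^ 2 ≤ S + S ^ 3 := sq_le_add_cube hS0
    calc Λ * ((K₄ * S) ^ 2 + (K₄ * S) ^ 3) * s ^ ν ≤ W * (S ^ 2 + S ^ 3) * s ^ ν := by gcongr
      _ ≤ W * (2 * (S + S ^ 3)) * s ^ ν := by
          gcongr
          linarith only [hS2, hS0, pow_nonneg hS0 3]
      _ = 2 * W * s ^ ν * (S + S ^ 3) := by ring
      _ ≤ _ := by
          gcongr
          linarith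

end YangMills

end YM

end

theorem mainTheorem6 {𝔤 : Type*} [YM.CompactLieAlgebra 𝔤] [FiniteDimensional ℝ 𝔤]
    (α θ γ δ ν : ℝ) (hI : YM.Init α θ γ δ) (hν_pos : 0 < ν)
    (hν_le : ν ≤ min (YM.etaOf α θ / 2 + YM.muOf γ δ / 2 + 1 / 2)
      (min (1 + 3 * YM.etaOf α θ / 2) (YM.muOf γ δ + 1 / 2))) :
    ∃ c > (0 : ℝ), ∃ q > (0 : ℝ), ∃ C > (0 : ℝ),
      ∀ A ∈ YM.stateSpace 𝔤 α θ γ δ,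
        ∀ s : ℝ, 0 < s → s ≤ c → s * (YM.sigma α θ γ δ A).toReal ^ q ≤ c →
          (∀ x, IntervalIntegrable (YM.duhamelIntegrand s A x) MeasureTheory.volume 0 s) ∧
          ∃ R : YM.E3 → YM.Conn 𝔤,
            YM.ymHeatFlow (YM.muOf γ δ) A s =
              some (fun x => YM.heat s A x + (∫ r in (0 : ℝ)..s, YM.duhamelIntegrand s A x r)
                + R x) ∧
            ∀ x, ‖R x‖ ≤ C * s ^ ν *
              ((YM.sigma α θ γ δ A).toReal + (YM.sigma α θ γ δ A).toReal ^ 3) :=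
  YM.exists_expansion 𝔤 α θ γ δ ν hI hν_pos hν_le
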